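/- **Setting.** A finite-state generalized semi-Markov process (GSMP) consists of a finite set $S$ of states; for each $s\in S$ a nonempty finite set $I(s)$ of events (clocks) and rates $r_{s,i}>0$, $i\in I(s)$; a labelling $\mathtt{Props}:S\to 2^{AP}$; for $i\in I(s)$, $s'\in S$, $i'\in I(s')$ a continuous probability density $t\mapsto f(t;s,i;s',i')$ on $[0,\infty)$; and for each $i\in I(s)$ a probability distribution $\mathtt{next}_i(s,\cdot)$ on $S$. From $\langle s,c\rangle$ with $c\in(0,\infty)^{I(s)}$, the clocks run down at their rates until the unique clock $i$ that reaches $0$ first does so, at time $\mathcal T(\langle s,c\rangle)=\min_j c_j/r_{s,j}$. Then $s'$ is chosen with probability $\mathtt{next}_i(s,s')$, the clocks in $I(s')\cap(I(s)\setminus\{i\})$ keep their current values, and each other clock $i'\in I(s')$ is set independently according to $f(\cdot;s,i;s',i')$. Let $\mathcal G$ be the set of generalized states: the pairs $\langle s,c\rangle$ for which a unique clock reaches $0$ first, in the pair itself and almost surely at every later step of this evolution, so that the evolution is a Markov chain on $\mathcal G$. A trace is a sequence $(g_n)$ in $\mathcal G$ with $\sum_n\mathcal T(g_n)=\infty$;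 it generates a function $[0,\infty)\to\mathcal G$ (the value at time $t$ is $g_n$ with its clocks run down for time $t-\sum_{j<n}\mathcal T(g_j)$, where $\sum_{j<n}\mathcal T(g_j)\le t<\sum_{j\le n}\mathcal T(g_j)$). $\mathtt{Traces}(g)$ is the law on traces of the chain started at $g$. Let $\mathcal M$ be the set of pseudometrics $m:\mathcal G\times\mathcal G\to[0,1]$ with $m(\langle s,c\rangle,\langle s',c'\rangle)=1$ whenever $\mathtt{Props}(s)\ne\mathtt{Props}(s')$, ordered by $m_1\preceq m_2$ iff $m_1\ge m_2$ pointwise. For functions $\phi,\psi:[0,\infty)\to\mathcal G$ let $$J(m)(\phi,\psi)=\max\Bigl(\sup_t\inf_{t'}\max(m(\phi(t),\psi(t')),|t-t'|),\ \sup_{t'}\inf_{t}\max(m(\phi(t),\psi(t')),|t-t'|)\Bigr),$$ and for a pseudometric $d$ and probability measures $P,Q$ let $W(d)(P,Q)=\inf_\rho\int d\,d\rho$ over all measures $\rho$ with marginals $P$ and $Q$ (upper integral if $d$ is not measurable). For $0<k<1$ define $\mathcal F_k(m)(\langle s,c\rangle,\langle s',c'\rangle)$ to be $k\,W(J(m))(\mathtt{Traces}\langle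 s,c\rangle,\mathtt{Traces}\langle s',c'\rangle)$ if $\mathtt{Props}(s)=\mathtt{Props}(s')$, and $1$ otherwise. Let $m_0=\top$ be the top element of $(\mathcal M,\preceq)$ (distance $0$ if the sets of propositions agree, $1$ otherwise), and $m_{n+1}=\mathcal F_k(m_n)$. **Lemma.** Let $0<k<1$. Then $\mathcal F_k$ has a maximum fixed point $m_{\mathcal F_k}$ in $(\mathcal M,\preceq)$, and the pseudometric space $(\mathcal G,m_{\mathcal F_k})$ is separable. Moreover, for all $n\ge 0$ and $g,g'\in\mathcal G$, $|m_{n+1}(g,g')-m_n(g,g')|\le k^{n+1}$ and $|m_{\mathcal F_k}(g,g')-m_n(g,g')|\le k^{n+1}/(1-k)$; in particular $m_n\to m_{\mathcal F_k}$ uniformly on $\mathcal G\times\mathcal G$. -/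

import Mathlib

open MeasureTheory ProbabilityTheory Filter Topology
open scoped ENNReal NNReal

/-! ### Pseudometrics and their liftings -/

/-- A `1`-bounded pseudometric on `X`. -/
structure IsPseudometric {X : Type*} (m : X → X → ℝ) : Prop where
  nonneg : ∀ x y, 0 ≤ m x y
  le_one : ∀ x y, m x y ≤ 1
  self : ∀ x, m x x = 0
  symm : ∀ x y, m x y = m y x
  triangle : ∀ x y z, m x z ≤ m x y + m y z

/-- The pseudometric space given by a pseudometric. -/
@[reducible]
def IsPseudometric.toPseudoMetricSpace {X : Type*} {m : X → X → ℝ} (hm : IsPseudometric m) :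
    PseudoMetricSpace X where
  dist := m
  dist_self := hm.self
  dist_comm := hm.symm
  dist_triangle := hm.triangle

/-- `(X, m)` is separable: there is a countable subset dense for the topology of `m`. -/
def IsPseudometric.Separable {X : Type*} {m : X → X → ℝ} (hm : IsPseudometric m) : Prop :=
  @TopologicalSpace.SeparableSpace X hm.toPseudoMetricSpace.toUniformSpace.toTopologicalSpace

/-- The order on pseudometrics: `m₁ ⪯ m₂` if `m₁` is pointwise at least `m₂`. -/
def PMetLE {X : Type*} (m₁ m₂ : X → X → ℝ) : Prop := ∀ x y, m₂ x y ≤ m₁ x y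

/-- The (upper) integral of a function: the infimum of the integrals of its measurable majorants.
It is the integral of `ENNReal.ofReal ∘ c` when `c` is measurable. -/
noncomputable def upperIntegral {Ω : Type*} [MeasurableSpace Ω] (ρ : Measure Ω) (c : Ω → ℝ) :
    ℝ≥0∞ :=
  ⨅ (φ : Ω → ℝ≥0∞) (_ : Measurable φ) (_ : ∀ ω, ENNReal.ofReal (c ω) ≤ φ ω), ∫⁻ ω, φ ω ∂ρ

/-- The Wasserstein lifting: the infimum of `∫ m dρ` over all measures `ρ` on `Ω × Ω` with
marginals `P` and `Q`. -/
noncomputable def wasserstein {Ω : Type*} [MeasurableSpace Ω] (m : Ω → Ω → ℝ)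
    (P Q : Measure Ω) : ℝ :=
  (⨅ (ρ : Measure (Ω × Ω)) (_ : ρ.map Prod.fst = P) (_ : ρ.map Prod.snd = Q),
    upperIntegral ρ (fun p => m p.1 p.2)).toReal

/-- The Skorohod `J₂` lifting: the Hausdorff distance between the graphs of `f` and `g`. -/
noncomputable def skorohodJ2 {X : Type*} (m : X → X → ℝ) (f g : ℝ≥0 → X) : ℝ :=
  max (⨆ t : ℝ≥0, ⨅ t' : ℝ≥0, max (m (f t) (g t')) |(t : ℝ) - t'|)
    (⨆ t' : ℝ≥0, ⨅ t : ℝ≥0, max (m (f t) (g t')) |(t : ℝ) - t'|)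

/-! ### Generalized semi-Markov processes -/

/-- A finite-state GSMP with states `S`, events (clocks) `E` and atomic propositions `AP`. -/
structure GSMP (S E AP : Type*) [Fintype S] [Fintype E] where
  /-- the set `I(s)` of events of the state `s` -/
  active : S → Finset E
  active_nonempty : ∀ s, (active s).Nonempty
  /-- the rate at which the clock `i ∈ I(s)` runs down in the state `s` -/
  rate : S → E → ℝ
  rate_pos : ∀ s, ∀ i ∈ active s, 0 < rate s i
  /-- the atomic propositions true in a state -/
  props : S → Set AP
  /-- `density s i s' i'` is the probability density `f(t; s, i; s', i')`, `t ≥ 0` -/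
  density : S → E → S → E → ℝ → ℝ
  density_continuous : ∀ s, ∀ i ∈ active s, ∀ s', ∀ i' ∈ active s',
    ContinuousOn (density s i s' i') (Set.Ici 0)
  density_nonneg : ∀ s, ∀ i ∈ active s, ∀ s', ∀ i' ∈ active s', ∀ t, 0 ≤ t →
    0 ≤ density s i s' i' t
  density_integral : ∀ s, ∀ i ∈ active s, ∀ s', ∀ i' ∈ active s',
    ∫⁻ t in Set.Ioi (0 : ℝ), ENNReal.ofReal (density s i s' i' t) = 1
  /-- `next i s s'` is the probability `next_i(s, s')` -/
  next : E → S → S → ℝ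
  next_nonneg : ∀ s, ∀ i ∈ active s, ∀ s', 0 ≤ next i s s'
  next_sum : ∀ s, ∀ i ∈ active s, ∑ s', next i s s' = 1

/-- A state together with a real number for every event. The clock vector of `s` is indexed by
`I(s)`; it is extended by `0` to the other events. -/
@[ext]
structure Config (S E : Type*) where
  state : S
  clock : E → ℝ

/-- The product of the discrete structure on states and the Borel structure on clock vectors. -/
instance Config.instMeasurableSpace {S E : Type*} : MeasurableSpace (Config S E) :=
  MeasurableSpace.comap (fun x => (x.state, x.clock))
    (@Prod.instMeasurableSpace S (E → ℝ) ⊤ inferInstance)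

namespace GSMP

variable {S E AP : Type*} [Fintype S] [Fintype E] (M : GSMP S E AP)

/-- The time that the clock `i` needs to run down to `0` if the state does not change. -/
noncomputable def runTime (x : Config S E) (i : E) : ℝ := x.clock i / M.rate x.state i

/-- `𝒯(⟨s, c⟩)`: the time required for the first clock to reach `0`. -/
noncomputable def firstTime (x : Config S E) : ℝ :=
  (M.active x.state).inf' (M.active_nonempty x.state) (M.runTime x)

/-- The clock `i ∈ I(s)` is the only one that reaches `0` first. -/
def FiresFirst (x : Config S E) (i : E) : Prop :=
  i ∈ M.active x.state ∧ ∀ j ∈ M.active x.state, j ≠ i → M.runTime x i < M.runTime x j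

/-- The clocks in `I(s)` have positive values, the other coordinates are `0`. -/
def Proper (x : Config S E) : Prop :=
  ∀ j, (j ∈ M.active x.state → 0 < x.clock j) ∧ (j ∉ M.active x.state → x.clock j = 0)

open Classical in
/-- The distribution of the value of the clock `j` when it is set in a transition from `s` to `s'`
through the event `i`; coordinates `j ∉ I(s')` are set to `0`. -/
noncomputable def resetLaw (s : S) (i : E) (s' : S) (j : E) : Measure ℝ :=
  if i ∈ M.active s ∧ j ∈ M.active s' then
    (volume.restrict (Set.Ioi 0)).withDensity (fun t => ENNReal.ofReal (M.density s i s' j t))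
  else Measure.dirac 0

open Classical in
/-- The configuration after a transition from `x` to `s'` through the event `i`, where `v` holds
the new values: clocks in `I(s') ∩ (I(s) \ {i})` carry forward their values, the others are set. -/
noncomputable def afterEvent (i : E) (x : Config S E) (s' : S) (v : E → ℝ) : Config S E :=
  ⟨s', fun j => if j ∈ M.active s' ∧ j ∈ M.active x.state ∧ j ≠ i
    then x.clock j - M.rate x.state j * M.runTime x i else v j⟩

/-- The distribution of the next configuration if the event `i` fires first in `x`: the state `s'`
is chosen with probability `next_i(s, s')` and the new clock values are drawn independently. -/
noncomputable def eventLaw (i : E) (x : Config S E) : Measure (Config S E) :=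
  ∑ s', ENNReal.ofReal (M.next i x.state s') •
    (Measure.pi (M.resetLaw x.state i s')).map (M.afterEvent i x s')

open Classical in
/-- The distribution of the next configuration. Configurations in which no unique clock reaches
`0` first stay put; they never occur below. -/
noncomputable def stepLaw (x : Config S E) : Measure (Config S E) :=
  if h : ∃ i, M.FiresFirst x i then M.eventLaw h.choose x else Measure.dirac x

variable {M} in
theorem FiresFirst.unique {x : Config S E} {i j : E} (hi : M.FiresFirst x i)
    (hj : M.FiresFirst x j) : i = j := by
  by_contra hne
  exact lt_asymm (hi.2 j hj.1 (Ne.symm hne)) (hj.2 i hi.1 hne)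

theorem stepLaw_of_firesFirst {x : Config S E} {i : E} (hi : M.FiresFirst x i) :
    M.stepLaw x = M.eventLaw i x := by
  have h : ∃ i, M.FiresFirst x i := ⟨i, hi⟩
  rw [stepLaw, dif_pos h, h.choose_spec.unique hi]

/-- `Good n` holds if, almost surely, in the initial configuration and in the first `n` following
ones, a unique clock reaches `0` first. -/
def Good : ℕ → Config S E → Prop
  | 0, x => M.Proper x ∧ ∃ i, M.FiresFirst x i
  | n + 1, x => (M.Proper x ∧ ∃ i, M.FiresFirst x i) ∧ ∀ᵐ y ∂(M.stepLaw x), Good n y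

/-- The generalized states: configurations with positive clock values such that, in them and
almost surely at every later stage of the evolution, a unique clock reaches `0` first. -/
abbrev GState : Type _ := {x : Config S E // ∀ n, M.Good n x}

/-! ### Measurability of the one-step law -/

theorem measurable_of_state {β : Type*} [MeasurableSpace β] {f : Config S E → β}
    (h : ∀ s, Measurable (fun c : E → ℝ => f ⟨s, c⟩)) : Measurable f := by
  let _ : MeasurableSpace S := ⊤
  have hg : Measurable (fun p : S × (E → ℝ) => f ⟨p.1, p.2⟩) :=
    measurable_from_prod_countable_right h
  exact hg.comp (comap_measurable (fun x : Config S E => (x.state, x.clock)))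

theorem measurable_config_mk (s : S) :
    Measurable (fun c : E → ℝ => (⟨s, c⟩ : Config S E)) := by
  let _ : MeasurableSpace S := ⊤
  exact measurable_comap_iff.2 measurable_prodMk_left

instance (s : S) (i : E) (s' : S) (j : E) : IsProbabilityMeasure (M.resetLaw s i s' j) := by
  unfold resetLaw
  split_ifs with h
  · constructor
    rw [withDensity_apply _ MeasurableSet.univ, Measure.restrict_univ]
    exact M.density_integral s i h.1 s' j h.2
  · infer_instance

theorem measurable_afterEvent (i : E) (s s' : S) :
    Measurable (fun p : (E → ℝ) × (E → ℝ) => M.afterEvent i ⟨s, p.1⟩ s' p.2) := by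
  unfold afterEvent runTime
  refine (measurable_config_mk s').comp (measurable_pi_lambda _ fun j => ?_)
  dsimp only
  split_ifs <;> fun_prop

theorem measurable_eventLaw (i : E) : Measurable (M.eventLaw i) := by
  refine measurable_of_state fun s => ?_
  refine Measure.measurable_of_measurable_coe _ fun B hB => ?_
  have hsec : ∀ (c : E → ℝ) (s' : S),
      Measurable (M.afterEvent i (⟨s, c⟩ : Config S E) s') := fun c s' =>
    (M.measurable_afterEvent i s s').comp measurable_prodMk_left
  have : (fun c : E → ℝ => M.eventLaw i (⟨s, c⟩ : Config S E) B) = fun c =>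
      ∑ s', ENNReal.ofReal (M.next i s s') * (Measure.pi (M.resetLaw s i s'))
        (Prod.mk c ⁻¹' ((fun p : (E → ℝ) × (E → ℝ) => M.afterEvent i ⟨s, p.1⟩ s' p.2) ⁻¹' B)) := by
    funext c
    simp only [eventLaw, Measure.coe_finsetSum, Finset.sum_apply, Measure.smul_apply,
      smul_eq_mul]
    refine Finset.sum_congr rfl fun s' _ => ?_
    rw [Measure.map_apply (hsec c s') hB]
    rfl
  rw [this]
  refine Finset.measurable_sum _ fun s' _ => Measurable.const_mul ?_ _
  exact measurable_measure_prodMk_left (M.measurable_afterEvent i s s' hB)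

theorem measurableSet_firesFirst (i : E) : MeasurableSet {x | M.FiresFirst x i} := by
  rw [← measurable_mem]
  refine measurable_of_state fun s => ?_
  refine (measurable_mem (s := {c : E → ℝ | M.FiresFirst (⟨s, c⟩ : Config S E) i})).2 ?_
  simp only [FiresFirst, runTime, Set.ofPred_and, Set.ofPred_forall]
  refine (MeasurableSet.const _).inter ?_
  refine MeasurableSet.iInter fun j => MeasurableSet.iInter fun _ => MeasurableSet.iInter fun _ =>
    measurableSet_lt ?_ ?_ <;> fun_prop

theorem measurableSet_proper : MeasurableSet {x | M.Proper x} := by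
  rw [← measurable_mem]
  refine measurable_of_state fun s => ?_
  refine (measurable_mem (s := {c : E → ℝ | M.Proper (⟨s, c⟩ : Config S E)})).2 ?_
  simp only [Proper, Set.ofPred_forall, Set.ofPred_and]
  refine MeasurableSet.iInter fun j => MeasurableSet.inter
    (MeasurableSet.iInter fun _ => measurableSet_lt ?_ ?_)
    (MeasurableSet.iInter fun _ => measurableSet_eq_fun ?_ ?_) <;> fun_prop

theorem measurableSet_exists_firesFirst : MeasurableSet {x | ∃ i, M.FiresFirst x i} := by
  rw [Set.ofPred_exists]
  exact MeasurableSet.iUnion M.measurableSet_firesFirst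

theorem measurable_stepLaw : Measurable M.stepLaw := by
  classical
  have : M.stepLaw = fun x => if ∃ i, M.FiresFirst x i then
      (∑ i, if M.FiresFirst x i then M.eventLaw i x else 0) else Measure.dirac x := by
    funext x
    split_ifs with h
    · obtain ⟨i, hi⟩ := h
      rw [M.stepLaw_of_firesFirst hi, Finset.sum_eq_single i, if_pos hi]
      · intro j _ hj
        exact if_neg fun hj' => hj (hj'.unique hi)
      · simp
    · rw [stepLaw, dif_neg h]
  rw [this]
  refine Measurable.ite M.measurableSet_exists_firesFirst ?_ Measure.measurable_dirac
  refine Measure.measurable_of_measurable_coe _ fun B hB => ?_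
  simp only [Measure.coe_finsetSum, Finset.sum_apply]
  refine Finset.measurable_sum _ fun i _ => ?_
  exact (Measure.measurable_coe hB).comp
    (Measurable.ite (M.measurableSet_firesFirst i) (M.measurable_eventLaw i) measurable_const)

instance (x : Config S E) : IsProbabilityMeasure (M.stepLaw x) := by
  unfold stepLaw
  split_ifs with h
  · constructor
    have hi := h.choose_spec.1
    have hm : ∀ s', Measurable (M.afterEvent h.choose x s') := fun s' =>
      (M.measurable_afterEvent h.choose x.state s').comp (measurable_prodMk_left (x := x.clock))
    simp only [eventLaw, Measure.coe_finsetSum, Finset.sum_apply, Measure.smul_apply,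
      smul_eq_mul]
    simp only [Measure.map_apply (hm _) MeasurableSet.univ, Set.preimage_univ, measure_univ,
      mul_one]
    rw [← ENNReal.ofReal_sum_of_nonneg fun s' _ => M.next_nonneg _ _ hi s', M.next_sum _ _ hi,
      ENNReal.ofReal_one]
  · infer_instance

/-- The one-step transition kernel. -/
noncomputable def stepKernel : Kernel (Config S E) (Config S E) where
  toFun := M.stepLaw
  measurable' := M.measurable_stepLaw

theorem measurableSet_good (n : ℕ) : MeasurableSet {x | M.Good n x} := by
  induction n with
  | zero => exact M.measurableSet_proper.inter M.measurableSet_exists_firesFirst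
  | succ n ih =>
    refine (M.measurableSet_proper.inter M.measurableSet_exists_firesFirst).inter ?_
    have h : Measurable fun x => M.stepLaw x {y | M.Good n y}ᶜ :=
      (Measure.measurable_coe ih.compl).comp M.measurable_stepLaw
    exact h (measurableSet_singleton 0)

theorem measurableEmbedding_val :
    MeasurableEmbedding (Subtype.val : M.GState → Config S E) := by
  have h : MeasurableSet {x | ∀ n, M.Good n x} := by
    rw [Set.ofPred_forall]
    exact MeasurableSet.iInter M.measurableSet_good
  exact MeasurableEmbedding.subtype_coe h

/-! ### The Markov process on generalized states and its traces -/

/-- The transition kernel of the Markov process on generalized states. -/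
noncomputable def kernel : Kernel M.GState M.GState :=
  (M.stepKernel.comap Subtype.val M.measurableEmbedding_val.measurable).comapRight
    M.measurableEmbedding_val

instance : IsMarkovKernel M.kernel := by
  refine Kernel.IsMarkovKernel.comapRight _ _ fun x => ?_
  change M.stepLaw x.1 _ = 1
  rw [← prob_compl_eq_zero_iff M.measurableEmbedding_val.measurableSet_range]
  have h : ∀ᵐ y ∂(M.stepLaw x.1), ∀ n, M.Good n y :=
    ae_all_iff.2 fun n => (x.2 (n + 1)).2
  refine measure_mono_null (fun y hy => ?_) h
  exact fun hy' => hy ⟨⟨y, hy'⟩, rfl⟩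

/-- The distribution of the sequence of generalized states visited from the generalized state
`x`: the law of the Markov chain with the kernel `M.kernel` started in `x`. -/
noncomputable def chainLaw (x : M.GState) : Measure (ℕ → M.GState) :=
  Kernel.traj (X := fun _ => M.GState)
    (fun n => M.kernel.comap (fun h : (i : Finset.Iic n) → M.GState => h ⟨n, by simp⟩)
      (measurable_pi_apply _)) 0 (fun _ => x)

/-- The total time spent in the first `n` generalized states of a sequence. -/
noncomputable def jumpTime (ω : ℕ → M.GState) (n : ℕ) : ℝ :=
  ∑ k ∈ Finset.range n, M.firstTime (ω k).1

/-- Finitely varying (non-Zeno) sequences of generalized states. -/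
abbrev Trace : Type _ := {ω : ℕ → M.GState // Tendsto (M.jumpTime ω) atTop atTop}

/-- The probability measure on traces induced by starting in `x`. -/
noncomputable def traceLaw (x : M.GState) : Measure M.Trace :=
  (M.chainLaw x).comap Subtype.val

open Classical in
/-- The configuration `⟨s, c - r t⟩`. -/
noncomputable def evolve (x : Config S E) (t : ℝ) : Config S E :=
  ⟨x.state, fun j => if j ∈ M.active x.state then x.clock j - M.rate x.state j * t else 0⟩

theorem runTime_evolve (x : Config S E) (t : ℝ) {j : E} (hj : j ∈ M.active x.state) :
    M.runTime (M.evolve x t) j = M.runTime x j - t := by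
  have := (M.rate_pos x.state j hj).ne'
  simp only [runTime, evolve, if_pos hj]
  field_simp

theorem firesFirst_evolve {x : Config S E} {i : E} (hi : M.FiresFirst x i) (t : ℝ) :
    M.FiresFirst (M.evolve x t) i := by
  refine ⟨hi.1, fun j hj hne => ?_⟩
  rw [M.runTime_evolve x t hi.1, M.runTime_evolve x t hj]
  exact sub_lt_sub_right (hi.2 j hj hne) t

theorem stepLaw_evolve {x : Config S E} {i : E} (hi : M.FiresFirst x i) (t : ℝ) :
    M.stepLaw (M.evolve x t) = M.stepLaw x := by
  rw [M.stepLaw_of_firesFirst hi, M.stepLaw_of_firesFirst (M.firesFirst_evolve hi t)]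
  have : ∀ s', M.afterEvent i (M.evolve x t) s' = M.afterEvent i x s' := by
    intro s'
    funext v
    refine Config.ext rfl (funext fun j => ?_)
    by_cases hj : j ∈ M.active s' ∧ j ∈ M.active x.state ∧ j ≠ i
    · have h1 : (M.afterEvent i (M.evolve x t) s' v).clock j =
          (M.evolve x t).clock j - M.rate x.state j * M.runTime (M.evolve x t) i := if_pos hj
      have h2 : (M.evolve x t).clock j = x.clock j - M.rate x.state j * t := if_pos hj.2.1
      have h3 : (M.afterEvent i x s' v).clock j =
          x.clock j - M.rate x.state j * M.runTime x i := if_pos hj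
      rw [h1, h2, h3, M.runTime_evolve x t hi.1]
      ring
    · have h1 : (M.afterEvent i (M.evolve x t) s' v).clock j = v j := if_neg hj
      have h3 : (M.afterEvent i x s' v).clock j = v j := if_neg hj
      rw [h1, h3]
  simp only [eventLaw, this]
  rfl

theorem good_evolve {x : Config S E} {n : ℕ} (hx : M.Good n x) {t : ℝ}
    (ht : t < M.firstTime x) : M.Good n (M.evolve x t) := by
  have key : M.Proper x ∧ (∃ i, M.FiresFirst x i) →
      M.Proper (M.evolve x t) ∧ ∃ i, M.FiresFirst (M.evolve x t) i := by
    rintro ⟨_, i, hi⟩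
    refine ⟨fun j => ⟨fun hj => ?_, fun hj => if_neg hj⟩, i, M.firesFirst_evolve hi t⟩
    have hj' : j ∈ M.active x.state := hj
    have h1 : t < M.runTime x j := ht.trans_le (Finset.inf'_le _ hj')
    have h2 := (lt_div_iff₀ (M.rate_pos x.state j hj')).1 h1
    simp only [evolve, if_pos hj']
    linarith
  cases n with
  | zero => exact key hx
  | succ n =>
    obtain ⟨i, hi⟩ := hx.1.2
    exact ⟨key hx.1, (M.stepLaw_evolve hi t).symm ▸ hx.2⟩

theorem exists_lt_jumpTime (ω : M.Trace) (t : ℝ) : ∃ n, t < M.jumpTime ω.1 (n + 1) :=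
  ((ω.2.comp (tendsto_add_atTop_nat 1)).eventually_gt_atTop t).exists

open Classical in
/-- The index of the generalized state occupied at time `t`: the `n` such that
`jumpTime n ≤ t < jumpTime (n + 1)`. -/
noncomputable def stage (ω : M.Trace) (t : ℝ≥0) : ℕ := Nat.find (M.exists_lt_jumpTime ω t)

theorem stage_spec (ω : M.Trace) (t : ℝ≥0) :
    M.jumpTime ω.1 (M.stage ω t) ≤ t ∧ (t : ℝ) < M.jumpTime ω.1 (M.stage ω t + 1) := by
  classical
  refine ⟨?_, Nat.find_spec (M.exists_lt_jumpTime ω t)⟩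
  rcases h : M.stage ω t with _ | n
  · simp [jumpTime]
  · exact not_lt.1 (Nat.find_min (M.exists_lt_jumpTime ω t) (show n < M.stage ω t by omega))

/-- The function `[0, ∞) → 𝒢` generated by a trace. -/
noncomputable def path (ω : M.Trace) (t : ℝ≥0) : M.GState :=
  ⟨M.evolve (ω.1 (M.stage ω t)).1 (t - M.jumpTime ω.1 (M.stage ω t)), fun n =>
    M.good_evolve ((ω.1 (M.stage ω t)).2 n) (by
      have h := (M.stage_spec ω t).2
      rw [jumpTime, Finset.sum_range_succ] at h
      rw [jumpTime]
      linarith)⟩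

/-! ### The functional and its maximum fixed point -/

/-- The atomic propositions true in a generalized state. -/
def propsOf (x : M.GState) : Set AP := M.props x.1.state

/-- The class `ℳ`: pseudometrics on generalized states that are `1` on generalized states whose
sets of true atomic propositions differ. -/
structure IsStateMetric (m : M.GState → M.GState → ℝ) : Prop extends IsPseudometric m where
  props_ne : ∀ x y, M.propsOf x ≠ M.propsOf y → m x y = 1

open Classical in
/-- The functional `ℱ_k` on `ℳ`. -/
noncomputable def functional (k : ℝ) (m : M.GState → M.GState → ℝ) (x y : M.GState) : ℝ :=
  if M.propsOf x = M.propsOf y then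
    k * wasserstein (fun ω ω' => skorohodJ2 m (M.path ω) (M.path ω')) (M.traceLaw x) (M.traceLaw y)
  else 1

/-- `m` is the maximum fixed point of `ℱ_k` in `(ℳ, ⪯)`. -/
structure IsMaxFixedPoint (k : ℝ) (m : M.GState → M.GState → ℝ) : Prop
    extends M.IsStateMetric m where
  fixed : M.functional k m = m
  greatest : ∀ m', M.IsStateMetric m' → M.functional k m' = m' → PMetLE m' m

open Classical in
/-- The top element of `(ℳ, ⪯)`. -/
noncomputable def topMetric (x y : M.GState) : ℝ := if M.propsOf x = M.propsOf y then 0 else 1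

/-- The iterates `m₀ = ⊤`, `mₙ₊₁ = ℱ_k(mₙ)`. -/
noncomputable def iter (k : ℝ) : ℕ → M.GState → M.GState → ℝ
  | 0 => M.topMetric
  | n + 1 => M.functional k (iter k n)

end GSMP

/-! ### Couplings and the Wasserstein lifting -/

/-! Fixed point. Neither the Skorohod lifting nor the Wasserstein lifting increases the sup distance
between costs (`skorohodJ2_le_add`, `wasserstein_le_add`), so `functional k` is a `k`-contraction of
the state metrics for the sup distance (`abs_functional_sub_le`). The first iterate is within `k` of
the top metric, which gives the geometric bounds, a uniform limit and its fixed point equation.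
Every fixed point is within `k ^ n` of the `n`-th iterate, so the fixed point is unique and in
particular maximum. That `functional k` maps state metrics to state metrics rests on two facts:
traces have total mass `1`, because almost every sequence is non-Zeno (`ae_nonZeno`), and the
Wasserstein lifting satisfies the triangle inequality even for nonmeasurable costs
(`wasserstein_triangle`).

Separability. Instead of continuity of the trace law in the initial state, the proof uses countable
measurable partitions into pieces of small diameter (`FinelyClassifiable`). This property passes to
uniform limits and implies separability, so it is enough that `functional k` preserves it
(`finelyClassifiable_functional`). An initial state influences the future only through the clocks
that have not been set since the start. Outside an event of small probability all of these are gone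
after some number `N` of transitions, and from then on the law of the future is absolutely
continuous with respect to one finite measure that does not depend on the initial state
(`chainLaw_renewed_eq_zero`). A trace is therefore replaced by a summary: the classes of its first
`N` states for a fine classification, and the exact sequence from then on. The summary laws,
restricted to the renewal event, are dominated by a single finite measure. Their densities lie in a
separable `L¹` space, so the initial states fall into countably many classes in which any two
summary laws have a large common part (`classifiable_common_part`). Traces coupled so as to have the
same summary have nearby paths.

For paths to be close during a whole stay in a state, and not only at its beginning, a second
invariant is carried along: letting time `t` pass moves a state by at most `t` (`TimeLipschitz`). A
classification at finitely many grid times then controls the stay (`classifiable_segmentClose`). -/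

theorem exists_gluing {X Y Z : Type*} [MeasurableSpace X] [MeasurableSpace Y] [MeasurableSpace Z]
    [StandardBorelSpace X] [Nonempty X] [StandardBorelSpace Z] [Nonempty Z]
    (ρ₁ : Measure (X × Y)) (ρ₂ : Measure (Y × Z)) [IsFiniteMeasure ρ₁] [IsFiniteMeasure ρ₂]
    (h : ρ₁.map Prod.snd = ρ₂.map Prod.fst) :
    ∃ ρ : Measure (Y × X × Z), ρ.map (fun p => (p.2.1, p.1)) = ρ₁ ∧
      ρ.map (fun p => (p.1, p.2.2)) = ρ₂ := by
  set σ : Measure (Y × X) := ρ₁.map Prod.swap with hσ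
  have : IsFiniteMeasure σ := by rw [hσ]; infer_instance
  have hfst : σ.fst = ρ₂.fst := by
    rw [hσ, Measure.fst, Measure.map_map measurable_fst measurable_swap, Measure.fst, ← h]
    rfl
  -- Given the common coordinate, the two outer coordinates are drawn independently from their
  -- conditional laws. Only the outer spaces need to be standard Borel.
  refine ⟨ρ₂.fst ⊗ₘ (σ.condKernel ×ₖ ρ₂.condKernel), ?_, ?_⟩
  · have h1 : (ρ₂.fst ⊗ₘ (σ.condKernel ×ₖ ρ₂.condKernel)).map (Prod.map id Prod.fst) = σ := by
      rw [← Measure.compProd_map measurable_fst, ← Kernel.fst_eq, Kernel.fst_prod, ← hfst,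
        σ.disintegrate]
    have h2 : σ.map Prod.swap = ρ₁ := by
      rw [hσ, Measure.map_map measurable_swap measurable_swap]
      simp
    refine Eq.trans ?_ h2
    conv_rhs => rw [← h1]
    rw [Measure.map_map measurable_swap (by fun_prop)]
    rfl
  · have h1 : (ρ₂.fst ⊗ₘ (σ.condKernel ×ₖ ρ₂.condKernel)).map (Prod.map id Prod.snd) = ρ₂ := by
      rw [← Measure.compProd_map measurable_snd, ← Kernel.snd_eq, Kernel.snd_prod,
        ρ₂.disintegrate]
    exact h1

section Wasserstein

variable {Ω : Type*} [MeasurableSpace Ω]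

theorem upperIntegral_le_of_measurable_of_le {c : Ω → ℝ} (ρ : Measure Ω) {φ : Ω → ℝ≥0∞}
    (hφ : Measurable φ) (h : ∀ ω, ENNReal.ofReal (c ω) ≤ φ ω) :
    upperIntegral ρ c ≤ ∫⁻ ω, φ ω ∂ρ :=
  iInf_le_of_le φ (iInf_le_of_le hφ (iInf_le _ h))

theorem isProbabilityMeasure_of_map_fst {ρ : Measure (Ω × Ω)} {P : Measure Ω}
    [IsProbabilityMeasure P] (h : ρ.map Prod.fst = P) : IsProbabilityMeasure ρ := by
  constructor
  rw [← measure_univ (μ := P), ← h, Measure.map_apply measurable_fst .univ, Set.preimage_univ]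

theorem wasserstein_nonneg (c : Ω → Ω → ℝ) (P Q : Measure Ω) : 0 ≤ wasserstein c P Q :=
  ENNReal.toReal_nonneg

theorem wasserstein_le_of_coupling {c : Ω → Ω → ℝ} {P Q : Measure Ω} {ρ : Measure (Ω × Ω)}
    (h₁ : ρ.map Prod.fst = P) (h₂ : ρ.map Prod.snd = Q) {φ : Ω × Ω → ℝ≥0∞} (hφ : Measurable φ)
    (hc : ∀ p, ENNReal.ofReal (c p.1 p.2) ≤ φ p) {b : ℝ} (hb : 0 ≤ b)
    (h : ∫⁻ p, φ p ∂ρ ≤ ENNReal.ofReal b) : wasserstein c P Q ≤ b := by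
  refine ENNReal.toReal_le_of_le_ofReal hb ?_
  exact (iInf_le_of_le ρ (iInf_le_of_le h₁ (iInf_le _ h₂))).trans
    ((upperIntegral_le_of_measurable_of_le ρ hφ hc).trans h)

theorem exists_coupling_lintegral_lt {c : Ω → Ω → ℝ} {P Q : Measure Ω} [IsProbabilityMeasure P]
    [IsProbabilityMeasure Q] (hc : ∀ ω ω', c ω ω' ≤ 1) {b : ℝ} (h : wasserstein c P Q < b) :
    ∃ ρ : Measure (Ω × Ω), ρ.map Prod.fst = P ∧ ρ.map Prod.snd = Q ∧
      ∃ φ : Ω × Ω → ℝ≥0∞, Measurable φ ∧ (∀ p, ENNReal.ofReal (c p.1 p.2) ≤ φ p) ∧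
        ∫⁻ p, φ p ∂ρ < ENNReal.ofReal b := by
  -- A cost bounded by `1` keeps the infimum finite; an infinite one would be turned into `0` by
  -- `toReal`.
  have hfin : (⨅ (ρ : Measure (Ω × Ω)) (_ : ρ.map Prod.fst = P) (_ : ρ.map Prod.snd = Q),
      upperIntegral ρ (fun p => c p.1 p.2)) ≠ ⊤ := by
    refine ne_top_of_le_ne_top ENNReal.one_ne_top
      (iInf_le_of_le (P.prod Q) (iInf_le_of_le (by simp) (iInf_le_of_le (by simp) ?_)))
    refine (upperIntegral_le_of_measurable_of_le (φ := fun _ => 1) _ measurable_const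
      fun p => ?_).trans (by simp)
    exact ENNReal.ofReal_le_one.2 (hc _ _)
  have h' := (ENNReal.lt_ofReal_iff_toReal_lt hfin).2 h
  simp only [iInf_lt_iff, upperIntegral] at h'
  obtain ⟨ρ, h₁, h₂, φ, hφ, hcφ, hlt⟩ := h'
  exact ⟨ρ, h₁, h₂, φ, hφ, hcφ, hlt⟩

theorem wasserstein_le_one {c : Ω → Ω → ℝ} (P Q : Measure Ω) [IsProbabilityMeasure P]
    [IsProbabilityMeasure Q] (hc : ∀ ω ω', c ω ω' ≤ 1) : wasserstein c P Q ≤ 1 :=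
  wasserstein_le_of_coupling (ρ := P.prod Q) (φ := fun _ => 1) (by simp) (by simp)
    measurable_const (fun _ => ENNReal.ofReal_le_one.2 (hc _ _)) zero_le_one (by simp)

/-- A coupling that charges the set where the cost exceeds `a` with mass at most `b`. -/
theorem wasserstein_le_add_of_coupling {c : Ω → Ω → ℝ} {P Q : Measure Ω} [IsProbabilityMeasure P]
    {ρ : Measure (Ω × Ω)} (h₁ : ρ.map Prod.fst = P) (h₂ : ρ.map Prod.snd = Q)
    (hc : ∀ ω ω', c ω ω' ≤ 1) {a b : ℝ} (ha : 0 ≤ a) (hb : 0 ≤ b) {B : Set (Ω × Ω)}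
    (hB : MeasurableSet B) (hle : ∀ p, p ∉ B → c p.1 p.2 ≤ a) (hρ : ρ B ≤ ENNReal.ofReal b) :
    wasserstein c P Q ≤ a + b := by
  have := isProbabilityMeasure_of_map_fst h₁
  refine wasserstein_le_of_coupling h₁ h₂
    (φ := fun p => ENNReal.ofReal a + B.indicator 1 p)
    (Measurable.add (f := fun _ => ENNReal.ofReal a) measurable_const
      (measurable_one.indicator hB)) (fun p => ?_) (add_nonneg ha hb) ?_
  · by_cases hp : p ∈ B
    · simp only [hp, Set.indicator_of_mem, Pi.one_apply]
      exact (ENNReal.ofReal_le_one.2 (hc _ _)).trans le_add_self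
    · simp only [hp, not_false_eq_true, Set.indicator_of_notMem, add_zero]
      exact ENNReal.ofReal_le_ofReal (hle p hp)
  · rw [lintegral_add_left measurable_const, lintegral_indicator_one hB, lintegral_const,
      measure_univ, mul_one, ENNReal.ofReal_add ha hb]
    gcongr

theorem wasserstein_self [MeasurableEq Ω] {c : Ω → Ω → ℝ} (P : Measure Ω) [IsProbabilityMeasure P]
    (hc : ∀ ω ω', c ω ω' ≤ 1) (h0 : ∀ ω, c ω ω = 0) : wasserstein c P P = 0 := by
  refine le_antisymm ?_ (wasserstein_nonneg _ _ _)
  have hd : Measurable fun ω : Ω => (ω, ω) := by fun_prop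
  have := wasserstein_le_add_of_coupling (P := P) (Q := P) (ρ := P.map fun ω => (ω, ω))
    (c := c) (a := 0) (b := 0) (B := (Set.diagonal Ω)ᶜ)
    (by rw [Measure.map_map measurable_fst hd]; exact Measure.map_id)
    (by rw [Measure.map_map measurable_snd hd]; exact Measure.map_id)
    hc le_rfl le_rfl measurableSet_diagonal.compl ?_ ?_
  · simpa using this
  · rintro ⟨ω, ω'⟩ h
    obtain rfl : ω = ω' := by simpa using h
    exact (h0 ω).le
  · rw [Measure.map_apply hd measurableSet_diagonal.compl]
    simp [Set.preimage]

theorem wasserstein_symm_le {c : Ω → Ω → ℝ} (P Q : Measure Ω) [IsProbabilityMeasure P]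
    [IsProbabilityMeasure Q] (hc : ∀ ω ω', c ω ω' ≤ 1) (hs : ∀ ω ω', c ω ω' = c ω' ω) :
    wasserstein c Q P ≤ wasserstein c P Q := by
  refine le_of_forall_gt fun b hb => ?_
  obtain ⟨b', hb', hbb⟩ := exists_between hb
  obtain ⟨ρ, h₁, h₂, φ, hφ, hcφ, hlt⟩ := exists_coupling_lintegral_lt hc hb'
  refine lt_of_le_of_lt (wasserstein_le_of_coupling (ρ := ρ.map Prod.swap) (φ := φ ∘ Prod.swap)
    ?_ ?_ (hφ.comp measurable_swap) (fun p => ?_)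
    ((wasserstein_nonneg _ _ _).trans hb'.le) ?_) hbb
  · rw [Measure.map_map measurable_fst measurable_swap]; exact h₂
  · rw [Measure.map_map measurable_snd measurable_swap]; exact h₁
  · rw [hs]; exact hcφ p.swap
  · rw [lintegral_map (hφ.comp measurable_swap) measurable_swap]
    simpa using hlt.le

theorem wasserstein_symm {c : Ω → Ω → ℝ} (P Q : Measure Ω) [IsProbabilityMeasure P]
    [IsProbabilityMeasure Q] (hc : ∀ ω ω', c ω ω' ≤ 1) (hs : ∀ ω ω', c ω ω' = c ω' ω) :
    wasserstein c P Q = wasserstein c Q P :=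
  le_antisymm (wasserstein_symm_le Q P hc hs) (wasserstein_symm_le P Q hc hs)

/-- Two near-optimal couplings are glued along `Q`. The sum of the two majorants depends on the
middle point, so it is no majorant on pairs; averaging it over the conditional law of the middle
point gives a measurable one, and the triangle inequality for `c` holds at every middle point.
Measurability of `c` plays no role. -/
theorem wasserstein_triangle [StandardBorelSpace Ω] {c : Ω → Ω → ℝ} (P Q R : Measure Ω)
    [IsProbabilityMeasure P] [IsProbabilityMeasure Q] [IsProbabilityMeasure R]
    (hc : ∀ ω ω', c ω ω' ≤ 1) (ht : ∀ ω₁ ω₂ ω₃, c ω₁ ω₃ ≤ c ω₁ ω₂ + c ω₂ ω₃) :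
    wasserstein c P R ≤ wasserstein c P Q + wasserstein c Q R := by
  have : Nonempty Ω := nonempty_of_isProbabilityMeasure P
  refine le_of_forall_pos_le_add fun ε hε => ?_
  obtain ⟨ρ₁, h₁, h₂, φ, hφ, hcφ, hlt₁⟩ := exists_coupling_lintegral_lt (P := P) (Q := Q) hc
    (lt_add_of_pos_right _ (half_pos hε))
  obtain ⟨ρ₂, h₃, h₄, ψ, hψ, hcψ, hlt₂⟩ := exists_coupling_lintegral_lt (P := Q) (Q := R) hc
    (lt_add_of_pos_right _ (half_pos hε))
  have := isProbabilityMeasure_of_map_fst h₁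
  have := isProbabilityMeasure_of_map_fst h₃
  obtain ⟨ρ, hρ₁, hρ₂⟩ := exists_gluing ρ₁ ρ₂ (h₂.trans h₃.symm)
  have hm₁ : Measurable fun p : Ω × Ω × Ω => (p.2.1, p.1) := by fun_prop
  have hm₂ : Measurable fun p : Ω × Ω × Ω => (p.1, p.2.2) := by fun_prop
  have hm₃ : Measurable fun p : Ω × Ω × Ω => (p.2, p.1) := by fun_prop
  have hm₄ : Measurable fun p : Ω × Ω × Ω => φ (p.2.1, p.1) := hφ.comp hm₁
  have hρp : IsProbabilityMeasure ρ := by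
    constructor
    rw [← measure_univ (μ := ρ₁), ← hρ₁, Measure.map_apply hm₁ .univ, Set.preimage_univ]
  set σ : Measure ((Ω × Ω) × Ω) := ρ.map fun p => (p.2, p.1) with hσ
  have : IsProbabilityMeasure σ := Measure.isProbabilityMeasure_map hm₃.aemeasurable
  let χ : (Ω × Ω) × Ω → ℝ≥0∞ := fun q => φ (q.1.1, q.2) + ψ (q.2, q.1.2)
  have hχ : Measurable χ := (hφ.comp (by fun_prop)).add (hψ.comp (by fun_prop))
  have hfst : σ.fst = ρ.map fun p => p.2 := by
    rw [hσ, Measure.fst, Measure.map_map measurable_fst hm₃]; rfl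
  have key : wasserstein c P R ≤
      (wasserstein c P Q + ε / 2) + (wasserstein c Q R + ε / 2) := by
    have hP := wasserstein_nonneg c P Q
    have hQ := wasserstein_nonneg c Q R
    refine wasserstein_le_of_coupling (ρ := σ.fst) (φ := fun p => ∫⁻ y, χ (p, y) ∂σ.condKernel p)
      ?_ ?_ hχ.lintegral_kernel_prod_right' (fun p => ?_) (by linarith) ?_
    · rw [hfst, Measure.map_map measurable_fst measurable_snd, ← h₁, ← hρ₁,
        Measure.map_map measurable_fst hm₁]
      rfl
    · rw [hfst, Measure.map_map measurable_snd measurable_snd, ← h₄, ← hρ₂,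
        Measure.map_map measurable_snd hm₂]
      rfl
    · calc ENNReal.ofReal (c p.1 p.2) = ∫⁻ _, ENNReal.ofReal (c p.1 p.2) ∂σ.condKernel p := by simp
        _ ≤ _ := lintegral_mono fun y =>
          (ENNReal.ofReal_le_ofReal (ht p.1 y p.2)).trans
            (ENNReal.ofReal_add_le.trans (add_le_add (hcφ (p.1, y)) (hcψ (y, p.2))))
    · rw [Measure.lintegral_condKernel hχ, hσ, lintegral_map hχ hm₃]
      simp only [χ]
      rw [lintegral_add_left hm₄, ENNReal.ofReal_add (by linarith) (by linarith)]
      refine add_le_add ?_ ?_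
      · rw [← lintegral_map (f := φ) hφ hm₁, hρ₁]; exact hlt₁.le
      · rw [← lintegral_map (f := ψ) hψ hm₂, hρ₂]; exact hlt₂.le
  linarith

theorem wasserstein_le_add {c c' : Ω → Ω → ℝ} (P Q : Measure Ω) [IsProbabilityMeasure P]
    [IsProbabilityMeasure Q] (hc' : ∀ ω ω', c' ω ω' ≤ 1) {δ : ℝ} (hδ : 0 ≤ δ)
    (h : ∀ ω ω', c ω ω' ≤ c' ω ω' + δ) : wasserstein c P Q ≤ wasserstein c' P Q + δ := by
  refine le_of_forall_pos_le_add fun ε hε => ?_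
  obtain ⟨ρ, h₁, h₂, φ, hφ, hcφ, hlt⟩ := exists_coupling_lintegral_lt (P := P) (Q := Q) hc'
    (lt_add_of_pos_right _ hε)
  have := isProbabilityMeasure_of_map_fst h₁
  have hn := wasserstein_nonneg c' P Q
  refine wasserstein_le_of_coupling h₁ h₂ (φ := fun p => φ p + ENNReal.ofReal δ)
    (hφ.add measurable_const) (fun p => ?_) (by linarith) ?_
  · exact (ENNReal.ofReal_le_ofReal (h _ _)).trans
      (ENNReal.ofReal_add_le.trans (add_le_add_left (hcφ p) _))
  · rw [lintegral_add_right _ measurable_const, lintegral_const, measure_univ, mul_one,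
      show wasserstein c' P Q + δ + ε = (wasserstein c' P Q + ε) + δ by ring,
      ENNReal.ofReal_add (by linarith) hδ]
    gcongr

end Wasserstein

/-! ### Homogeneous Markov chains -/

section Chain

variable {X : Type*} [MeasurableSpace X]

/-- The sequence with first term `x` followed by `ω`. -/
def consSeq (x : X) (ω : ℕ → X) : ℕ → X
  | 0 => x
  | n + 1 => ω n

/-- The sequence without its first `n` terms. -/
def shiftSeq (n : ℕ) (ω : ℕ → X) : ℕ → X := fun k => ω (n + k)

theorem measurable_consSeq : Measurable fun p : X × (ℕ → X) => consSeq p.1 p.2 := by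
  refine measurable_pi_lambda _ fun n => ?_
  cases n with
  | zero => exact measurable_fst
  | succ n => exact (measurable_pi_apply n).comp measurable_snd

theorem measurable_consSeq_right (x : X) : Measurable (consSeq x) :=
  measurable_consSeq.comp measurable_prodMk_left

theorem measurable_shiftSeq (n : ℕ) : Measurable (shiftSeq n : (ℕ → X) → ℕ → X) :=
  measurable_pi_lambda _ fun k => measurable_pi_apply (n + k)

omit [MeasurableSpace X] in
theorem shiftSeq_succ_consSeq (n : ℕ) (x : X) (ω : ℕ → X) :
    shiftSeq (n + 1) (consSeq x ω) = shiftSeq n ω := by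
  funext k
  simp only [shiftSeq]
  rw [show n + 1 + k = (n + k) + 1 by omega]
  rfl

variable (κ : Kernel X X)

/-- `κ` as a transition kernel depending on the past through the present only. -/
noncomputable def pastKernel (n : ℕ) : Kernel (Finset.Iic n → X) X :=
  κ.comap (fun h => h ⟨n, by simp⟩) (measurable_pi_apply _)

instance [IsMarkovKernel κ] (n : ℕ) : IsMarkovKernel (pastKernel κ n) := by
  unfold pastKernel; infer_instance

/-- The law of the Markov chain with transition kernel `κ`, as a kernel in the starting point. -/
noncomputable def chainKernel [IsMarkovKernel κ] : Kernel X (ℕ → X) :=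
  (Kernel.traj (X := fun _ => X) (pastKernel κ) 0).comap (fun x _ => x)
    (measurable_pi_lambda _ fun _ => measurable_id)

variable [IsMarkovKernel κ]

instance : IsMarkovKernel (chainKernel κ) := by unfold chainKernel; infer_instance

/-- The one-step property of the law of a Markov chain, tested on functions. -/
def IsMarkovLaw (μ : Measure (ℕ → X)) : Prop :=
  ∀ (b : ℕ) (f : (Finset.Iic b → X) × X → ℝ≥0∞), Measurable f →
    ∫⁻ ω, f (Preorder.frestrictLe (π := fun _ => X) b ω, ω (b + 1)) ∂μ =
      ∫⁻ ω, ∫⁻ y, f (Preorder.frestrictLe (π := fun _ => X) b ω, y) ∂κ (ω b) ∂μ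

variable {κ}

theorem isMarkovLaw_chainKernel (x : X) : IsMarkovLaw κ (chainKernel κ x) := by
  intro b f hf
  have h := Kernel.partialTraj_compProd_eq_map_traj (X := fun _ => X) (κ := pastKernel κ)
    (a := 0) (b := b) (Nat.zero_le b) (x₀ := fun _ => x)
  rw [← Kernel.traj_map_frestrictLe_apply] at h
  have hr : Measurable (Preorder.frestrictLe (π := fun _ : ℕ => X) b) := by fun_prop
  have h2 : ∫⁻ p, f p ∂((chainKernel κ x).map
      (fun ω => (Preorder.frestrictLe (π := fun _ => X) b ω, ω (b + 1)))) = _ :=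
    congrArg (fun ρ => ∫⁻ p, f p ∂ρ) h.symm
  rw [lintegral_map hf (by fun_prop)] at h2
  rw [h2, Measure.lintegral_compProd hf, lintegral_map hf.lintegral_kernel_prod_right' hr]
  rfl

theorem map_chainKernel_zero (x : X) :
    (chainKernel κ x).map (Preorder.frestrictLe (π := fun _ => X) 0) =
      Measure.dirac fun _ => x := by
  have h := Kernel.traj_map_frestrictLe_apply (X := fun _ => X) (κ := pastKernel κ) 0 0
    (fun _ => x)
  rw [Kernel.partialTraj_self, Kernel.id_apply] at h
  exact h

theorem ae_chainKernel_zero [MeasurableSingletonClass X] (x : X) :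
    ∀ᵐ ω ∂chainKernel κ x, ω 0 = x := by
  have hr : Measurable (Preorder.frestrictLe (π := fun _ : ℕ => X) 0) := by fun_prop
  have h : ∀ᵐ h ∂(chainKernel κ x).map (Preorder.frestrictLe (π := fun _ => X) 0),
      h ⟨0, by simp⟩ = x := by
    rw [map_chainKernel_zero, ae_dirac_iff]
    exact (measurable_pi_apply (X := fun _ : Finset.Iic 0 => X) ⟨0, by simp⟩)
      (measurableSet_singleton x)
  exact ae_of_ae_map hr.aemeasurable h

/-- The one-step property computes the marginal up to time `b + 1` from the one up to time `b`. All
finite-dimensional marginals therefore agree, and they determine the measure. -/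
theorem IsMarkovLaw.ext {μ ν : Measure (ℕ → X)} [IsProbabilityMeasure μ] [IsProbabilityMeasure ν]
    (hμ : IsMarkovLaw κ μ) (hν : IsMarkovLaw κ ν)
    (h0 : μ.map (Preorder.frestrictLe (π := fun _ => X) 0) =
      ν.map (Preorder.frestrictLe (π := fun _ => X) 0)) : μ = ν := by
  have hr : ∀ b, Measurable (Preorder.frestrictLe (π := fun _ : ℕ => X) b) := fun b => by fun_prop
  have key : ∀ b, μ.map (Preorder.frestrictLe (π := fun _ => X) b) =
      ν.map (Preorder.frestrictLe (π := fun _ => X) b) := by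
    intro b
    induction b with
    | zero => exact h0
    | succ b ih =>
      let ψ : (Finset.Iic b → X) × X → (Finset.Iic (b + 1) → X) := fun p i =>
        if h : i.1 ≤ b then p.1 ⟨i.1, by simpa using h⟩ else p.2
      have hψ : Measurable ψ := by
        refine measurable_pi_lambda _ fun i => ?_
        by_cases h : i.1 ≤ b
        · simp only [ψ, h, dite_true]; fun_prop
        · simp only [ψ, h, dite_false]; fun_prop
      have hψe : ∀ ω : ℕ → X, Preorder.frestrictLe (π := fun _ => X) (b + 1) ω =
          ψ (Preorder.frestrictLe (π := fun _ => X) b ω, ω (b + 1)) := by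
        intro ω
        funext i
        by_cases h : i.1 ≤ b
        · simp [ψ, h]
        · have : i.1 = b + 1 := by
            have := Finset.mem_Iic.1 i.2
            omega
          simp [ψ, this]
      have aux : ∀ {ρ : Measure (ℕ → X)}, IsMarkovLaw κ ρ →
          ∀ f : (Finset.Iic (b + 1) → X) → ℝ≥0∞, Measurable f →
          ∫⁻ h, f h ∂(ρ.map (Preorder.frestrictLe (π := fun _ => X) (b + 1))) =
          ∫⁻ h, ∫⁻ y, f (ψ (h, y)) ∂pastKernel κ b h
            ∂(ρ.map (Preorder.frestrictLe (π := fun _ => X) b)) := by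
        intro ρ hρ f hf
        rw [lintegral_map hf (hr _), lintegral_map
          (Measurable.lintegral_kernel_prod_right' (κ := pastKernel κ b)
            (f := fun p => f (ψ p)) (hf.comp hψ)) (hr _)]
        simp_rw [hψe]
        exact hρ b (f ∘ ψ) (hf.comp hψ)
      refine Measure.ext_of_lintegral _ fun f hf => ?_
      rw [aux hμ f hf, aux hν f hf, ih]
  refine IsProjectiveLimit.unique (α := fun _ : ℕ => X) (P := fun I => ν.map (I.restrict (π := fun _ : ℕ => X))) ?_
    (fun _ => rfl)
  intro I
  have hI : I ⊆ Finset.Iic (I.sup id) := fun i hi => Finset.mem_Iic.2 (Finset.le_sup (f := id) hi)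
  have : I.restrict (π := fun _ : ℕ => X) =
      Finset.restrict₂ (π := fun _ : ℕ => X) hI ∘ Preorder.frestrictLe (π := fun _ => X) (I.sup id) := rfl
  have hm : Measurable (Finset.restrict₂ (π := fun _ : ℕ => X) hI) :=
    Finset.measurable_restrict₂ (X := fun _ : ℕ => X) hI
  change μ.map (I.restrict (π := fun _ : ℕ => X)) = ν.map (I.restrict (π := fun _ : ℕ => X))
  rw [this, ← Measure.map_map hm (hr _), key, Measure.map_map hm (hr _)]

/-- First-step decomposition, the source of all later recursions in the initial state. The
right-hand side starts in `x` and has the one-step property: at time `0` by the choice of the second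
term, later because the chain restarted in that term is Markov. `IsMarkovLaw.ext` then identifies
the two laws. -/
theorem chainKernel_apply_eq_bind [MeasurableSingletonClass X] (x : X) :
    chainKernel κ x = ((κ x).bind (chainKernel κ)).map (consSeq x) := by
  have hc := measurable_consSeq_right x
  have hr : ∀ b, Measurable (Preorder.frestrictLe (π := fun _ : ℕ => X) b) := fun b => by fun_prop
  have : IsProbabilityMeasure (((κ x).bind (chainKernel κ)).map (consSeq x)) :=
    Measure.isProbabilityMeasure_map hc.aemeasurable
  have hint : ∀ f : (ℕ → X) → ℝ≥0∞, Measurable f →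
      ∫⁻ ω, f ω ∂(((κ x).bind (chainKernel κ)).map (consSeq x)) =
      ∫⁻ z, ∫⁻ ω, f (consSeq x ω) ∂chainKernel κ z ∂κ x := by
    intro f hf
    rw [lintegral_map hf hc, Measure.lintegral_bind (f := fun ω => f (consSeq x ω)) (chainKernel κ).aemeasurable
      (hf.comp hc).aemeasurable]
  refine (isMarkovLaw_chainKernel x).ext ?_ ?_
  · intro b f hf
    have hf1 : Measurable fun ω : ℕ → X =>
        f (Preorder.frestrictLe (π := fun _ => X) b ω, ω (b + 1)) :=
      hf.comp ((hr b).prodMk (measurable_pi_apply _))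
    have hf2 : Measurable fun ω : ℕ → X =>
        ∫⁻ y, f (Preorder.frestrictLe (π := fun _ => X) b ω, y) ∂κ (ω b) :=
      (Measurable.lintegral_kernel_prod_right' (κ := pastKernel κ b) hf).comp (hr b)
    rw [hint _ hf1, hint _ hf2]
    cases b with
    | zero =>
      have hx : ∀ ω : ℕ → X, Preorder.frestrictLe (π := fun _ => X) 0 (consSeq x ω) =
          fun _ => x := by
        intro ω
        funext i
        have : i.1 = 0 := Nat.le_zero.1 (Finset.mem_Iic.1 i.2)
        simp only [Preorder.frestrictLe_apply, this]
        rfl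
      simp only [hx]
      have e1 : ∀ z, ∫⁻ ω, f (fun _ => x, consSeq x ω (0 + 1)) ∂chainKernel κ z =
          f (fun _ => x, z) := by
        intro z
        rw [← lintegral_congr_ae (f := fun _ => f (fun _ => x, z))]
        · simp
        · filter_upwards [ae_chainKernel_zero (κ := κ) z] with ω hω
          simp [consSeq, hω]
      simp_rw [e1]
      simp [consSeq]
    | succ b =>
      refine lintegral_congr fun z => ?_
      let χ : (Finset.Iic b → X) → (Finset.Iic (b + 1) → X) := fun h i =>
        if hi : i.1 = 0 then x else h ⟨i.1 - 1, by
          have := Finset.mem_Iic.1 i.2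
          simp only [Finset.mem_Iic]; omega⟩
      have hχ : Measurable χ := by
        refine measurable_pi_lambda _ fun i => ?_
        by_cases h : i.1 = 0
        · simp only [χ, h, dite_true]; fun_prop
        · simp only [χ, h, dite_false]; fun_prop
      have hχe : ∀ ω : ℕ → X, Preorder.frestrictLe (π := fun _ => X) (b + 1) (consSeq x ω) =
          χ (Preorder.frestrictLe (π := fun _ => X) b ω) := by
        intro ω
        funext i
        obtain ⟨i, hi⟩ := i
        cases i with
        | zero => rfl
        | succ i => simp [χ, consSeq]
      have := isMarkovLaw_chainKernel (κ := κ) z b (fun p => f (χ p.1, p.2))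
        (hf.comp (by fun_prop))
      simp only [hχe]
      exact this
  · rw [map_chainKernel_zero, Measure.map_map (hr 0) hc]
    have : Preorder.frestrictLe (π := fun _ : ℕ => X) 0 ∘ consSeq x = fun _ => fun _ => x := by
      funext ω i
      have : i.1 = 0 := Nat.le_zero.1 (Finset.mem_Iic.1 i.2)
      simp only [Function.comp, Preorder.frestrictLe_apply, this]
      rfl
    rw [this, Measure.map_const, measure_univ, one_smul]

theorem lintegral_chainKernel [MeasurableSingletonClass X] (x : X) {f : (ℕ → X) → ℝ≥0∞}
    (hf : Measurable f) :
    ∫⁻ ω, f ω ∂chainKernel κ x = ∫⁻ z, ∫⁻ ω, f (consSeq x ω) ∂chainKernel κ z ∂κ x := by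
  have hc := measurable_consSeq_right x
  conv_lhs => rw [chainKernel_apply_eq_bind]
  rw [lintegral_map hf hc, Measure.lintegral_bind (f := fun ω => f (consSeq x ω)) (chainKernel κ).aemeasurable
    (hf.comp hc).aemeasurable]

theorem chainKernel_apply [MeasurableSingletonClass X] (x : X) {B : Set (ℕ → X)}
    (hB : MeasurableSet B) :
    chainKernel κ x B = ∫⁻ z, chainKernel κ z (consSeq x ⁻¹' B) ∂κ x := by
  rw [← lintegral_indicator_one hB, lintegral_chainKernel x (measurable_one.indicator hB)]
  refine lintegral_congr fun z => ?_
  rw [← lintegral_indicator_one (measurable_consSeq_right x hB)]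
  rfl

theorem ae_chainKernel_of_ae [MeasurableSingletonClass X] {p : X → X → Prop}
    (hp : MeasurableSet {q : X × X | p q.1 q.2}) (h : ∀ x, ∀ᵐ y ∂κ x, p x y) (x : X) :
    ∀ᵐ ω ∂chainKernel κ x, ∀ n, p (ω n) (ω (n + 1)) := by
  rw [ae_all_iff]
  intro n
  have hm : ∀ n, MeasurableSet {ω : ℕ → X | ¬ p (ω n) (ω (n + 1))} := fun n =>
    (((measurable_pi_apply (X := fun _ => X) n).prodMk (measurable_pi_apply (n + 1))) hp).compl
  change chainKernel κ x {ω | ¬ p (ω n) (ω (n + 1))} = 0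
  induction n generalizing x with
  | zero =>
    rw [chainKernel_apply x (hm 0), lintegral_eq_zero_iff']
    · filter_upwards [h x] with z hz
      refine measure_mono_null (t := {ω | ω 0 = z}ᶜ) ?_ (ae_chainKernel_zero z)
      intro ω hω hω'
      exact hω (by simpa [consSeq, show ω 0 = z from hω'] using hz)
    · exact ((chainKernel κ).measurable_coe (measurable_consSeq_right x (hm 0))).aemeasurable
  | succ n ih =>
    rw [chainKernel_apply x (hm _)]
    rw [lintegral_congr (g := fun _ => 0)]
    · simp
    · intro z
      exact ih z

end Chain

/-! ### Measurable structure of configurations, generalized states and traces -/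

/-- A configuration as a pair of a state and a clock vector. -/
def Config.equivProd (S E : Type*) : Config S E ≃ S × (E → ℝ) where
  toFun x := (x.state, x.clock)
  invFun p := ⟨p.1, p.2⟩
  left_inv _ := rfl
  right_inv _ := rfl

/-- Generalized states and traces inherit this as measurable subsets; the disintegrations behind the
gluing of couplings need it. -/
instance Config.instStandardBorelSpace {S E : Type*} [Fintype S] [Fintype E] :
    StandardBorelSpace (Config S E) := by
  let _ : MeasurableSpace S := ⊤
  let _ : TopologicalSpace S := ⊥
  have : DiscreteTopology S := ⟨rfl⟩
  have : DiscreteMeasurableSpace S := ⟨fun _ => trivial⟩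
  let τ : TopologicalSpace (Config S E) := TopologicalSpace.induced (Config.equivProd S E)
    inferInstance
  let e : Config S E ≃ₜ S × (E → ℝ) := (Config.equivProd S E).toHomeomorphOfIsInducing ⟨rfl⟩
  have hb : BorelSpace (Config S E) := by
    constructor
    have h1 : (Prod.instMeasurableSpace : MeasurableSpace (S × (E → ℝ))) = borel _ := BorelSpace.measurable_eq
    change MeasurableSpace.comap (Config.equivProd S E) _ = _
    rw [h1]
    exact borel_comap.symm
  exact ⟨τ, hb, e.isClosedEmbedding.polishSpace⟩

namespace GSMP

variable {S E AP : Type*} [Fintype S] [Fintype E] (M : GSMP S E AP)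

instance : StandardBorelSpace M.GState :=
  MeasurableSet.standardBorel
    (s := {x | ∀ n, M.Good n x}) (by
      rw [Set.ofPred_forall]
      exact MeasurableSet.iInter M.measurableSet_good)

theorem chainLaw_eq (x : M.GState) : M.chainLaw x = chainKernel M.kernel x := rfl

theorem proper_val (x : M.GState) : M.Proper x.1 := (x.2 0).1

theorem exists_firesFirst_val (x : M.GState) : ∃ i, M.FiresFirst x.1 i := (x.2 0).2

theorem map_val_kernel (x : M.GState) :
    (M.kernel x).map Subtype.val = M.stepLaw x.1 := by
  change ((M.stepLaw x.1).comap Subtype.val).map Subtype.val = _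
  rw [M.measurableEmbedding_val.map_comap]
  refine Measure.restrict_eq_self_of_ae_mem ?_
  have h : ∀ᵐ y ∂(M.stepLaw x.1), ∀ n, M.Good n y :=
    ae_all_iff.2 fun n => (x.2 (n + 1)).2
  filter_upwards [h] with y hy
  exact ⟨⟨y, hy⟩, rfl⟩

theorem lintegral_kernel (x : M.GState) {f : Config S E → ℝ≥0∞} (hf : Measurable f) :
    ∫⁻ y, f y.1 ∂M.kernel x = ∫⁻ y, f y ∂M.stepLaw x.1 := by
  rw [← M.map_val_kernel, lintegral_map hf M.measurableEmbedding_val.measurable]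

theorem kernel_apply_preimage (x : M.GState) {B : Set (Config S E)} (hB : MeasurableSet B) :
    M.kernel x (Subtype.val ⁻¹' B) = M.stepLaw x.1 B := by
  rw [← M.map_val_kernel, Measure.map_apply M.measurableEmbedding_val.measurable hB]

theorem measurable_afterEvent_right (i : E) (x : Config S E) (s' : S) :
    Measurable (M.afterEvent i x s') :=
  (M.measurable_afterEvent i x.state s').comp (measurable_prodMk_left (x := x.clock))

theorem eventLaw_apply (i : E) (x : Config S E) {B : Set (Config S E)} (hB : MeasurableSet B) :
    M.eventLaw i x B = ∑ s', ENNReal.ofReal (M.next i x.state s') *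
      Measure.pi (M.resetLaw x.state i s') (M.afterEvent i x s' ⁻¹' B) := by
  simp only [eventLaw, Measure.coe_finsetSum, Finset.sum_apply, Measure.smul_apply, smul_eq_mul,
    Measure.map_apply (M.measurable_afterEvent_right i x _) hB]

theorem lintegral_eventLaw (i : E) (x : Config S E) {f : Config S E → ℝ≥0∞} (hf : Measurable f) :
    ∫⁻ y, f y ∂M.eventLaw i x = ∑ s', ENNReal.ofReal (M.next i x.state s') *
      ∫⁻ v, f (M.afterEvent i x s' v) ∂Measure.pi (M.resetLaw x.state i s') := by
  simp only [eventLaw, lintegral_finsetSum_measure, lintegral_smul_measure, smul_eq_mul,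
    lintegral_map hf (M.measurable_afterEvent_right i x _)]

theorem sum_ofReal_next {s : S} {i : E} (hi : i ∈ M.active s) :
    ∑ s', ENNReal.ofReal (M.next i s s') = 1 := by
  rw [← ENNReal.ofReal_sum_of_nonneg fun s' _ => M.next_nonneg _ _ hi s', M.next_sum _ _ hi,
    ENNReal.ofReal_one]

theorem measurable_firstTime : Measurable M.firstTime := by
  refine measurable_of_state fun s => ?_
  refine measurable_of_Ici fun a => ?_
  have : (fun c : E → ℝ => M.firstTime (⟨s, c⟩ : Config S E)) ⁻¹' Set.Ici a =
      ⋂ i ∈ M.active s, {c : E → ℝ | a ≤ c i / M.rate s i} := by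
    ext c
    simp [firstTime, runTime]
  rw [this]
  exact MeasurableSet.biInter (Set.to_countable _) fun i _ =>
    measurableSet_le measurable_const (by fun_prop)

variable {M} in
theorem FiresFirst.firstTime_eq {x : Config S E} {i : E} (hi : M.FiresFirst x i) :
    M.firstTime x = M.runTime x i := by
  refine le_antisymm (Finset.inf'_le _ hi.1) (Finset.le_inf' _ _ fun j hj => ?_)
  by_cases h : j = i
  · rw [h]
  · exact (hi.2 j hj h).le

theorem firstTime_pos {x : Config S E} (hx : M.Proper x) : 0 < M.firstTime x := by
  refine (Finset.lt_inf'_iff _).2 fun j hj => ?_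
  exact div_pos ((hx j).1 hj) (M.rate_pos _ _ hj)

theorem firstTime_val_pos (x : M.GState) : 0 < M.firstTime x.1 := M.firstTime_pos (M.proper_val x)

theorem measurable_jumpTime (n : ℕ) : Measurable fun ω : ℕ → M.GState => M.jumpTime ω n := by
  unfold jumpTime
  refine Finset.measurable_sum _ fun k _ => ?_
  exact M.measurable_firstTime.comp (M.measurableEmbedding_val.measurable.comp
    (measurable_pi_apply k))

theorem jumpTime_succ (ω : ℕ → M.GState) (n : ℕ) :
    M.jumpTime ω (n + 1) = M.jumpTime ω n + M.firstTime (ω n).1 := by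
  simp [jumpTime, Finset.sum_range_succ]

theorem jumpTime_zero (ω : ℕ → M.GState) : M.jumpTime ω 0 = 0 := by simp [jumpTime]

theorem jumpTime_consSeq (x : M.GState) (ω : ℕ → M.GState) (n : ℕ) :
    M.jumpTime (consSeq x ω) (n + 1) = M.firstTime x.1 + M.jumpTime ω n := by
  simp only [jumpTime, Finset.sum_range_succ']
  rw [add_comm]
  rfl

theorem strictMono_jumpTime (ω : ℕ → M.GState) : StrictMono (M.jumpTime ω) :=
  strictMono_nat_of_lt_succ fun n => by
    rw [jumpTime_succ]
    linarith [M.firstTime_val_pos (ω n)]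

theorem measurableSet_nonZeno :
    MeasurableSet {ω : ℕ → M.GState | Tendsto (M.jumpTime ω) atTop atTop} := by
  have : {ω : ℕ → M.GState | Tendsto (M.jumpTime ω) atTop atTop} =
      {ω | ∀ K : ℕ, ∃ n, (K : ℝ) ≤ M.jumpTime ω n} := by
    ext ω
    refine ⟨fun h K => (h.eventually_ge_atTop _).exists, fun h => ?_⟩
    refine tendsto_atTop_atTop_of_monotone (M.strictMono_jumpTime ω).monotone fun b => ?_
    obtain ⟨K, hK⟩ := exists_nat_ge b
    obtain ⟨n, hn⟩ := h K
    exact ⟨n, hK.trans hn⟩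
  rw [this]
  simp only [Set.ofPred_forall, Set.ofPred_exists]
  exact MeasurableSet.iInter fun K => MeasurableSet.iUnion fun n =>
    measurableSet_le measurable_const (M.measurable_jumpTime n)

instance : StandardBorelSpace M.Trace := M.measurableSet_nonZeno.standardBorel

theorem measurableEmbedding_traceVal :
    MeasurableEmbedding (Subtype.val : M.Trace → ℕ → M.GState) :=
  MeasurableEmbedding.subtype_coe M.measurableSet_nonZeno

/-! ### Almost all sequences are finitely varying -/

theorem resetLaw_ae_pos {s s' : S} {i j : E} (hi : i ∈ M.active s) (hj : j ∈ M.active s') :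
    ∀ᵐ t ∂M.resetLaw s i s' j, 0 < t := by
  rw [resetLaw, if_pos ⟨hi, hj⟩]
  exact (withDensity_absolutelyContinuous _ _).ae_le (ae_restrict_mem measurableSet_Ioi)

theorem resetLaw_ae_eq_zero {s s' : S} {i j : E} (hj : j ∉ M.active s') :
    ∀ᵐ t ∂M.resetLaw s i s' j, t = 0 := by
  rw [resetLaw, if_neg fun h => hj h.2]
  exact (ae_dirac_iff (measurableSet_singleton 0)).2 rfl

theorem ae_pi_resetLaw {s s' : S} {i : E} {p : E → ℝ → Prop}
    (h : ∀ j, ∀ᵐ t ∂M.resetLaw s i s' j, p j t) :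
    ∀ᵐ v ∂Measure.pi (M.resetLaw s i s'), ∀ j, p j (v j) :=
  ae_all_iff.2 fun j => (Measure.tendsto_eval_ae_ae (i := j)).eventually (h j)

/-- Clocks that are set are almost surely positive, so continuity from below gives a threshold for
each triple `(s, s', i)`. There are finitely many triples, hence one threshold serves all. -/
theorem exists_half_le_resetLaw : ∃ δ : ℝ, 0 < δ ∧ ∀ s s' i, i ∈ M.active s →
    1 / 2 ≤ Measure.pi (M.resetLaw s i s') {v | ∀ j ∈ M.active s', δ ≤ v j} := by
  have h1 : ∀ p : S × S × E, ∃ n : ℕ, p.2.2 ∈ M.active p.1 →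
      1 / 2 ≤ Measure.pi (M.resetLaw p.1 p.2.2 p.2.1)
        {v | ∀ j ∈ M.active p.2.1, (1 / (n + 1) : ℝ) ≤ v j} := by
    rintro ⟨s, s', i⟩
    by_cases hi : i ∈ M.active s
    swap
    · exact ⟨0, fun h => absurd h hi⟩
    let V : ℕ → Set (E → ℝ) := fun n => {v | ∀ j ∈ M.active s', (1 / (n + 1) : ℝ) ≤ v j}
    have hV : Monotone V := fun m n hmn v hv j hj =>
      (one_div_le_one_div_of_le (by positivity) (by exact_mod_cast Nat.succ_le_succ hmn)).trans
        (hv j hj)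
    have hU : Measure.pi (M.resetLaw s i s') (⋃ n, V n) = 1 := by
      rw [← prob_compl_eq_zero_iff₀]
      · have := M.ae_pi_resetLaw (s := s) (s' := s') (i := i)
          (p := fun j t => j ∈ M.active s' → 0 < t) (fun j => by
            by_cases hj : j ∈ M.active s'
            · simpa [hj] using M.resetLaw_ae_pos hi hj
            · simp [hj])
        refine measure_mono_null (fun v hv => ?_) this
        intro hv'
        refine hv (Set.mem_iUnion.2 ?_)
        have : ∀ j, ∃ n : ℕ, j ∈ M.active s' → (1 / (n + 1) : ℝ) < v j := fun j => by
          by_cases hj : j ∈ M.active s'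
          · obtain ⟨n, hn⟩ := exists_nat_one_div_lt (hv' j hj)
            exact ⟨n, fun _ => hn⟩
          · exact ⟨0, fun h => absurd h hj⟩
        choose n hn using this
        refine ⟨Finset.univ.sup n, fun j hj => le_trans ?_ (hn j hj).le⟩
        refine one_div_le_one_div_of_le (by positivity) ?_
        have := Finset.le_sup (f := n) (Finset.mem_univ j)
        exact_mod_cast Nat.succ_le_succ this
      · refine (MeasurableSet.iUnion fun n => ?_).nullMeasurableSet
        simp only [V, Set.ofPred_forall]
        exact MeasurableSet.iInter fun j => MeasurableSet.iInter fun _ =>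
          measurableSet_le measurable_const (measurable_pi_apply j)
    have ht := tendsto_measure_iUnion_atTop (μ := Measure.pi (M.resetLaw s i s')) hV
    rw [hU] at ht
    obtain ⟨n, hn⟩ := (ht.eventually_const_lt (show (1 / 2 : ℝ≥0∞) < 1 by
      simp)).exists
    exact ⟨n, fun _ => hn.le⟩
  choose n hn using h1
  refine ⟨1 / ((Finset.univ.sup n : ℕ) + 1), by positivity, fun s s' i hi => ?_⟩
  refine (hn (s, s', i) hi).trans (measure_mono fun v hv j hj => le_trans ?_ (hv j hj))
  refine one_div_le_one_div_of_le (by positivity) ?_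
  have := Finset.le_sup (f := n) (Finset.mem_univ (s, s', i))
  exact_mod_cast Nat.succ_le_succ this

open Classical in
/-- The active clocks with a value less than `τ`. -/
noncomputable def shortClocks (τ : ℝ) (x : Config S E) : Finset E :=
  (M.active x.state).filter fun j => x.clock j < τ

theorem measurableSet_card_shortClocks_le (τ : ℝ) (n : ℕ) :
    MeasurableSet {x : Config S E | (M.shortClocks τ x).card ≤ n} := by
  have : Measurable fun x : Config S E => (M.shortClocks τ x).card := by
    refine measurable_of_state fun s => ?_
    simp only [shortClocks, Finset.card_filter]
    refine Finset.measurable_sum _ fun j _ => ?_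
    exact Measurable.ite (measurableSet_lt (measurable_pi_apply j) measurable_const)
      measurable_const measurable_const
  exact this measurableSet_Iic

/-- A stay shorter than `η / R` lowers every clock by less than `η`, so a clock below `τ` afterwards
was kept and was below `τ + η` before. The clock that fires was below `η` before and is not kept, so
the inclusion is strict. -/
theorem card_shortClocks_afterEvent_lt {x : Config S E} {i : E} (hi : M.FiresFirst x i) {R η τ : ℝ}
    (hR : 0 < R) (hRx : ∀ j ∈ M.active x.state, M.rate x.state j ≤ R) (hpos : 0 < M.firstTime x)
    (hτ : 0 ≤ τ) (hT : M.firstTime x < η / R) {s' : S} {v : E → ℝ}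
    (hv : ∀ j ∈ M.active s', τ ≤ v j) :
    (M.shortClocks τ (M.afterEvent i x s' v)).card < (M.shortClocks (τ + η) x).card := by
  classical
  have hrun : M.runTime x i = M.firstTime x := hi.firstTime_eq.symm
  have hRT : R * M.firstTime x < η := by
    rw [lt_div_iff₀ hR] at hT; linarith
  refine Finset.card_lt_card (Finset.ssubset_iff_of_subset ?_ |>.2 ⟨i, ?_, ?_⟩)
  · intro j hj
    obtain ⟨hj1, hj2⟩ := Finset.mem_filter.1 hj
    change j ∈ M.active s' at hj1
    by_cases hc : j ∈ M.active s' ∧ j ∈ M.active x.state ∧ j ≠ i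
    · have h : (M.afterEvent i x s' v).clock j =
        x.clock j - M.rate x.state j * M.runTime x i := if_pos hc
      rw [h, hrun] at hj2
      refine Finset.mem_filter.2 ⟨hc.2.1, ?_⟩
      have := mul_le_mul_of_nonneg_right (hRx j hc.2.1) hpos.le
      linarith
    · have h : (M.afterEvent i x s' v).clock j = v j := if_neg hc
      rw [h] at hj2
      exact absurd hj2 (not_lt.2 (hv j hj1))
  · refine Finset.mem_filter.2 ⟨hi.1, ?_⟩
    have h1 : x.clock i = M.rate x.state i * M.firstTime x := by
      rw [← hrun, runTime, mul_div_cancel₀ _ (M.rate_pos _ _ hi.1).ne']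
    have := mul_le_mul_of_nonneg_right (hRx i hi.1) hpos.le
    linarith
  · intro hj
    obtain ⟨hj1, hj2⟩ := Finset.mem_filter.1 hj
    have h : (M.afterEvent i x s' v).clock i = v i := if_neg fun h => h.2.2 rfl
    rw [h] at hj2
    exact absurd hj2 (not_lt.2 (hv i hj1))

/-- The expectation of `exp (-t)` for the time `t` spent in the first `n` states. -/
noncomputable def discount (n : ℕ) (x : M.GState) : ℝ≥0∞ :=
  ∫⁻ ω, ENNReal.ofReal (Real.exp (-M.jumpTime ω n)) ∂M.chainLaw x

theorem measurable_exp_jumpTime (n : ℕ) : Measurable fun ω : ℕ → M.GState =>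
    ENNReal.ofReal (Real.exp (-M.jumpTime ω n)) :=
  ENNReal.measurable_ofReal.comp (Real.measurable_exp.comp (M.measurable_jumpTime n).neg)

theorem discount_succ (n : ℕ) (x : M.GState) : M.discount (n + 1) x =
    ENNReal.ofReal (Real.exp (-M.firstTime x.1)) * ∫⁻ z, M.discount n z ∂M.kernel x := by
  rw [discount, chainLaw_eq, lintegral_chainKernel x (M.measurable_exp_jumpTime _),
    ← lintegral_const_mul']
  · refine lintegral_congr fun z => ?_
    rw [discount, ← lintegral_const_mul' _ _ ENNReal.ofReal_ne_top, chainLaw_eq]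
    refine lintegral_congr fun ω => ?_
    rw [jumpTime_consSeq, neg_add, Real.exp_add, ENNReal.ofReal_mul (Real.exp_pos _).le]
  · exact ENNReal.ofReal_ne_top

instance (x : M.GState) : IsProbabilityMeasure (M.chainLaw x) := by
  rw [chainLaw_eq]; infer_instance

theorem discount_zero (x : M.GState) : M.discount 0 x = 1 := by
  simp [discount, jumpTime_zero]

theorem discount_succ_le_lintegral (n : ℕ) (x : M.GState) :
    M.discount (n + 1) x ≤ ∫⁻ z, M.discount n z ∂M.kernel x := by
  rw [discount_succ]
  refine mul_le_of_le_one_left' (ENNReal.ofReal_le_one.2 (Real.exp_le_one_iff.2 ?_))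
  linarith [M.firstTime_val_pos x]

theorem discount_le_one (n : ℕ) (x : M.GState) : M.discount n x ≤ 1 := by
  induction n generalizing x with
  | zero => rw [discount_zero]
  | succ n ih =>
    refine (M.discount_succ_le_lintegral n x).trans ((lintegral_mono ih).trans ?_)
    simp

theorem discount_succ_le_exp (n : ℕ) {x : M.GState} {e : ℝ} (h : e ≤ M.firstTime x.1) :
    M.discount (n + 1) x ≤ ENNReal.ofReal (Real.exp (-e)) := by
  rw [discount_succ]
  refine (mul_le_mul' (ENNReal.ofReal_le_ofReal (Real.exp_le_exp.2 (neg_le_neg h)))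
    (lintegral_mono (M.discount_le_one n))).trans ?_
  simp

theorem discount_add_le (n : ℕ) {m : ℕ} {C : ℝ≥0∞} (hC : C ≠ ⊤) (h : ∀ x, M.discount m x ≤ C)
    (x : M.GState) : M.discount (n + m) x ≤ C * M.discount n x := by
  induction n generalizing x with
  | zero => simpa [discount_zero] using h x
  | succ n ih =>
    rw [show n + 1 + m = (n + m) + 1 by ring, discount_succ, discount_succ]
    calc _ ≤ ENNReal.ofReal (Real.exp (-M.firstTime x.1)) *
          ∫⁻ z, C * M.discount n z ∂M.kernel x := by gcongr with z; exact ih z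
      _ = _ := by rw [lintegral_const_mul' _ _ hC]; ring

theorem half_le_kernel_card_shortClocks_lt {δ : ℝ} (hδ : ∀ s s' i, i ∈ M.active s →
      1 / 2 ≤ Measure.pi (M.resetLaw s i s') {v | ∀ j ∈ M.active s', δ ≤ v j})
    (x : M.GState) {R η τ : ℝ} (hR : 0 < R)
    (hRx : ∀ j ∈ M.active x.1.state, M.rate x.1.state j ≤ R) (hτ : 0 ≤ τ) (hτδ : τ ≤ δ)
    (hT : M.firstTime x.1 < η / R) {n : ℕ} (hn : (M.shortClocks (τ + η) x.1).card ≤ n + 1) :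
    1 / 2 ≤ M.kernel x {z | (M.shortClocks τ z.1).card ≤ n} := by
  have hm := M.measurableSet_card_shortClocks_le τ n
  change _ ≤ M.kernel x (Subtype.val ⁻¹' {z | (M.shortClocks τ z).card ≤ n})
  obtain ⟨i, hi⟩ := M.exists_firesFirst_val x
  rw [M.kernel_apply_preimage x hm, M.stepLaw_of_firesFirst hi, M.eventLaw_apply i _ hm]
  calc (1 / 2 : ℝ≥0∞) = ∑ s', ENNReal.ofReal (M.next i x.1.state s') * (1 / 2) := by
        rw [← Finset.sum_mul, M.sum_ofReal_next hi.1, one_mul]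
    _ ≤ _ := by
        refine Finset.sum_le_sum fun s' _ => mul_le_mul' le_rfl ((hδ _ s' i hi.1).trans
          (measure_mono fun v hv => ?_))
        have := M.card_shortClocks_afterEvent_lt hi hR hRx (M.firstTime_val_pos x) hτ hT
          (fun j hj => hτδ.trans (hv j hj))
        exact Nat.lt_succ_iff.1 (this.trans_le hn)

/-- Induction on the number of short clocks, with the threshold lowered by `η` at each transition.
Either the stay lasts at least `η / R`, which costs a factor `exp (-(η / R))`, or with probability
at least `1 / 2` the next state has one short clock fewer. A state without short clocks has a long
stay. Every state has at most `Fintype.card E` short clocks, so `Fintype.card E + 1` transitions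
suffice from anywhere. -/
theorem exists_discount_le : ∃ (N : ℕ) (q : ℝ≥0∞), q < 1 ∧ ∀ x, M.discount N x ≤ q := by
  obtain ⟨δ, hδ0, hδ⟩ := M.exists_half_le_resetLaw
  obtain ⟨R, hR, hRx⟩ : ∃ R : ℝ, 0 < R ∧ ∀ s j, M.rate s j ≤ R := by
    obtain ⟨R, hR⟩ := (Set.finite_range fun p : S × E => M.rate p.1 p.2).bddAbove
    exact ⟨max R 1, by positivity, fun s j => (hR ⟨(s, j), rfl⟩).trans (le_max_left _ _)⟩
  set N := Fintype.card E with hN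
  -- With this choice every threshold required of freshly set clocks, `(n + 1) * η` with `n < N`, is
  -- at most `δ`.
  set η := δ / (N + 1) with hη
  have hη0 : 0 < η := by positivity
  have key : ∀ n : ℕ, n ≤ N → ∃ q : ℝ≥0∞, q < 1 ∧ ∀ x : M.GState,
      (M.shortClocks ((n + 1) * η) x.1).card ≤ n → M.discount (n + 1) x ≤ q := by
    have hexp : ENNReal.ofReal (Real.exp (-(η / R))) < 1 :=
      ENNReal.ofReal_lt_one.2 (Real.exp_lt_one_iff.2 (neg_lt_zero.2 (by positivity)))
    intro n
    induction n with
    | zero =>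
      refine fun _ => ⟨_, hexp, fun x hx => M.discount_succ_le_exp 0 ?_⟩
      have h0 := Finset.card_eq_zero.1 (Nat.le_zero.1 hx)
      refine Finset.le_inf' _ _ fun j hj => ?_
      have hj' : ¬ x.1.clock j < (0 + 1) * η := fun h => by
        have : j ∈ M.shortClocks (((0 : ℕ) + 1) * η) x.1 :=
          Finset.mem_filter.2 ⟨hj, by simpa using h⟩
        rw [h0] at this
        exact absurd this (Finset.notMem_empty j)
      have hr := M.rate_pos _ _ hj
      rw [not_lt, zero_add, one_mul] at hj'
      exact div_le_div₀ (hη0.le.trans hj') hj' hr (hRx _ _)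
    | succ n ih =>
      intro hnN
      obtain ⟨q, hq, hqx⟩ := ih (by omega)
      -- The value `(1 + q) / 2` averages the bound `q`, valid with probability at least one half,
      -- with the trivial bound `1`.
      refine ⟨max (ENNReal.ofReal (Real.exp (-(η / R)))) ((1 + q) / 2), max_lt hexp ?_,
        fun x hx => ?_⟩
      · rw [ENNReal.div_lt_iff (by simp) (by simp), one_mul, ← one_add_one_eq_two]
        exact ENNReal.add_lt_add_left ENNReal.one_ne_top hq
      rcases le_or_gt (η / R) (M.firstTime x.1) with hT | hT
      · exact (M.discount_succ_le_exp _ hT).trans (le_max_left _ _)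
      refine ((M.discount_succ_le_lintegral _ x).trans ?_).trans (le_max_right _ _)
      set F : Set M.GState := {z | (M.shortClocks ((n + 1) * η) z.1).card ≤ n} with hF
      have hFm : MeasurableSet F := M.measurableEmbedding_val.measurable
        (M.measurableSet_card_shortClocks_le ((n + 1) * η) n)
      have hhalf : 1 / 2 ≤ M.kernel x F := by
        refine M.half_le_kernel_card_shortClocks_lt hδ x hR (fun j _ => hRx _ j)
          (by positivity) ?_ hT (η := η) ?_
        · rw [hη, ← mul_div_assoc, div_le_iff₀ (by positivity), mul_comm]
          have : ((n + 1 : ℕ) : ℝ) ≤ N := by exact_mod_cast hnN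
          push_cast at this
          exact mul_le_mul_of_nonneg_left (by linarith) hδ0.le
        · have : ((n + 1 : ℕ) + 1 : ℝ) * η = (n + 1) * η + η := by push_cast; ring
          rwa [this] at hx
      have hle : ∀ z, M.discount (n + 1) z ≤ F.indicator (fun _ => q) z +
          Fᶜ.indicator (fun _ => 1) z := by
        intro z
        by_cases hz : z ∈ F
        · simpa [hz] using hqx z hz
        · simpa [hz] using M.discount_le_one _ z
      refine (lintegral_mono hle).trans ?_
      rw [lintegral_add_left (measurable_const.indicator hFm), lintegral_indicator_const hFm,
        lintegral_indicator_const hFm.compl, one_mul]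
      -- Writing the mass of `F` as `1 / 2 + a` avoids truncated subtraction.
      obtain ⟨a, ha⟩ := exists_add_of_le hhalf
      have hsum : M.kernel x F + M.kernel x Fᶜ = 1 := by
        rw [measure_add_measure_compl hFm, measure_univ]
      have hac : a + M.kernel x Fᶜ = 1 / 2 := by
        have h2 : 1 / 2 + (a + M.kernel x Fᶜ) = 1 / 2 + 1 / 2 := by
          rw [← add_assoc, ← ha, hsum, ENNReal.add_halves]
        exact (ENNReal.add_right_inj (by simp)).1 h2
      calc q * M.kernel x F + M.kernel x Fᶜ
          = q * (1 / 2) + (q * a + M.kernel x Fᶜ) := by rw [ha]; ring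
        _ ≤ q * (1 / 2) + (a + M.kernel x Fᶜ) := by
            gcongr
            exact mul_le_of_le_one_left' hq.le
        _ = (1 + q) / 2 := by rw [hac, add_comm, ENNReal.add_div, mul_one_div]
  obtain ⟨q, hq, hqx⟩ := key N le_rfl
  exact ⟨N + 1, q, hq, fun x => hqx x (Finset.card_le_univ _)⟩

/-- The bound `q` for a block of `N` transitions is uniform in the initial state, so `j` blocks give
`q ^ j`. Hence the infimum of `exp (-jumpTime)` has integral `0` and vanishes almost surely, which
forces the jump times to be unbounded. -/
theorem ae_nonZeno (x : M.GState) :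
    ∀ᵐ ω ∂M.chainLaw x, Tendsto (M.jumpTime ω) atTop atTop := by
  obtain ⟨N, q, hq, hN⟩ := M.exists_discount_le
  have hpow : ∀ j : ℕ, M.discount (j * N) x ≤ q ^ j := by
    intro j
    induction j with
    | zero => simp [discount_zero]
    | succ j ih =>
      rw [Nat.succ_mul, pow_succ']
      exact (M.discount_add_le (j * N) hq.ne_top hN x).trans (mul_le_mul' le_rfl ih)
  have hinf : ∫⁻ ω, ⨅ n, ENNReal.ofReal (Real.exp (-M.jumpTime ω n)) ∂M.chainLaw x = 0 := by
    refine le_antisymm ?_ zero_le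
    refine ge_of_tendsto (ENNReal.tendsto_pow_atTop_nhds_zero_of_lt_one hq)
      (Eventually.of_forall fun j => ?_)
    exact (lintegral_mono fun ω => iInf_le _ (j * N)).trans (hpow j)
  rw [lintegral_eq_zero_iff (Measurable.iInf fun n => M.measurable_exp_jumpTime n)] at hinf
  filter_upwards [hinf] with ω hω
  refine tendsto_atTop_atTop_of_monotone (M.strictMono_jumpTime ω).monotone fun b => ?_
  have : ⨅ n, ENNReal.ofReal (Real.exp (-M.jumpTime ω n)) < ENNReal.ofReal (Real.exp (-b)) := by
    rw [show (⨅ n, ENNReal.ofReal (Real.exp (-M.jumpTime ω n))) = 0 from hω]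
    exact ENNReal.ofReal_pos.2 (Real.exp_pos _)
  obtain ⟨n, hn⟩ := iInf_lt_iff.1 this
  rw [ENNReal.ofReal_lt_ofReal_iff (Real.exp_pos _), Real.exp_lt_exp] at hn
  exact ⟨n, by linarith⟩

instance (x : M.GState) : IsProbabilityMeasure (M.traceLaw x) := by
  refine (M.measurableEmbedding_traceVal).isProbabilityMeasure_comap ?_
  filter_upwards [M.ae_nonZeno x] with ω hω
  exact ⟨⟨ω, hω⟩, rfl⟩

theorem map_val_traceLaw (x : M.GState) :
    (M.traceLaw x).map Subtype.val = M.chainLaw x := by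
  rw [traceLaw, M.measurableEmbedding_traceVal.map_comap]
  refine Measure.restrict_eq_self_of_ae_mem ?_
  filter_upwards [M.ae_nonZeno x] with ω hω
  exact ⟨⟨ω, hω⟩, rfl⟩

end GSMP

/-! ### The Skorohod lifting -/

section Skorohod

variable {X : Type*} {m m' : X → X → ℝ}

theorem skorohodJ2_le (hm : ∀ x y, 0 ≤ m x y) {f g : ℝ≥0 → X} {a : ℝ}
    (h₁ : ∀ t, ∃ t' : ℝ≥0, m (f t) (g t') ≤ a ∧ |(t : ℝ) - t'| ≤ a)
    (h₂ : ∀ t', ∃ t : ℝ≥0, m (f t) (g t') ≤ a ∧ |(t : ℝ) - t'| ≤ a) :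
    skorohodJ2 m f g ≤ a := by
  refine max_le (ciSup_le fun t => ?_) (ciSup_le fun t' => ?_)
  · obtain ⟨t', h, h'⟩ := h₁ t
    exact ciInf_le_of_le ⟨0, by rintro _ ⟨t', rfl⟩; exact le_max_of_le_left (hm _ _)⟩ t'
      (max_le h h')
  · obtain ⟨t, h, h'⟩ := h₂ t'
    exact ciInf_le_of_le ⟨0, by rintro _ ⟨t', rfl⟩; exact le_max_of_le_left (hm _ _)⟩ t
      (max_le h h')

theorem skorohodJ2_nonneg (hm : ∀ x y, 0 ≤ m x y) (f g : ℝ≥0 → X) : 0 ≤ skorohodJ2 m f g :=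
  le_max_of_le_left (Real.iSup_nonneg fun _ => Real.iInf_nonneg fun _ =>
    le_max_of_le_left (hm _ _))

theorem skorohodJ2_le_one (hm : IsPseudometric m) (f g : ℝ≥0 → X) : skorohodJ2 m f g ≤ 1 :=
  skorohodJ2_le hm.nonneg (fun t => ⟨t, hm.le_one _ _, by simp⟩)
    fun t => ⟨t, hm.le_one _ _, by simp⟩

theorem exists_lt_of_skorohodJ2_lt (hm : IsPseudometric m) {f g : ℝ≥0 → X} {b : ℝ}
    (h : skorohodJ2 m f g < b) :
    (∀ t, ∃ t' : ℝ≥0, m (f t) (g t') < b ∧ |(t : ℝ) - t'| < b) ∧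
      ∀ t', ∃ t : ℝ≥0, m (f t) (g t') < b ∧ |(t : ℝ) - t'| < b := by
  -- The choice `t' = t` bounds every infimum by `1`, so the real supremum is a true upper bound and
  -- not the default value `0`. The family `F` covers both orders of the arguments.
  have bdd : ∀ (F : ℝ≥0 → ℝ≥0 → X × X),
      BddAbove (Set.range fun t => ⨅ t' : ℝ≥0, max (m (F t t').1 (F t t').2) |(t : ℝ) - t'|) := by
    intro F
    refine ⟨1, ?_⟩
    rintro _ ⟨t, rfl⟩
    refine ciInf_le_of_le ⟨0, by rintro _ ⟨t', rfl⟩; exact le_max_of_le_left (hm.nonneg _ _)⟩ t ?_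
    exact max_le (hm.le_one _ _) (by simp)
  obtain ⟨h₁, h₂⟩ := max_lt_iff.1 h
  refine ⟨fun t => ?_, fun t' => ?_⟩
  · obtain ⟨t', ht'⟩ := exists_lt_of_ciInf_lt
      ((le_ciSup (bdd fun t t' => (f t, g t')) t).trans_lt h₁)
    exact ⟨t', max_lt_iff.1 ht'⟩
  · have h₂' : (⨆ t' : ℝ≥0, ⨅ t : ℝ≥0, max (m (f t) (g t')) |(t' : ℝ) - t|) < b := by
      simpa only [abs_sub_comm] using h₂
    obtain ⟨t, ht⟩ := exists_lt_of_ciInf_lt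
      ((le_ciSup (bdd fun t' t => (f t, g t')) t').trans_lt h₂')
    rw [abs_sub_comm] at ht
    exact ⟨t, max_lt_iff.1 ht⟩

theorem skorohodJ2_self (hm : IsPseudometric m) (f : ℝ≥0 → X) : skorohodJ2 m f f = 0 :=
  le_antisymm (skorohodJ2_le hm.nonneg (fun t => ⟨t, (hm.self _).le, by simp⟩)
    fun t => ⟨t, (hm.self _).le, by simp⟩) (skorohodJ2_nonneg hm.nonneg f f)

theorem skorohodJ2_symm (hm : IsPseudometric m) (f g : ℝ≥0 → X) :
    skorohodJ2 m f g = skorohodJ2 m g f := by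
  unfold skorohodJ2
  rw [max_comm]
  congr 1
  · refine iSup_congr fun t' => iInf_congr fun t => ?_
    rw [hm.symm, abs_sub_comm]
  · refine iSup_congr fun t => iInf_congr fun t' => ?_
    rw [hm.symm, abs_sub_comm]

theorem skorohodJ2_triangle (hm : IsPseudometric m) (f g h : ℝ≥0 → X) :
    skorohodJ2 m f h ≤ skorohodJ2 m f g + skorohodJ2 m g h := by
  refine le_of_forall_pos_le_add fun ε hε => ?_
  obtain ⟨h₁, h₂⟩ := exists_lt_of_skorohodJ2_lt hm (lt_add_of_pos_right (skorohodJ2 m f g)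
    (half_pos hε))
  obtain ⟨h₃, h₄⟩ := exists_lt_of_skorohodJ2_lt hm (lt_add_of_pos_right (skorohodJ2 m g h)
    (half_pos hε))
  refine skorohodJ2_le hm.nonneg (fun t => ?_) fun t => ?_
  · obtain ⟨t', ha, hb⟩ := h₁ t
    obtain ⟨t'', hc, hd⟩ := h₃ t'
    refine ⟨t'', (hm.triangle _ (g t') _).trans (by linarith), ?_⟩
    exact (abs_sub_le (t : ℝ) t' t'').trans (by linarith)
  · obtain ⟨t', ha, hb⟩ := h₄ t
    obtain ⟨t'', hc, hd⟩ := h₂ t'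
    refine ⟨t'', (hm.triangle _ (g t') _).trans (by linarith), ?_⟩
    exact (abs_sub_le (t'' : ℝ) t' t).trans (by linarith)

theorem skorohodJ2_le_add (hm : IsPseudometric m) (hm' : IsPseudometric m') {δ : ℝ} (hδ : 0 ≤ δ)
    (h : ∀ x y, m x y ≤ m' x y + δ) (f g : ℝ≥0 → X) :
    skorohodJ2 m f g ≤ skorohodJ2 m' f g + δ := by
  refine le_of_forall_pos_le_add fun ε hε => ?_
  obtain ⟨h₁, h₂⟩ := exists_lt_of_skorohodJ2_lt hm' (lt_add_of_pos_right (skorohodJ2 m' f g) hε)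
  refine skorohodJ2_le hm.nonneg (fun t => ?_) fun t => ?_
  · obtain ⟨t', ha, hb⟩ := h₁ t
    exact ⟨t', (h _ _).trans (by linarith), by linarith⟩
  · obtain ⟨t', ha, hb⟩ := h₂ t
    exact ⟨t', (h _ _).trans (by linarith), by linarith⟩

end Skorohod

namespace GSMP

variable {S E AP : Type*} [Fintype S] [Fintype E] (M : GSMP S E AP)

/-! ### The functional on state metrics -/

section Functional

variable {M} {k : ℝ} {m m' : M.GState → M.GState → ℝ}

theorem IsStateMetric.functional (hm : M.IsStateMetric m) (hk0 : 0 ≤ k) (hk1 : k ≤ 1) :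
    M.IsStateMetric (M.functional k m) := by
  have hJ1 : ∀ ω ω' : M.Trace, skorohodJ2 m (M.path ω) (M.path ω') ≤ 1 := fun ω ω' =>
    skorohodJ2_le_one hm.toIsPseudometric _ _
  have hle : ∀ x y, M.functional k m x y ≤ 1 := fun x y => by
    unfold GSMP.functional
    split_ifs
    · exact mul_le_one₀ hk1 (wasserstein_nonneg _ _ _) (wasserstein_le_one _ _ hJ1)
    · exact le_rfl
  have hnn : ∀ x y, 0 ≤ M.functional k m x y := fun x y => by
    unfold GSMP.functional
    split_ifs
    · exact mul_nonneg hk0 (wasserstein_nonneg _ _ _)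
    · exact zero_le_one
  refine ⟨⟨hnn, hle, fun x => ?_, fun x y => ?_, fun x y z => ?_⟩, fun x y h => if_neg h⟩
  · rw [GSMP.functional, if_pos rfl, wasserstein_self _ hJ1
      fun ω => skorohodJ2_self hm.toIsPseudometric _, mul_zero]
  · unfold GSMP.functional
    rw [wasserstein_symm _ _ hJ1 fun ω ω' => skorohodJ2_symm hm.toIsPseudometric _ _]
    simp only [eq_comm]
  · by_cases hxy : M.propsOf x = M.propsOf y
    · by_cases hyz : M.propsOf y = M.propsOf z
      · simp only [GSMP.functional, if_pos hxy, if_pos hyz, if_pos (hxy.trans hyz)]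
        rw [← mul_add]
        exact mul_le_mul_of_nonneg_left (wasserstein_triangle _ _ _ hJ1
          fun _ _ _ => skorohodJ2_triangle hm.toIsPseudometric _ _ _) hk0
      · have : M.functional k m y z = 1 := if_neg hyz
        linarith [hle x z, hnn x y]
    · have : M.functional k m x y = 1 := if_neg hxy
      linarith [hle x z, hnn y z]

/-- Both liftings let the error `δ` through unchanged; the factor `k` makes this a contraction. -/
theorem functional_le_add (hm : M.IsStateMetric m) (hm' : M.IsStateMetric m') (hk0 : 0 ≤ k)
    {δ : ℝ} (hδ : 0 ≤ δ) (h : ∀ x y, m x y ≤ m' x y + δ) (x y : M.GState) :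
    M.functional k m x y ≤ M.functional k m' x y + k * δ := by
  unfold GSMP.functional
  split_ifs
  · rw [← mul_add]
    refine mul_le_mul_of_nonneg_left (wasserstein_le_add _ _ (fun ω ω' =>
      skorohodJ2_le_one hm'.toIsPseudometric _ _) hδ fun ω ω' => ?_) hk0
    exact skorohodJ2_le_add hm.toIsPseudometric hm'.toIsPseudometric hδ h _ _
  · linarith [mul_nonneg hk0 hδ]

theorem abs_functional_sub_le (hm : M.IsStateMetric m) (hm' : M.IsStateMetric m') (hk0 : 0 ≤ k)
    {δ : ℝ} (hδ : 0 ≤ δ) (h : ∀ x y, |m x y - m' x y| ≤ δ) (x y : M.GState) :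
    |M.functional k m x y - M.functional k m' x y| ≤ k * δ := by
  rw [abs_sub_le_iff]
  constructor
  · linarith [functional_le_add hm hm' hk0 hδ
      (fun x y => by linarith [(abs_sub_le_iff.1 (h x y)).1]) x y]
  · linarith [functional_le_add hm' hm hk0 hδ
      (fun x y => by linarith [(abs_sub_le_iff.1 (h x y)).2]) x y]

end Functional

theorem isStateMetric_topMetric : M.IsStateMetric M.topMetric := by
  refine ⟨⟨fun x y => ?_, fun x y => ?_, fun x => if_pos rfl, fun x y => ?_, fun x y z => ?_⟩,
    fun x y h => if_neg h⟩
  · unfold topMetric; split_ifs <;> norm_num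
  · unfold topMetric; split_ifs <;> norm_num
  · unfold topMetric; simp only [eq_comm]
  · unfold topMetric
    split_ifs with h1 <;> first
      | exact absurd (‹M.propsOf x = M.propsOf y›.trans ‹M.propsOf y = M.propsOf z›) h1
      | norm_num

theorem isStateMetric_iter {k : ℝ} (hk0 : 0 ≤ k) (hk1 : k ≤ 1) (n : ℕ) :
    M.IsStateMetric (M.iter k n) := by
  induction n with
  | zero => exact M.isStateMetric_topMetric
  | succ n ih => exact ih.functional hk0 hk1

theorem abs_iter_succ_sub_le {k : ℝ} (hk0 : 0 ≤ k) (hk1 : k ≤ 1) (n : ℕ) (x y : M.GState) :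
    |M.iter k (n + 1) x y - M.iter k n x y| ≤ k ^ (n + 1) := by
  induction n generalizing x y with
  | zero =>
    change |M.functional k M.topMetric x y - M.topMetric x y| ≤ k ^ (0 + 1)
    unfold functional
    by_cases h : M.propsOf x = M.propsOf y
    · rw [if_pos h, topMetric, if_pos h, sub_zero, zero_add, pow_one,
        abs_of_nonneg (mul_nonneg hk0 (wasserstein_nonneg _ _ _))]
      exact mul_le_of_le_one_right hk0 (wasserstein_le_one _ _ fun ω ω' =>
        skorohodJ2_le_one M.isStateMetric_topMetric.toIsPseudometric _ _)
    · rw [if_neg h, topMetric, if_neg h]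
      simpa using hk0
  | succ n ih =>
    rw [pow_succ']
    exact abs_functional_sub_le (M.isStateMetric_iter hk0 hk1 (n + 1))
      (M.isStateMetric_iter hk0 hk1 n) hk0 (by positivity) ih x y

variable {M} in
theorem IsStateMetric.of_tendsto {f : ℕ → M.GState → M.GState → ℝ} {m : M.GState → M.GState → ℝ}
    (hf : ∀ n, M.IsStateMetric (f n))
    (h : ∀ x y, Tendsto (fun n => f n x y) atTop (𝓝 (m x y))) : M.IsStateMetric m where
  nonneg x y := ge_of_tendsto' (h x y) fun n => (hf n).nonneg x y
  le_one x y := le_of_tendsto' (h x y) fun n => (hf n).le_one x y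
  self x := tendsto_nhds_unique (h x x) (by simp [(hf _).self x])
  symm x y := tendsto_nhds_unique (h x y) (by simpa only [(hf _).symm x y] using h y x)
  triangle x y z := le_of_tendsto_of_tendsto' (h x z) ((h x y).add (h y z))
    fun n => (hf n).triangle x y z
  props_ne x y hxy := tendsto_nhds_unique (h x y) (by simp [(hf _).props_ne x y hxy])

/-- The contraction carries the geometric bound over to the fixed point equation for the limit. For
another fixed point `m'`, the distance to the `n`-th iterate is at most `1` for `n = 0` and shrinks
by `k` at each step, so `m'` has the same limit: maximality comes out as uniqueness. -/
theorem exists_isMaxFixedPoint {k : ℝ} (hk0 : 0 < k) (hk1 : k < 1) :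
    ∃ m : M.GState → M.GState → ℝ, M.IsMaxFixedPoint k m ∧
      ∀ (n : ℕ) (x y : M.GState), |m x y - M.iter k n x y| ≤ k ^ (n + 1) / (1 - k) := by
  have hd : ∀ (x y : M.GState) (n : ℕ),
      dist (M.iter k n x y) (M.iter k (n + 1) x y) ≤ k * k ^ n := fun x y n => by
    rw [dist_comm, Real.dist_eq, ← pow_succ']
    exact M.abs_iter_succ_sub_le hk0.le hk1.le n x y
  have hlim : ∀ x y : M.GState, ∃ l, Tendsto (fun n => M.iter k n x y) atTop (𝓝 l) := fun x y =>
    cauchySeq_tendsto_of_complete (cauchySeq_of_le_geometric k k hk1 (hd x y))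
  choose m hm using hlim
  have hbound : ∀ (n : ℕ) (x y : M.GState),
      |m x y - M.iter k n x y| ≤ k ^ (n + 1) / (1 - k) := fun n x y => by
    have := dist_le_of_le_geometric_of_tendsto k k hk1 (hd x y) (hm x y) n
    rwa [dist_comm, Real.dist_eq, ← pow_succ'] at this
  have hmm : M.IsStateMetric m :=
    IsStateMetric.of_tendsto (M.isStateMetric_iter hk0.le hk1.le) hm
  have h1k : 0 < 1 - k := by linarith
  have hzero : Tendsto (fun n : ℕ => k * (k ^ (n + 1) / (1 - k))) atTop (𝓝 0) := by
    have := ((tendsto_pow_atTop_nhds_zero_of_lt_one hk0.le hk1).comp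
      (tendsto_add_atTop_nat 1)).div_const (1 - k) |>.const_mul k
    simpa using this
  refine ⟨m, ⟨hmm, ?_, fun m' hm' hfix => ?_⟩, hbound⟩
  · funext x y
    refine tendsto_nhds_unique (f := fun n => M.iter k (n + 1) x y) ?_
      ((hm x y).comp (tendsto_add_atTop_nat 1))
    refine tendsto_iff_dist_tendsto_zero.2 (squeeze_zero (fun _ => dist_nonneg) (fun n => ?_) hzero)
    rw [dist_comm, Real.dist_eq]
    exact abs_functional_sub_le hmm (M.isStateMetric_iter hk0.le hk1.le n) hk0.le
      (by positivity) (hbound n) x y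
  · have : ∀ (n : ℕ) (x y : M.GState), |m' x y - M.iter k n x y| ≤ k ^ n := by
      intro n
      induction n with
      | zero =>
        intro x y
        have h0 := (M.isStateMetric_iter hk0.le hk1.le 0).nonneg x y
        have h1 := (M.isStateMetric_iter hk0.le hk1.le 0).le_one x y
        rw [pow_zero, abs_sub_le_iff]
        constructor <;> linarith [hm'.nonneg x y, hm'.le_one x y]
      | succ n ih =>
        intro x y
        rw [pow_succ']
        conv_lhs => rw [← hfix]
        exact abs_functional_sub_le hm' (M.isStateMetric_iter hk0.le hk1.le n) hk0.le
          (by positivity) ih x y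
    intro x y
    refine (tendsto_nhds_unique (hm x y) ?_).le
    refine tendsto_iff_dist_tendsto_zero.2 (squeeze_zero (fun _ => dist_nonneg) (fun n => ?_)
      (tendsto_pow_atTop_nhds_zero_of_lt_one hk0.le hk1))
    rw [dist_comm, Real.dist_eq]
    exact this n x y

theorem tendstoUniformly_iter {k : ℝ} (hk0 : 0 < k) (hk1 : k < 1) {m : M.GState → M.GState → ℝ}
    (h : ∀ (n : ℕ) (x y : M.GState), |m x y - M.iter k n x y| ≤ k ^ (n + 1) / (1 - k)) :
    TendstoUniformly (fun n (p : M.GState × M.GState) => M.iter k n p.1 p.2)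
      (fun p => m p.1 p.2) atTop := by
  have hzero : Tendsto (fun n : ℕ => k ^ (n + 1) / (1 - k)) atTop (𝓝 0) := by
    have := ((tendsto_pow_atTop_nhds_zero_of_lt_one hk0.le hk1).comp
      (tendsto_add_atTop_nat 1)).div_const (1 - k)
    simpa using this
  refine Metric.tendstoUniformly_iff.2 fun ε hε => ?_
  filter_upwards [hzero.eventually_lt_const hε] with n hn p
  exact (h n p.1 p.2).trans_lt hn

/-! ### Paths of traces -/

/-- The generalized state reached from `x` after letting time `t` pass, if no clock reaches `0`. -/
noncomputable def elapse (x : M.GState) (t : ℝ) : M.GState :=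
  open Classical in
  if h : t < M.firstTime x.1 then ⟨M.evolve x.1 t, fun n => M.good_evolve (x.2 n) h⟩ else x

theorem elapse_val {x : M.GState} {t : ℝ} (h : t < M.firstTime x.1) :
    (M.elapse x t).1 = M.evolve x.1 t := by
  rw [elapse, dif_pos h]

theorem firstTime_evolve (x : Config S E) (t : ℝ) :
    M.firstTime (M.evolve x t) = M.firstTime x - t := by
  refine le_antisymm ?_ ?_
  · obtain ⟨j, hj, he⟩ := Finset.exists_mem_eq_inf' (M.active_nonempty x.state) (M.runTime x)
    have : M.firstTime x = M.runTime x j := he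
    rw [this, ← M.runTime_evolve x t hj]
    exact Finset.inf'_le _ hj
  · refine Finset.le_inf' _ _ fun j hj => ?_
    rw [M.runTime_evolve x t hj]
    exact sub_le_sub_right (Finset.inf'_le _ hj) t

theorem firstTime_elapse {x : M.GState} {t : ℝ} (h : t < M.firstTime x.1) :
    M.firstTime (M.elapse x t).1 = M.firstTime x.1 - t := by
  rw [M.elapse_val h, firstTime_evolve]

theorem elapse_elapse {x : M.GState} {a b : ℝ} (ha : a < M.firstTime x.1)
    (hab : a + b < M.firstTime x.1) : M.elapse (M.elapse x a) b = M.elapse x (a + b) := by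
  have hb : b < M.firstTime (M.elapse x a).1 := by rw [M.firstTime_elapse ha]; linarith
  refine Subtype.ext ?_
  rw [M.elapse_val hb, M.elapse_val hab, M.elapse_val ha]
  refine Config.ext rfl (funext fun j => ?_)
  by_cases hj : j ∈ M.active x.1.state
  · have h1 : (M.evolve (M.evolve x.1 a) b).clock j =
        (M.evolve x.1 a).clock j - M.rate x.1.state j * b := if_pos hj
    have h2 : ∀ t, (M.evolve x.1 t).clock j = x.1.clock j - M.rate x.1.state j * t :=
      fun t => if_pos hj
    rw [h1, h2, h2]
    ring
  · exact (if_neg hj).trans (if_neg hj).symm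

theorem stage_eq (ω : M.Trace) {n : ℕ} {t : ℝ≥0} (h₁ : M.jumpTime ω.1 n ≤ t)
    (h₂ : (t : ℝ) < M.jumpTime ω.1 (n + 1)) : M.stage ω t = n := by
  obtain ⟨h₃, h₄⟩ := M.stage_spec ω t
  have h5 := (M.strictMono_jumpTime ω.1).lt_iff_lt.1 (h₁.trans_lt h₄)
  have h6 := (M.strictMono_jumpTime ω.1).lt_iff_lt.1 (h₃.trans_lt h₂)
  omega

theorem path_eq_elapse (ω : M.Trace) {n : ℕ} {a : ℝ} {t : ℝ≥0} (ht : (t : ℝ) = M.jumpTime ω.1 n + a)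
    (h₁ : 0 ≤ a) (h₂ : a < M.firstTime (ω.1 n).1) : M.path ω t = M.elapse (ω.1 n) a := by
  have hs : M.stage ω t = n := M.stage_eq ω (by linarith) (by rw [jumpTime_succ]; linarith)
  refine Subtype.ext ?_
  rw [M.elapse_val h₂]
  simp only [path]
  rw [hs, ht, add_sub_cancel_left]

theorem exists_path_eq_elapse (ω : M.Trace) (t : ℝ≥0) :
    ∃ (n : ℕ) (a : ℝ), 0 ≤ a ∧ a < M.firstTime (ω.1 n).1 ∧ (t : ℝ) = M.jumpTime ω.1 n + a ∧
      M.path ω t = M.elapse (ω.1 n) a := by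
  obtain ⟨h₃, h₄⟩ := M.stage_spec ω t
  rw [jumpTime_succ] at h₄
  have ht : (t : ℝ) = M.jumpTime ω.1 (M.stage ω t) + (t - M.jumpTime ω.1 (M.stage ω t)) := by ring
  exact ⟨M.stage ω t, t - M.jumpTime ω.1 (M.stage ω t), by linarith, by linarith, ht,
    M.path_eq_elapse ω ht (by linarith) (by linarith)⟩

theorem jumpTime_nonneg (ω : ℕ → M.GState) (n : ℕ) : 0 ≤ M.jumpTime ω n :=
  Finset.sum_nonneg fun k _ => (M.firstTime_val_pos (ω k)).le

/-- Every position in the sequence `ω` has a position of `ω'` close to it. -/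
def Follows (m : M.GState → M.GState → ℝ) (ε : ℝ) (ω ω' : ℕ → M.GState) : Prop :=
  ∀ n, ∀ a, 0 ≤ a → a < M.firstTime (ω n).1 → ∃ b, 0 ≤ b ∧ b < M.firstTime (ω' n).1 ∧
    |(M.jumpTime ω n + a) - (M.jumpTime ω' n + b)| ≤ ε ∧ m (M.elapse (ω n) a) (M.elapse (ω' n) b) ≤ ε

theorem skorohodJ2_path_le {m : M.GState → M.GState → ℝ} (hm : IsPseudometric m) {ε : ℝ}
    {ω ω' : M.Trace} (h : M.Follows m ε ω.1 ω'.1) (h' : M.Follows m ε ω'.1 ω.1) :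
    skorohodJ2 m (M.path ω) (M.path ω') ≤ ε := by
  have aux : ∀ {ω ω' : M.Trace}, M.Follows m ε ω.1 ω'.1 → ∀ t : ℝ≥0,
      ∃ t' : ℝ≥0, m (M.path ω t) (M.path ω' t') ≤ ε ∧ |(t : ℝ) - t'| ≤ ε := by
    intro ω ω' h t
    obtain ⟨n, a, ha0, ha1, ht, hp⟩ := M.exists_path_eq_elapse ω t
    obtain ⟨b, hb0, hb1, hd, hm⟩ := h n a ha0 ha1
    obtain ⟨t', ht'⟩ : ∃ t' : ℝ≥0, (t' : ℝ) = M.jumpTime ω'.1 n + b :=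
      ⟨(M.jumpTime ω'.1 n + b).toNNReal,
        Real.coe_toNNReal _ (add_nonneg (M.jumpTime_nonneg _ _) hb0)⟩
    refine ⟨t', ?_, ?_⟩
    · rw [hp, M.path_eq_elapse ω' ht' hb0 hb1]
      exact hm
    · rw [ht, ht']; exact hd
  refine skorohodJ2_le hm.nonneg (aux h) fun t' => ?_
  obtain ⟨t, h₁, h₂⟩ := aux h' t'
  exact ⟨t, by rwa [hm.symm], by rwa [abs_sub_comm]⟩

end GSMP

/-! ### Couplings through a common image -/

section Coupling

/-- The common part `σ` is placed on the diagonal. The two remainders have the same mass `t`, and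
their product divided by `t` supplies the missing marginals, so the off-diagonal mass is at most
`t`. -/
theorem exists_coupling_of_common_part {Y : Type*} [MeasurableSpace Y] [MeasurableEq Y]
    {p q σ : Measure Y} [IsProbabilityMeasure p] [IsProbabilityMeasure q] (hp : σ ≤ p) (hq : σ ≤ q)
    {τ : ℝ≥0∞} (hτ : 1 ≤ σ Set.univ + τ) :
    ∃ ρ : Measure (Y × Y), ρ.map Prod.fst = p ∧ ρ.map Prod.snd = q ∧
      ρ (Set.diagonal Y)ᶜ ≤ τ := by
  have : IsFiniteMeasure σ := isFiniteMeasure_of_le p hp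
  have hp' : p - σ + σ = p := Measure.sub_add_cancel_of_le hp
  have hq' : q - σ + σ = q := Measure.sub_add_cancel_of_le hq
  have hmass : ∀ r : Measure Y, IsProbabilityMeasure r → r - σ + σ = r →
      (r - σ) Set.univ = 1 - σ Set.univ := by
    intro r _ hr
    refine ENNReal.eq_sub_of_add_eq (measure_ne_top σ _) ?_
    rw [← Measure.add_apply, hr, measure_univ]
  set t := 1 - σ Set.univ with ht
  have hpt := hmass p inferInstance hp'
  have hqt := hmass q inferInstance hq'
  have htop : t ≠ ⊤ := ne_top_of_le_ne_top ENNReal.one_ne_top tsub_le_self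
  have hd : Measurable fun y : Y => (y, y) := by fun_prop
  -- For `t = 0` the factor `t⁻¹` is `⊤`, which is harmless because the remainders vanish.
  have hcancel : ∀ r : Measure Y, IsProbabilityMeasure r → r - σ + σ = r →
      t⁻¹ • t • (r - σ) = r - σ := by
    intro r h1 hr
    by_cases h0 : t = 0
    · rw [Measure.measure_univ_eq_zero.1 ((hmass r h1 hr).trans h0)]
      simp
    · rw [smul_smul, ENNReal.inv_mul_cancel h0 htop, one_smul]
  have : IsFiniteMeasure (p - σ) := ⟨by rw [hpt]; exact htop.lt_top⟩
  have : IsFiniteMeasure (q - σ) := ⟨by rw [hqt]; exact htop.lt_top⟩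
  refine ⟨σ.map (fun y => (y, y)) + t⁻¹ • (p - σ).prod (q - σ), ?_, ?_, ?_⟩
  · rw [Measure.map_add _ _ measurable_fst, Measure.map_smul, Measure.map_fst_prod, hqt,
      hcancel p inferInstance hp', Measure.map_map measurable_fst hd, add_comm]
    conv_rhs => rw [← hp']
    congr 1
    exact Measure.map_id
  · rw [Measure.map_add _ _ measurable_snd, Measure.map_smul, Measure.map_snd_prod, hpt,
      hcancel q inferInstance hq', Measure.map_map measurable_snd hd, add_comm]
    conv_rhs => rw [← hq']
    congr 1
    exact Measure.map_id
  · rw [Measure.add_apply, Measure.map_apply hd measurableSet_diagonal.compl]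
    have h0 : (fun y : Y => (y, y)) ⁻¹' (Set.diagonal Y)ᶜ = ∅ := by
      ext y; simp
    rw [h0, measure_empty, zero_add, Measure.smul_apply, smul_eq_mul]
    calc t⁻¹ * (p - σ).prod (q - σ) (Set.diagonal Y)ᶜ
        ≤ t⁻¹ * (p - σ).prod (q - σ) Set.univ := by gcongr; exact Set.subset_univ _
      _ = t⁻¹ * t * t := by
          rw [← Set.univ_prod_univ, Measure.prod_prod, hpt, hqt, mul_assoc]
      _ ≤ 1 * t := by gcongr; exact ENNReal.inv_mul_le_one t
      _ ≤ τ := by rw [one_mul, ht]; exact tsub_le_iff_left.2 hτ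

/-- The images under `Θ` are coupled and the coupling is lifted by two gluings, one with the law of
the graph of `Θ` under `P` and one under `Q`. The graph relations survive almost everywhere, so the
images of the lifted pair are the coupled images. -/
theorem exists_coupling_of_map_common_part {Ω Y : Type*} [MeasurableSpace Ω] [StandardBorelSpace Ω]
    [MeasurableSpace Y] [StandardBorelSpace Y] {Θ : Ω → Y} (hΘ : Measurable Θ) {P Q : Measure Ω}
    [IsProbabilityMeasure P] [IsProbabilityMeasure Q] {σ : Measure Y} (hP : σ ≤ P.map Θ)
    (hQ : σ ≤ Q.map Θ) {τ : ℝ≥0∞} (hτ : 1 ≤ σ Set.univ + τ) :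
    ∃ ρ : Measure (Ω × Ω), ρ.map Prod.fst = P ∧ ρ.map Prod.snd = Q ∧
      ρ {p | Θ p.1 ≠ Θ p.2} ≤ τ := by
  have : Nonempty Ω := nonempty_of_isProbabilityMeasure P
  have : Nonempty Y := ⟨Θ (Classical.arbitrary Ω)⟩
  have : IsProbabilityMeasure (P.map Θ) := Measure.isProbabilityMeasure_map hΘ.aemeasurable
  have : IsProbabilityMeasure (Q.map Θ) := Measure.isProbabilityMeasure_map hΘ.aemeasurable
  obtain ⟨ρ₂, h₁, h₂, h₃⟩ := exists_coupling_of_common_part hP hQ hτ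
  have hg₁ : Measurable fun ω => (ω, Θ ω) := measurable_id.prodMk hΘ
  have hg₂ : Measurable fun ω => (Θ ω, ω) := hΘ.prodMk measurable_id
  have : IsProbabilityMeasure ρ₂ := isProbabilityMeasure_of_map_fst h₁
  obtain ⟨μ, hμ₁, hμ₂⟩ := exists_gluing (P.map fun ω => (ω, Θ ω)) ρ₂ (by
    rw [Measure.map_map measurable_snd hg₁, h₁]; rfl)
  have hm₁ : Measurable fun p : Y × Ω × Y => (p.2.1, p.1) := by fun_prop
  have hm₂ : Measurable fun p : Y × Ω × Y => (p.1, p.2.2) := by fun_prop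
  have hm₃ : Measurable fun p : Y × Ω × Y => ((p.2.1, p.1), p.2.2) := by fun_prop
  have : IsFiniteMeasure μ := by
    constructor
    have : ρ₂ Set.univ < ⊤ := measure_lt_top _ _
    rwa [← hμ₂, Measure.map_apply hm₂ .univ, Set.preimage_univ] at this
  obtain ⟨ν, hν₁, hν₂⟩ := exists_gluing (μ.map fun p => ((p.2.1, p.1), p.2.2))
    (Q.map fun ω => (Θ ω, ω)) (by
      rw [Measure.map_map measurable_snd hm₃, Measure.map_map measurable_fst hg₂]
      have : Q.map Θ = (μ.map fun p => (p.1, p.2.2)).map Prod.snd := by rw [hμ₂, h₂]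
      rw [Measure.map_map measurable_snd hm₂] at this
      exact this.symm)
  have hn₁ : Measurable fun p : Y × (Ω × Y) × Ω => (p.2.1, p.1) := by fun_prop
  have hn₂ : Measurable fun p : Y × (Ω × Y) × Ω => (p.1, p.2.2) := by fun_prop
  have hn₃ : Measurable fun p : Y × (Ω × Y) × Ω => (p.2.1.1, p.2.2) := by fun_prop
  have hΩY : ν.map (fun p => p.2.1) = P.map fun ω => (ω, Θ ω) := by
    rw [← hμ₁]
    have : (ν.map fun p => (p.2.1, p.1)).map Prod.fst = _ :=
      congrArg (fun r => r.map Prod.fst) hν₁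
    rw [Measure.map_map measurable_fst hn₁, Measure.map_map measurable_fst hm₃] at this
    exact this
  have hYY : ν.map (fun p => (p.2.1.2, p.1)) = ρ₂ := by
    rw [← hμ₂]
    have hf : Measurable fun q : (Ω × Y) × Y => (q.1.2, q.2) := by fun_prop
    have : (ν.map fun p => (p.2.1, p.1)).map (fun q => (q.1.2, q.2)) = _ :=
      congrArg (fun r => r.map fun q => (q.1.2, q.2)) hν₁
    rw [Measure.map_map hf hn₁, Measure.map_map hf hm₃] at this
    exact this
  refine ⟨ν.map fun p => (p.2.1.1, p.2.2), ?_, ?_, ?_⟩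
  · have : (ν.map fun p => p.2.1).map Prod.fst = _ := congrArg (fun r => r.map Prod.fst) hΩY
    rw [Measure.map_map measurable_fst (by fun_prop), Measure.map_map measurable_fst hg₁] at this
    rw [Measure.map_map measurable_fst hn₃]
    exact this.trans Measure.map_id
  · have : (ν.map fun p => (p.1, p.2.2)).map Prod.snd = _ := congrArg (fun r => r.map Prod.snd) hν₂
    rw [Measure.map_map measurable_snd hn₂, Measure.map_map measurable_snd hg₂] at this
    rw [Measure.map_map measurable_snd hn₃]
    exact this.trans Measure.map_id
  · have hmeas : MeasurableSet {p : Ω × Ω | Θ p.1 ≠ Θ p.2} :=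
      (measurableSet_eq_fun (hΘ.comp measurable_fst) (hΘ.comp measurable_snd)).compl
    rw [Measure.map_apply hn₃ hmeas]
    have e₁ : ∀ᵐ p ∂ν, p.2.1.2 = Θ p.2.1.1 := by
      have : ∀ᵐ q ∂P.map fun ω => (ω, Θ ω), q.2 = Θ q.1 := by
        rw [ae_map_iff hg₁.aemeasurable (measurableSet_eq_fun (by fun_prop) (by fun_prop))]
        simp
      rw [← hΩY] at this
      exact ae_of_ae_map (by fun_prop) this
    have e₂ : ∀ᵐ p ∂ν, p.1 = Θ p.2.2 := by
      have : ∀ᵐ q ∂Q.map fun ω => (Θ ω, ω), q.1 = Θ q.2 := by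
        rw [ae_map_iff hg₂.aemeasurable (measurableSet_eq_fun (by fun_prop) (by fun_prop))]
        simp
      rw [← hν₂] at this
      exact ae_of_ae_map (by fun_prop) this
    refine le_trans (measure_mono_ae ?_)
      (show ν ((fun p => (p.2.1.2, p.1)) ⁻¹' (Set.diagonal Y)ᶜ) ≤ τ from ?_)
    · filter_upwards [e₁, e₂] with p h₁ h₂ hp
      change p.2.1.2 ≠ p.1
      rw [h₁, h₂]
      exact hp
    · rw [← Measure.map_apply (by fun_prop) measurableSet_diagonal.compl, hYY]
      exact h₃

end Coupling

/-! ### Countable measurable classifications -/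

/-- There is a measurable map to `ℕ` such that points with the same image are related. -/
def Classifiable {X : Type*} [MeasurableSpace X] (R : X → X → Prop) : Prop :=
  ∃ π : X → ℕ, Measurable π ∧ ∀ x y, π x = π y → R x y

namespace Classifiable

variable {X : Type*} [MeasurableSpace X] {R R' : X → X → Prop}

theorem of_countable {K : Type*} [Countable K] [MeasurableSpace K] [MeasurableSingletonClass K]
    {f : X → K} (hf : Measurable f) (h : ∀ x y, f x = f y → R x y) : Classifiable R := by
  obtain ⟨e, he⟩ := exists_injective_nat K
  exact ⟨e ∘ f, (measurable_of_countable e).comp hf, fun x y hxy => h x y (he hxy)⟩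

theorem mono (hR : Classifiable R) (h : ∀ x y, R x y → R' x y) : Classifiable R' := by
  obtain ⟨π, hπ, hR⟩ := hR
  exact ⟨π, hπ, fun x y hxy => h x y (hR x y hxy)⟩

theorem and (hR : Classifiable R) (hR' : Classifiable R') :
    Classifiable fun x y => R x y ∧ R' x y := by
  obtain ⟨π, hπ, hR⟩ := hR
  obtain ⟨π', hπ', hR'⟩ := hR'
  refine of_countable (hπ.prodMk hπ') fun x y h => ?_
  exact ⟨hR x y (congrArg Prod.fst h), hR' x y (congrArg Prod.snd h)⟩

theorem of_fiberwise {D : X → ℕ} (hD : Measurable D)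
    (h : ∀ q, Classifiable fun x y => D x = q → D y = q → R x y) : Classifiable R := by
  choose π hπ hR using h
  have hm : Measurable fun x => π (D x) x :=
    (measurable_from_prod_countable_right (f := fun p : ℕ × X => π p.1 p.2) hπ).comp
      (hD.prodMk measurable_id)
  refine of_countable (hD.prodMk hm) fun x y hxy => ?_
  have h1 : D x = D y := congrArg Prod.fst hxy
  have h2 : π (D x) x = π (D y) y := congrArg Prod.snd hxy
  rw [← h1] at h2
  exact hR (D x) x y h2 rfl h1.symm

/-- A cover by countably many measurable sets in which all points are related. -/
theorem of_cover {C : ℕ → Set X} (hC : ∀ n, MeasurableSet (C n)) (hcov : ∀ x, ∃ n, x ∈ C n)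
    (h : ∀ n, ∀ x ∈ C n, ∀ y ∈ C n, R x y) : Classifiable R := by
  classical
  refine ⟨fun x => Nat.find (hcov x), measurable_find hcov hC, fun x y hxy => ?_⟩
  have hxy' : Nat.find (hcov x) = Nat.find (hcov y) := hxy
  have hy := Nat.find_spec (hcov y)
  rw [← hxy'] at hy
  exact h _ x (Nat.find_spec (hcov x)) y hy

end Classifiable

/-- All `κ x` have densities in the separable space `L¹(Λ)`, and `x` is classified by an element of
a dense sequence within `ε / 2` of its density. Two densities close to the same element are within
`ε` of each other, and their minimum is the density of the common part. The jointly measurable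
version of the densities makes the classes measurable. -/
theorem classifiable_common_part {X Y : Type*} [MeasurableSpace X] [MeasurableSpace Y]
    [MeasurableSpace.CountablyGenerated Y] (κ : Kernel X Y) [IsFiniteKernel κ] (Λ : Measure Y)
    [IsFiniteMeasure Λ] (hκ : ∀ x, κ x ≪ Λ) {ε : ℝ≥0∞} (hε : ε ≠ 0) :
    Classifiable fun x y => ∃ σ : Measure Y, σ ≤ κ x ∧ σ ≤ κ y ∧ κ x Set.univ ≤ σ Set.univ + ε := by
  set f : X → Y → ℝ≥0∞ := Kernel.rnDeriv κ (Kernel.const X Λ) with hf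
  have hfm : Measurable (Function.uncurry f) := Kernel.measurable_rnDeriv _ _
  have hfx : ∀ x, Measurable (f x) := fun x => hfm.comp measurable_prodMk_left
  have hd : ∀ x, Λ.withDensity (f x) = κ x := by
    intro x
    have h := Kernel.withDensity_rnDeriv_eq (κ := κ) (η := Kernel.const X Λ) (a := x)
      (by simpa using hκ x)
    rwa [Kernel.withDensity_apply _ hfm, Kernel.const_apply] at h
  have htop : ∀ x, ∀ᵐ y ∂Λ, f x y ≠ ⊤ := by
    intro x
    have := ae_lt_top (hfx x) (μ := Λ) (by
      rw [← setLIntegral_univ, ← withDensity_apply _ .univ, hd]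
      exact measure_ne_top _ _)
    filter_upwards [this] with y hy using hy.ne
  have : Fact ((1 : ℝ≥0∞) ≠ ⊤) := ⟨ENNReal.one_ne_top⟩
  have : TopologicalSpace.SeparableSpace (Lp ℝ 1 Λ) := inferInstance
  let g : ℕ → Lp ℝ 1 Λ := TopologicalSpace.denseSeq _
  have hgm : ∀ n, Measurable (g n : Y → ℝ) := fun n => (Lp.stronglyMeasurable (g n)).measurable
  have hε2 : ε / 2 ≠ 0 := by simpa using hε
  refine Classifiable.of_cover
    (C := fun n => {x | ∫⁻ y, ‖(f x y).toReal - g n y‖ₑ ∂Λ < ε / 2}) (fun n => ?_) (fun x => ?_) ?_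
  · have h1 : Measurable fun p : X × Y => ‖(f p.1 p.2).toReal - g n p.2‖ₑ :=
      (hfm.ennreal_toReal.sub ((hgm n).comp measurable_snd)).enorm
    exact measurableSet_lt h1.lintegral_prod_right' measurable_const
  · have hint : Integrable (fun y => (f x y).toReal) Λ := by
      refine integrable_toReal_of_lintegral_ne_top (hfx x).aemeasurable ?_
      rw [← setLIntegral_univ, ← withDensity_apply _ .univ, hd]
      exact measure_ne_top _ _
    let F : Lp ℝ 1 Λ := (memLp_one_iff_integrable.2 hint).toLp _
    obtain ⟨n, hn⟩ := (TopologicalSpace.denseRange_denseSeq (Lp ℝ 1 Λ)).exists_mem_open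
      (Metric.isOpen_eball (x := F) (ε := ε / 2)) ⟨F, Metric.mem_eball_self (by positivity)⟩
    refine ⟨n, ?_⟩
    have h2 : edist (g n) F < ε / 2 := hn
    rw [edist_comm, Lp.edist_def, eLpNorm_one_eq_lintegral_enorm] at h2
    refine lt_of_eq_of_lt (lintegral_congr_ae ?_) h2
    filter_upwards [MemLp.coeFn_toLp (memLp_one_iff_integrable.2 hint)] with y hy
    simp only [Pi.sub_apply]
    rw [hy]
  · intro n x hx y hy
    refine ⟨Λ.withDensity fun z => min (f x z) (f y z), ?_, ?_, ?_⟩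
    · rw [← hd x]; exact withDensity_mono (Eventually.of_forall fun z => min_le_left _ _)
    · rw [← hd y]; exact withDensity_mono (Eventually.of_forall fun z => min_le_right _ _)
    · rw [← hd x, withDensity_apply _ .univ, withDensity_apply _ .univ, setLIntegral_univ,
        setLIntegral_univ]
      have hxm : Measurable fun z => ‖(f x z).toReal - g n z‖ₑ :=
        ((hfx x).ennreal_toReal.sub (hgm n)).enorm
      calc ∫⁻ z, f x z ∂Λ ≤ ∫⁻ z, (min (f x z) (f y z) +
            (‖(f x z).toReal - g n z‖ₑ + ‖(f y z).toReal - g n z‖ₑ)) ∂Λ := by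
            refine lintegral_mono_ae ?_
            filter_upwards [htop x, htop y] with z h1 h2
            rcases le_total (f x z) (f y z) with h | h
            · rw [min_eq_left h]; exact le_self_add
            · rw [min_eq_right h]
              lift f x z to ℝ≥0 using h1 with a
              lift f y z to ℝ≥0 using h2 with b
              rw [Real.enorm_eq_ofReal_abs, Real.enorm_eq_ofReal_abs,
                ← ENNReal.ofReal_add (abs_nonneg _) (abs_nonneg _), ← ENNReal.ofReal_coe_nnreal,
                ← ENNReal.ofReal_coe_nnreal (p := b),
                ← ENNReal.ofReal_add b.coe_nonneg (by positivity)]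
              simp only [ENNReal.toReal_ofReal NNReal.zero_le_coe]
              refine ENNReal.ofReal_le_ofReal ?_
              have h3 := le_abs_self ((a : ℝ) - g n z)
              have h4 := neg_abs_le ((b : ℝ) - g n z)
              linarith
        _ = ∫⁻ z, min (f x z) (f y z) ∂Λ + (∫⁻ z, ‖(f x z).toReal - g n z‖ₑ ∂Λ +
            ∫⁻ z, ‖(f y z).toReal - g n z‖ₑ ∂Λ) := by
            rw [lintegral_add_left ((hfx x).min (hfx y)), lintegral_add_left hxm]
        _ ≤ _ := by
            gcongr
            refine (add_le_add (le_of_lt hx) (le_of_lt hy)).trans ?_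
            rw [ENNReal.add_halves]

/-! ### Absolute continuity of product measures -/

section Pi

variable {ι : Type*} [Fintype ι]

theorem pi_withDensity {μ : ι → Measure ℝ} [∀ i, IsProbabilityMeasure (μ i)] {f : ι → ℝ → ℝ≥0∞}
    (hf : ∀ i, Measurable (f i)) [∀ i, SigmaFinite ((μ i).withDensity (f i))] :
    Measure.pi (fun i => (μ i).withDensity (f i)) =
      (Measure.pi μ).withDensity fun x => ∏ i, f i (x i) := by
  refine (Measure.pi_eq fun s hs => ?_)
  rw [withDensity_apply _ (MeasurableSet.univ_pi hs), ← lintegral_indicator (MeasurableSet.univ_pi hs)]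
  have h1 : ∀ x : ι → ℝ, (Set.univ.pi s).indicator (fun x => ∏ i, f i (x i)) x =
      ∏ i, (s i).indicator (f i) (x i) := by
    intro x
    classical
    by_cases hx : x ∈ Set.univ.pi s
    · rw [Set.indicator_of_mem hx]
      exact Finset.prod_congr rfl fun i _ => (Set.indicator_of_mem (hx i trivial) _).symm
    · rw [Set.indicator_of_notMem hx]
      simp only [Set.mem_pi, Set.mem_univ, true_implies, not_forall] at hx
      obtain ⟨i, hi⟩ := hx
      exact (Finset.prod_eq_zero (Finset.mem_univ i) (Set.indicator_of_notMem hi _)).symm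
  simp_rw [h1]
  have hind := iIndepFun_pi (μ := μ) (X := fun i => (s i).indicator (f i))
    fun i => ((hf i).indicator (hs i)).aemeasurable
  rw [lintegral_prod_eq_prod_lintegral_of_indepFun (s := Finset.univ)
    (fun i (x : ι → ℝ) => (s i).indicator (f i) (x i)) hind
    fun i => ((hf i).indicator (hs i)).comp (measurable_pi_apply i)]
  refine Finset.prod_congr rfl fun i _ => ?_
  rw [withDensity_apply _ (hs i), ← lintegral_indicator (hs i)]
  exact (measurePreserving_eval μ i).lintegral_comp ((hf i).indicator (hs i))

theorem pi_absolutelyContinuous {μ ν : ι → Measure ℝ} [∀ i, IsProbabilityMeasure (μ i)]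
    [∀ i, IsProbabilityMeasure (ν i)] (h : ∀ i, μ i ≪ ν i) : Measure.pi μ ≪ Measure.pi ν := by
  have hd : ∀ i, (ν i).withDensity ((μ i).rnDeriv (ν i)) = μ i := fun i =>
    Measure.withDensity_rnDeriv_eq _ _ (h i)
  have : ∀ i, SigmaFinite ((ν i).withDensity ((μ i).rnDeriv (ν i))) := fun i => by
    rw [hd]; infer_instance
  have h2 := pi_withDensity (μ := ν) (f := fun i => (μ i).rnDeriv (ν i))
    fun i => Measure.measurable_rnDeriv _ _
  have h3 : Measure.pi μ = Measure.pi fun i => (ν i).withDensity ((μ i).rnDeriv (ν i)) := by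
    congr 1
    funext i
    exact (hd i).symm
  rw [h3, h2]
  exact withDensity_absolutelyContinuous _ _

theorem map_prod_pi_pi {μ ν : ι → Measure ℝ} [∀ i, IsProbabilityMeasure (μ i)]
    [∀ i, IsProbabilityMeasure (ν i)] {φ : ι → ℝ × ℝ → ℝ} (hφ : ∀ i, Measurable (φ i)) :
    ((Measure.pi μ).prod (Measure.pi ν)).map (fun p i => φ i (p.1 i, p.2 i)) =
      Measure.pi fun i => ((μ i).prod (ν i)).map (φ i) := by
  have : ∀ i, IsProbabilityMeasure (((μ i).prod (ν i)).map (φ i)) := fun i =>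
    Measure.isProbabilityMeasure_map (hφ i).aemeasurable
  have he := (measurePreserving_arrowProdEquivProdArrow ℝ ℝ ι μ ν).map_eq
  have hm : Measurable fun (p : (ι → ℝ) × (ι → ℝ)) i => φ i (p.1 i, p.2 i) :=
    measurable_pi_lambda _ fun i => (hφ i).comp (by fun_prop)
  rw [← he, Measure.map_map hm (MeasurableEquiv.measurable _),
    ← Measure.pi_map_pi fun i => (hφ i).aemeasurable]
  rfl

end Pi

/-- The standard Gaussian measure, used as a finite measure equivalent to Lebesgue measure. -/
noncomputable abbrev stdGauss : Measure ℝ := gaussianReal 0 1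

theorem absolutelyContinuous_stdGauss {μ : Measure ℝ} (h : μ ≪ volume) : μ ≪ stdGauss :=
  h.trans (gaussianReal_absolutelyContinuous' 0 one_ne_zero)

theorem map_sub_stdGauss_absolutelyContinuous (c : ℝ) :
    stdGauss.map (fun t => t - c) ≪ stdGauss := by
  refine absolutelyContinuous_stdGauss ?_
  have h := (gaussianReal_absolutelyContinuous 0 one_ne_zero).map
    (show Measurable fun t : ℝ => t - c by fun_prop)
  rwa [(measurePreserving_sub_right volume c).map_eq] at h

namespace GSMP

variable {S E AP : Type*} [Fintype S] [Fintype E] (M : GSMP S E AP)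

/-! ### Absolute continuity of the clocks that have been set -/

open Classical in
/-- The configuration in `s` with the values `a` for the clocks in `A` and `w` for the others. -/
noncomputable def blend (s : S) (A : Finset E) (a w : E → ℝ) : Config S E :=
  ⟨s, fun j => if j ∈ A then a j else if j ∈ M.active s then w j else 0⟩

open Classical in
/-- The clocks in `A` that are neither set nor dropped in a transition from `s` to `s'`
through `i`. -/
noncomputable def kept (i : E) (s s' : S) (A : Finset E) : Finset E :=
  A.filter fun j => j ∈ M.active s' ∧ j ∈ M.active s ∧ j ≠ i

/-- The reference measure on clock vectors. -/
noncomputable abbrev gaussClocks (E : Type*) [Fintype E] : Measure (E → ℝ) :=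
  Measure.pi fun _ => stdGauss

open Classical in
/-- The values of the clocks outside `A` after a transition at time `z`. -/
noncomputable def nextClocks (i : E) (s s' : S) (z : ℝ) (w v : E → ℝ) : E → ℝ := fun j =>
  if j ∈ M.active s' ∧ j ∈ M.active s ∧ j ≠ i then w j - M.rate s j * z
  else if j ∈ M.active s' then v j else w j

theorem measurable_blend (s : S) (A : Finset E) :
    Measurable fun p : (E → ℝ) × (E → ℝ) => M.blend s A p.1 p.2 := by
  refine (measurable_config_mk s).comp (measurable_pi_lambda _ fun j => ?_)
  split_ifs <;> fun_prop

theorem measurable_nextClocks (i : E) (s s' : S) :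
    Measurable fun p : ℝ × (E → ℝ) × (E → ℝ) => M.nextClocks i s s' p.1 p.2.1 p.2.2 := by
  refine measurable_pi_lambda _ fun j => ?_
  unfold nextClocks
  split_ifs <;> fun_prop

/-- A transition preserves the form of `blend`: the clocks in `A` that survive are shifted by an
amount that depends on the others only through the firing time. -/
theorem afterEvent_blend {i : E} {s : S} (s' : S) (A : Finset E) (a w : E → ℝ) {v : E → ℝ}
    (hv : ∀ j ∉ M.active s', v j = 0) :
    M.afterEvent i (M.blend s A a w) s' v =
      M.blend s' (M.kept i s s' A) (fun j => a j - M.rate s j * M.runTime (M.blend s A a w) i)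
        (M.nextClocks i s s' (M.runTime (M.blend s A a w) i) w v) := by
  refine Config.ext rfl (funext fun j => ?_)
  simp only [afterEvent, blend, kept, nextClocks, Finset.mem_filter]
  by_cases h1 : j ∈ M.active s' <;> by_cases h2 : j ∈ M.active s <;> by_cases h3 : j = i <;>
    by_cases h4 : j ∈ A <;> simp [h1, h2, h3, h4, hv j]
  all_goals
    subst h3
    first
      | (simp [h1]; done)
      | simp [h1, hv j h1]

/-- For a fixed firing time `z` the coordinates stay independent. A kept clock is a translated
Gaussian and a set clock has a density. An inactive coordinate retains its old Gaussian value, which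
`blend` ignores; a reset to `0` would destroy absolute continuity. -/
theorem map_nextClocks_absolutelyContinuous {i : E} {s : S} (hi : i ∈ M.active s) (s' : S) (z : ℝ) :
    ((gaussClocks E).prod (Measure.pi (M.resetLaw s i s'))).map
      (fun p => M.nextClocks i s s' z p.1 p.2) ≪ gaussClocks E := by
  classical
  let φ : E → ℝ × ℝ → ℝ := fun j q =>
    if j ∈ M.active s' ∧ j ∈ M.active s ∧ j ≠ i then q.1 - M.rate s j * z
    else if j ∈ M.active s' then q.2 else q.1
  have hφ : ∀ j, Measurable (φ j) := fun j => by
    simp only [φ]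
    split_ifs <;> fun_prop
  have h : (fun p : (E → ℝ) × (E → ℝ) => M.nextClocks i s s' z p.1 p.2) =
      fun p j => φ j (p.1 j, p.2 j) := by
    funext p j
    simp only [nextClocks, φ]
  rw [h, map_prod_pi_pi hφ]
  have : ∀ j, IsProbabilityMeasure ((stdGauss.prod (M.resetLaw s i s' j)).map (φ j)) := fun j =>
    Measure.isProbabilityMeasure_map (hφ j).aemeasurable
  refine pi_absolutelyContinuous fun j => ?_
  by_cases h1 : j ∈ M.active s' ∧ j ∈ M.active s ∧ j ≠ i
  · have : φ j = (fun t => t - M.rate s j * z) ∘ Prod.fst := by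
      funext q; simp [φ, h1]
    rw [this, ← Measure.map_map (by fun_prop) measurable_fst, Measure.map_fst_prod, measure_univ,
      one_smul]
    exact map_sub_stdGauss_absolutelyContinuous _
  · by_cases h2 : j ∈ M.active s'
    · have : φ j = Prod.snd := by
        funext q; simp only [φ]; rw [if_neg h1, if_pos h2]
      rw [this, Measure.map_snd_prod, measure_univ, one_smul]
      refine absolutelyContinuous_stdGauss ?_
      rw [resetLaw, if_pos ⟨hi, h2⟩]
      exact (withDensity_absolutelyContinuous _ _).trans Measure.absolutelyContinuous_restrict
    · have : φ j = Prod.fst := by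
        funext q; simp only [φ]; rw [if_neg h1, if_neg h2]
      rw [this, Measure.map_fst_prod, measure_univ, one_smul]

/-- The event `i` has just fired, so its clock is either set anew or dropped, and its old value
matters only through the firing time. -/
theorem nextClocks_congr {i : E} {s s' : S} {z : ℝ} {w w' v : E → ℝ} (h : ∀ j, j ≠ i → w j = w' j)
    (A : Finset E) (a : E → ℝ) :
    M.blend s' (M.kept i s s' A) a (M.nextClocks i s s' z w v) =
      M.blend s' (M.kept i s s' A) a (M.nextClocks i s s' z w' v) := by
  refine Config.ext rfl (funext fun j => ?_)
  simp only [blend, nextClocks]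
  by_cases h1 : j ∈ M.active s'
  · by_cases h3 : j = i
    · subst h3
      simp [h1]
    · simp [h1, h3, h j h3]
  · simp [h1]

theorem map_prod_gaussClocks_replace (i : E) (ρ : Measure (E → ℝ)) [IsProbabilityMeasure ρ]
    [DecidableEq E] :
    ((gaussClocks E).prod ((gaussClocks E).prod ρ)).map
      (fun q => (fun j => if j = i then q.1 j else q.2.1 j, q.2.2)) = (gaussClocks E).prod ρ := by
  let φ : E → ℝ × ℝ → ℝ := fun j q => if j = i then q.1 else q.2
  have hφ : ∀ j, Measurable (φ j) := fun j => by
    simp only [φ]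
    split_ifs <;> fun_prop
  have hφγ : ∀ j, (stdGauss.prod stdGauss).map (φ j) = stdGauss := fun j => by
    by_cases h : j = i
    · have : φ j = Prod.fst := by funext q; simp [φ, h]
      rw [this, Measure.map_fst_prod, measure_univ, one_smul]
    · have : φ j = Prod.snd := by funext q; simp [φ, h]
      rw [this, Measure.map_snd_prod, measure_univ, one_smul]
  have h1 := map_prod_pi_pi (μ := fun _ : E => stdGauss) (ν := fun _ => stdGauss) hφ
  simp_rw [hφγ] at h1
  have hu : Measurable fun (p : (E → ℝ) × (E → ℝ)) j => φ j (p.1 j, p.2 j) :=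
    measurable_pi_lambda _ fun j => (hφ j).comp (by fun_prop)
  have hU : Measurable fun q : (E → ℝ) × (E → ℝ) × (E → ℝ) =>
      ((fun j => if j = i then q.1 j else q.2.1 j : E → ℝ), q.2.2) := by
    have : Measurable fun q : (E → ℝ) × (E → ℝ) × (E → ℝ) =>
      ((fun j => φ j (q.1 j, q.2.1 j) : E → ℝ), q.2.2) := by
      exact (hu.comp (f := fun q : (E → ℝ) × (E → ℝ) × (E → ℝ) => (q.1, q.2.1))
        (by fun_prop)).prodMk (by fun_prop)
    exact this
  rw [← Measure.prodAssoc_prod, Measure.map_map hU (MeasurableEquiv.measurable _)]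
  have h2 := Measure.map_prod_map ((gaussClocks E).prod (gaussClocks E)) ρ hu measurable_id
  rw [h1, Measure.map_id] at h2
  exact h2.symm

theorem runTime_blend {i : E} {s : S} (hi : i ∈ M.active s) (A : Finset E) (a w : E → ℝ)
    [Decidable (i ∈ A)] :
    M.runTime (M.blend s A a w) i = (if i ∈ A then a i else w i) / M.rate s i := by
  by_cases h : i ∈ A <;> simp [runTime, blend, hi, h]

/-- If `i ∈ A`, the firing time is a constant determined by `a`. Otherwise it is a multiple of `w
i`, and the result depends on `w i` in no other way; `w i` may then be replaced by an independent
copy, and Fubini reduces the claim to fixed firing times. -/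
theorem ae_afterEvent_blend_eq_zero {h : Config S E → ℝ≥0∞} (hh : Measurable h) {i : E} {s : S}
    (hi : i ∈ M.active s) (s' : S) (A : Finset E)
    (hnull : ∀ a, ∀ᵐ w ∂gaussClocks E, h (M.blend s' (M.kept i s s' A) a w) = 0) (a : E → ℝ) :
    ∀ᵐ p ∂(gaussClocks E).prod (Measure.pi (M.resetLaw s i s')),
      h (M.afterEvent i (M.blend s A a p.1) s' p.2) = 0 := by
  classical
  set ρ := Measure.pi (M.resetLaw s i s') with hρ
  let F : ℝ → (E → ℝ) → (E → ℝ) → ℝ≥0∞ := fun z w v =>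
    h (M.blend s' (M.kept i s s' A) (fun j => a j - M.rate s j * z) (M.nextClocks i s s' z w v))
  have hF : Measurable fun q : ℝ × (E → ℝ) × (E → ℝ) => F q.1 q.2.1 q.2.2 :=
    hh.comp ((M.measurable_blend s' _).comp
      ((by fun_prop : Measurable fun q : ℝ × (E → ℝ) × (E → ℝ) =>
        ((fun j => a j - M.rate s j * q.1 : E → ℝ))).prodMk (M.measurable_nextClocks i s s')))
  have hFz : ∀ z, ∀ᵐ p ∂(gaussClocks E).prod ρ, F z p.1 p.2 = 0 := fun z =>
    ae_of_ae_map ((M.measurable_nextClocks i s s').comp measurable_prodMk_left).aemeasurable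
      ((M.map_nextClocks_absolutelyContinuous hi s' z).ae_le (hnull _))
  have hv : ∀ᵐ p ∂(gaussClocks E).prod ρ, ∀ j ∉ M.active s', p.2 j = 0 := by
    refine Measure.quasiMeasurePreserving_snd.ae (p := fun v : E → ℝ => ∀ j ∉ M.active s', v j = 0) ?_
    exact M.ae_pi_resetLaw (p := fun j t => j ∉ M.active s' → t = 0) fun j => by
      by_cases hj : j ∈ M.active s'
      · simp [hj]
      · simpa [hj] using M.resetLaw_ae_eq_zero hj
  by_cases hiA : i ∈ A
  · filter_upwards [hv, hFz (a i / M.rate s i)] with p h1 h2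
    rw [M.afterEvent_blend s' A a p.1 h1, M.runTime_blend hi, if_pos hiA]
    exact h2
  · have hG : Measurable fun p : (E → ℝ) × (E → ℝ) => F (p.1 i / M.rate s i) p.1 p.2 :=
      hF.comp (f := fun p : (E → ℝ) × (E → ℝ) => (p.1 i / M.rate s i, p)) (by fun_prop)
    suffices hsuff : ∀ᵐ p ∂(gaussClocks E).prod ρ, F (p.1 i / M.rate s i) p.1 p.2 = 0 by
      filter_upwards [hv, hsuff] with p h1 h2
      rw [M.afterEvent_blend s' A a p.1 h1, M.runTime_blend hi, if_neg hiA]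
      exact h2
    have hU : Measurable fun q : (E → ℝ) × (E → ℝ) × (E → ℝ) =>
        ((fun j => if j = i then q.1 j else q.2.1 j : E → ℝ), q.2.2) := by
      refine Measurable.prodMk (measurable_pi_lambda _ fun j => ?_) (by fun_prop)
      split_ifs <;> fun_prop
    -- Coordinate `i` now comes from an independent Gaussian vector, so the firing time is
    -- independent of the remaining data.
    rw [← map_prod_gaussClocks_replace i ρ]
    refine (ae_map_iff hU.aemeasurable (hG (measurableSet_singleton 0))).2 ?_
    have hmeas : Measurable fun q : (E → ℝ) × (E → ℝ) × (E → ℝ) =>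
        F (q.1 i / M.rate s i) q.2.1 q.2.2 :=
      hF.comp (f := fun q : (E → ℝ) × (E → ℝ) × (E → ℝ) => (q.1 i / M.rate s i, q.2))
        (by fun_prop)
    have hae : ∀ᵐ q ∂(gaussClocks E).prod ((gaussClocks E).prod ρ),
        F (q.1 i / M.rate s i) q.2.1 q.2.2 = 0 := by
      refine (Measure.ae_prod_iff_ae_ae (hmeas (measurableSet_singleton 0))).2 ?_
      exact Eventually.of_forall fun w => hFz (w i / M.rate s i)
    filter_upwards [hae] with q hq
    simp only [if_true]
    rw [← hq]
    refine congrArg h (M.nextClocks_congr (fun j hj => if_neg hj) A _)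

open Classical in
/-- One step backwards: the expectation of `h` after a transition, where the set `A` of clocks
that have not been set is updated. -/
noncomputable def backStep (h : Finset E → Config S E → ℝ≥0∞) (A : Finset E) (x : Config S E) :
    ℝ≥0∞ :=
  ∑ i, if M.FiresFirst x i then
    ∫⁻ y, h (M.kept i x.state y.state A) y ∂M.eventLaw i x else 0

/-- `h A` vanishes almost everywhere in the clocks outside `A`, whatever the clocks in `A`. -/
def NullOffClocks (h : Finset E → Config S E → ℝ≥0∞) : Prop :=
  ∀ A s a, ∀ᵐ w ∂gaussClocks E, h A (M.blend s A a w) = 0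

theorem measurable_apply_kept {h : Finset E → Config S E → ℝ≥0∞} (hh : ∀ A, Measurable (h A))
    (i : E) (s : S) (A : Finset E) : Measurable fun y => h (M.kept i s y.state A) y :=
  measurable_of_state fun s' => (hh (M.kept i s s' A)).comp (measurable_config_mk s')

theorem measurable_backStep {h : Finset E → Config S E → ℝ≥0∞} (hh : ∀ A, Measurable (h A))
    (A : Finset E) : Measurable (M.backStep h A) := by
  classical
  refine Finset.measurable_sum _ fun i _ => ?_
  refine Measurable.ite (M.measurableSet_firesFirst i) ?_ measurable_const
  refine measurable_of_state fun s => ?_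
  exact (Measure.measurable_lintegral (M.measurable_apply_kept hh i s A)).comp
    ((M.measurable_eventLaw i).comp (measurable_config_mk s))

theorem backStep_of_firesFirst (h : Finset E → Config S E → ℝ≥0∞) (A : Finset E) {x : Config S E}
    {i : E} (hi : M.FiresFirst x i) :
    M.backStep h A x = ∫⁻ y, h (M.kept i x.state y.state A) y ∂M.stepLaw x := by
  rw [M.stepLaw_of_firesFirst hi, backStep, Finset.sum_eq_single i, if_pos hi]
  · intro j _ hj
    exact if_neg fun hj' => hj (hj'.unique hi)
  · simp

theorem NullOffClocks.backStep {h : Finset E → Config S E → ℝ≥0∞} (hh : ∀ A, Measurable (h A))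
    (hnull : M.NullOffClocks h) : M.NullOffClocks (M.backStep h) := by
  intro A s a
  have key : ∀ i, i ∈ M.active s → ∀ s', ∀ᵐ w ∂gaussClocks E,
      ∫⁻ v, h (M.kept i s s' A) (M.afterEvent i (M.blend s A a w) s' v)
        ∂Measure.pi (M.resetLaw s i s') = 0 := by
    intro i hi s'
    have h1 := Measure.ae_ae_of_ae_prod
      (M.ae_afterEvent_blend_eq_zero (hh _) hi s' A (hnull _ s') a)
    filter_upwards [h1] with w hw
    exact (lintegral_congr_ae hw).trans lintegral_zero
  have key' : ∀ᵐ w ∂gaussClocks E, ∀ i, i ∈ M.active s → ∀ s',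
      ∫⁻ v, h (M.kept i s s' A) (M.afterEvent i (M.blend s A a w) s' v)
        ∂Measure.pi (M.resetLaw s i s') = 0 :=
    ae_all_iff.2 fun i => ae_all_iff.2 fun hi => ae_all_iff.2 fun s' => key i hi s'
  filter_upwards [key'] with w hw
  refine Finset.sum_eq_zero fun i _ => ?_
  split_ifs with hi
  · rw [M.lintegral_eventLaw i _ (M.measurable_apply_kept hh i _ A)]
    refine Finset.sum_eq_zero fun s' _ => ?_
    have : ∫⁻ v, h (M.kept i s s' A) (M.afterEvent i (M.blend s A a w) s' v)
        ∂Measure.pi (M.resetLaw s i s') = 0 := hw i hi.1 s'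
    exact mul_eq_zero_of_right _ this
  · rfl

end GSMP

namespace GSMP

variable {S E AP : Type*} [Fintype S] [Fintype E] (M : GSMP S E AP)

/-! ### Clocks that have not been set since the start -/

/-- The event that fires first in a generalized state. -/
noncomputable def fired (x : M.GState) : E := (M.exists_firesFirst_val x).choose

theorem firesFirst_fired (x : M.GState) : M.FiresFirst x.1 (M.fired x) :=
  (M.exists_firesFirst_val x).choose_spec

/-- The clocks in `A` that have not been set or dropped in the first `n` transitions. -/
noncomputable def oldClocks : ℕ → Finset E → (ℕ → M.GState) → Finset E
  | 0, A, _ => A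
  | n + 1, A, ω => oldClocks n
      (M.kept (M.fired (ω 0)) (ω 0).1.state (ω 1).1.state A) (shiftSeq 1 ω)

theorem shiftSeq_one_consSeq {X : Type*} (x : X) (ω : ℕ → X) :
    shiftSeq 1 (consSeq x ω) = ω := by
  funext k
  simp only [shiftSeq]
  rw [add_comm]
  rfl

theorem oldClocks_succ_consSeq (n : ℕ) (A : Finset E) (x : M.GState) (ω : ℕ → M.GState) :
    M.oldClocks (n + 1) A (consSeq x ω) =
      M.oldClocks n (M.kept (M.fired x) x.1.state (ω 0).1.state A) ω := by
  rw [oldClocks, shiftSeq_one_consSeq]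
  rfl

theorem oldClocks_subset (n : ℕ) (A : Finset E) (ω : ℕ → M.GState) : M.oldClocks n A ω ⊆ A := by
  classical
  induction n generalizing A ω with
  | zero => exact subset_rfl
  | succ n ih =>
    rw [oldClocks]
    exact (ih _ _).trans fun j hj => (Finset.mem_filter.1 hj).1

theorem measurable_state :
    @Measurable _ _ _ ⊤ (fun x : M.GState => x.1.state) := by
  let _ : MeasurableSpace S := ⊤
  have h : Measurable fun x : Config S E => x.state :=
    measurable_of_state fun s => measurable_const
  exact h.comp M.measurableEmbedding_val.measurable

theorem measurable_fired : @Measurable _ _ _ ⊤ M.fired := by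
  let _ : MeasurableSpace E := ⊤
  refine measurable_to_countable' fun i => ?_
  have : M.fired ⁻¹' {i} = Subtype.val ⁻¹' {x | M.FiresFirst x i} := by
    ext x
    refine ⟨fun h => ?_, fun h => (M.firesFirst_fired x).unique h⟩
    have h' : M.fired x = i := h
    exact h' ▸ M.firesFirst_fired x
  rw [this]
  exact M.measurableEmbedding_val.measurable (M.measurableSet_firesFirst i)

theorem measurable_oldClocks (n : ℕ) :
    @Measurable _ _ (@Prod.instMeasurableSpace _ _ ⊤ _) ⊤
      (fun p : Finset E × (ℕ → M.GState) => M.oldClocks n p.1 p.2) := by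
  let _ : MeasurableSpace (Finset E) := ⊤
  let _ : MeasurableSpace E := ⊤
  let _ : MeasurableSpace S := ⊤
  induction n with
  | zero => exact measurable_fst
  | succ n ih =>
    have h0 : Measurable fun p : Finset E × (ℕ → M.GState) => p.2 0 := by fun_prop
    have h1 : Measurable fun p : Finset E × (ℕ → M.GState) => p.2 1 := by fun_prop
    have hk : Measurable fun q : E × S × S × Finset E => M.kept q.1 q.2.1 q.2.2.1 q.2.2.2 :=
      measurable_of_countable _
    exact ih.comp ((hk.comp ((M.measurable_fired.comp h0).prodMk ((M.measurable_state.comp h0).prodMk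
      ((M.measurable_state.comp h1).prodMk measurable_fst)))).prodMk
      ((measurable_shiftSeq 1).comp measurable_snd))

theorem measurableSet_oldClocks_eq_empty (n : ℕ) (A : Finset E) :
    MeasurableSet {ω : ℕ → M.GState | M.oldClocks n A ω = ∅} := by
  let _ : MeasurableSpace (Finset E) := ⊤
  exact ((M.measurable_oldClocks n).comp measurable_prodMk_left) (show MeasurableSet {(∅ : Finset E)} from trivial)

/-- All clocks have been set after `n` transitions. -/
def Renewed (n : ℕ) (ω : ℕ → M.GState) : Prop :=
  M.oldClocks n (M.active (ω 0).1.state) ω = ∅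

theorem measurableSet_renewed (n : ℕ) : MeasurableSet {ω | M.Renewed n ω} := by
  let _ : MeasurableSpace (Finset E) := ⊤
  let _ : MeasurableSpace S := ⊤
  have h0 : Measurable fun ω : ℕ → M.GState => M.active (ω 0).1.state :=
    (measurable_of_countable M.active).comp (M.measurable_state.comp (measurable_pi_apply 0))
  exact ((M.measurable_oldClocks n).comp (h0.prodMk measurable_id)) (show MeasurableSet {(∅ : Finset E)} from trivial)

/-- Clocks that are neither set nor dropped run down. -/
def RunsDown (x y : M.GState) : Prop :=
  ∀ j, j ∈ M.active y.1.state → j ∈ M.active x.1.state → ¬ M.FiresFirst x.1 j →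
    y.1.clock j = x.1.clock j - M.rate x.1.state j * M.firstTime x.1

theorem measurable_clock (j : E) : Measurable fun x : Config S E => x.clock j :=
  measurable_of_state fun _ => measurable_pi_apply j

theorem measurable_rate (j : E) : Measurable fun x : Config S E => M.rate x.state j :=
  measurable_of_state fun s => (measurable_const : Measurable fun _ : E → ℝ => M.rate s j)

theorem measurableSet_active (j : E) : MeasurableSet {x : Config S E | j ∈ M.active x.state} := by
  rw [← measurable_mem]
  exact measurable_of_state fun s => (measurable_const : Measurable fun _ : E → ℝ => j ∈ M.active s)

theorem measurableSet_runsDown : MeasurableSet {q : M.GState × M.GState | M.RunsDown q.1 q.2} := by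
  have hv := M.measurableEmbedding_val.measurable
  have h1 : Measurable fun q : M.GState × M.GState => q.1.1 := hv.comp measurable_fst
  have h2 : Measurable fun q : M.GState × M.GState => q.2.1 := hv.comp measurable_snd
  have : {q : M.GState × M.GState | M.RunsDown q.1 q.2} = ⋂ j,
      ({q : M.GState × M.GState | j ∈ M.active q.2.1.state}ᶜ ∪
        ({q : M.GState × M.GState | j ∈ M.active q.1.1.state}ᶜ ∪
          ({q : M.GState × M.GState | M.FiresFirst q.1.1 j} ∪
            {q | q.2.1.clock j = q.1.1.clock j - M.rate q.1.1.state j * M.firstTime q.1.1}))) := by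
    ext q
    simp only [RunsDown, Set.mem_ofPred_eq, Set.mem_iInter, Set.mem_union, Set.mem_compl_iff]
    refine forall_congr' fun j => ?_
    tauto
  rw [this]
  refine MeasurableSet.iInter fun j => (h2 (M.measurableSet_active j)).compl.union
    ((h1 (M.measurableSet_active j)).compl.union ((h1 (M.measurableSet_firesFirst j)).union ?_))
  exact measurableSet_eq_fun ((measurable_clock j).comp h2) (((measurable_clock j).comp h1).sub
    (((M.measurable_rate j).comp h1).mul (M.measurable_firstTime.comp h1)))

theorem ae_runsDown (x : M.GState) : ∀ᵐ y ∂M.kernel x, M.RunsDown x y := by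
  let B : Set (Config S E) := {y | ∀ j, j ∈ M.active y.state → j ∈ M.active x.1.state →
    ¬ M.FiresFirst x.1 j → y.clock j = x.1.clock j - M.rate x.1.state j * M.firstTime x.1}
  have hB : MeasurableSet B := by
    have : B = ⋂ j, ({y : Config S E | j ∈ M.active y.state}ᶜ ∪ {y | j ∈ M.active x.1.state →
        ¬ M.FiresFirst x.1 j →
          y.clock j = x.1.clock j - M.rate x.1.state j * M.firstTime x.1}) := by
      ext y
      simp only [B, Set.mem_ofPred_eq, Set.mem_iInter, Set.mem_union, Set.mem_compl_iff]
      refine forall_congr' fun j => ?_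
      tauto
    rw [this]
    refine MeasurableSet.iInter fun j => (M.measurableSet_active j).compl.union ?_
    by_cases h1 : j ∈ M.active x.1.state
    · by_cases h2 : M.FiresFirst x.1 j
      · simp [h2]
      · simpa [h1, h2] using measurableSet_eq_fun (measurable_clock (S := S) j) measurable_const
    · simp [h1]
  have hi := M.firesFirst_fired x
  change M.kernel x (Subtype.val ⁻¹' Bᶜ) = 0
  rw [M.kernel_apply_preimage x hB.compl, M.stepLaw_of_firesFirst hi, M.eventLaw_apply _ _ hB.compl]
  refine Finset.sum_eq_zero fun s' _ => mul_eq_zero_of_right _ ?_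
  convert measure_empty (μ := Measure.pi (M.resetLaw x.1.state (M.fired x) s'))
  refine Set.eq_empty_iff_forall_notMem.2 fun v hv => hv fun j h1 h2 h3 => ?_
  have hc : j ∈ M.active s' ∧ j ∈ M.active x.1.state ∧ j ≠ M.fired x :=
    ⟨h1, h2, fun h => h3 (h ▸ hi)⟩
  have : (M.afterEvent (M.fired x) x.1 s' v).clock j =
      x.1.clock j - M.rate x.1.state j * M.runTime x.1 (M.fired x) := if_pos hc
  rw [this, hi.firstTime_eq]

theorem jumpTime_succ' (ω : ℕ → M.GState) (n : ℕ) :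
    M.jumpTime ω (n + 1) = M.firstTime (ω 0).1 + M.jumpTime (shiftSeq 1 ω) n := by
  simp only [jumpTime, Finset.sum_range_succ', shiftSeq]
  rw [add_comm]
  simp only [add_comm 1]

/-- An old clock has been running at a rate of at least `r` all the time, so its initial value
bounds the elapsed time. Along a non-Zeno sequence no clock can stay old forever. -/
theorem clock_add_le_of_mem_oldClocks {r : ℝ} (hr : ∀ s, ∀ j ∈ M.active s, r ≤ M.rate s j) (n : ℕ)
    {A : Finset E} {ω : ℕ → M.GState} (hω : ∀ n, M.RunsDown (ω n) (ω (n + 1))) {j : E}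
    (hj : j ∈ M.oldClocks n A ω) :
    (ω n).1.clock j + r * M.jumpTime ω n ≤ (ω 0).1.clock j := by
  classical
  induction n generalizing A ω with
  | zero => simp [jumpTime_zero]
  | succ n ih =>
    rw [oldClocks] at hj
    have h1 := ih (ω := shiftSeq 1 ω) (fun n => by
      have := hω (1 + n)
      rwa [add_assoc] at this) hj
    obtain ⟨-, h2, h3, h4⟩ := Finset.mem_filter.1 (M.oldClocks_subset _ _ _ hj)
    have h5 := hω 0 j h2 h3 fun h => h4 (h.unique (M.firesFirst_fired _))
    have h6 := mul_le_mul_of_nonneg_right (hr _ j h3) (M.firstTime_val_pos (ω 0)).le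
    rw [jumpTime_succ', add_comm n 1]
    simp only [shiftSeq] at h1
    simp only [zero_add, add_zero] at h1 h5
    linarith

theorem clock_nonneg (x : M.GState) (j : E) : 0 ≤ x.1.clock j := by
  by_cases h : j ∈ M.active x.1.state
  · exact ((M.proper_val x j).1 h).le
  · exact ((M.proper_val x j).2 h).ge

theorem exists_pos_le_rate : ∃ r : ℝ, 0 < r ∧ ∀ s, ∀ j ∈ M.active s, r ≤ M.rate s j := by
  classical
  have h : ∀ p : S × E, ∃ r : ℝ, 0 < r ∧ (p.2 ∈ M.active p.1 → r ≤ M.rate p.1 p.2) := fun p => by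
    by_cases hp : p.2 ∈ M.active p.1
    · exact ⟨_, M.rate_pos _ _ hp, fun _ => le_rfl⟩
    · exact ⟨1, one_pos, fun h => absurd h hp⟩
  choose r hr0 hr using h
  rcases isEmpty_or_nonempty (S × E) with he | he
  · exact ⟨1, one_pos, fun s j _ => (he.false (s, j)).elim⟩
  · refine ⟨Finset.univ.inf' Finset.univ_nonempty r, (Finset.lt_inf'_iff _).2 fun p _ => hr0 p,
      fun s j hj => (Finset.inf'_le _ (Finset.mem_univ (s, j))).trans (hr (s, j) hj)⟩

theorem ae_eventually_renewed (x : M.GState) :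
    ∀ᵐ ω ∂M.chainLaw x, ∀ᶠ n in atTop, M.Renewed n ω := by
  obtain ⟨r, hr0, hr⟩ := M.exists_pos_le_rate
  filter_upwards [M.ae_nonZeno x,
    ae_chainKernel_of_ae M.measurableSet_runsDown M.ae_runsDown x] with ω h1 h2
  have h3 : ∀ᶠ n in atTop, ∀ j : E, (ω 0).1.clock j / r < M.jumpTime ω n :=
    eventually_all.2 fun j => h1.eventually_gt_atTop _
  filter_upwards [h3] with n hn
  refine Finset.eq_empty_iff_forall_notMem.2 fun j hj => ?_
  have h4 := M.clock_add_le_of_mem_oldClocks hr n h2 hj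
  have h5 := (div_lt_iff₀ hr0).1 (hn j)
  have h6 := M.clock_nonneg (ω n) j
  linarith

theorem exists_le_chainLaw_renewed (x : M.GState) {ε : ℝ≥0∞} (hε : ε ≠ 0) :
    ∃ n, 1 ≤ M.chainLaw x {ω | M.Renewed n ω} + ε := by
  have h : Tendsto (fun n => M.chainLaw x {ω | M.Renewed n ω}) atTop (𝓝 1) := by
    have := tendsto_measure_of_ae_tendsto_indicator_of_isFiniteMeasure (μ := M.chainLaw x)
      (L := atTop) (A := Set.univ) (As := fun n => {ω | M.Renewed n ω}) .univ
      (fun n => M.measurableSet_renewed n) (by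
        filter_upwards [M.ae_eventually_renewed x] with ω hω
        filter_upwards [hω] with n hn
        simpa using hn)
    simpa using this
  have h2 : Tendsto (fun n => M.chainLaw x {ω | M.Renewed n ω} + ε) atTop (𝓝 (1 + ε)) :=
    h.add_const ε
  have h3 : (1 : ℝ≥0∞) < 1 + ε := ENNReal.lt_add_right ENNReal.one_ne_top hε
  obtain ⟨n, hn⟩ := (h2.eventually_const_lt h3).exists
  exact ⟨n, hn.le⟩

/-! ### The law of the chain after all clocks have been set -/

/-- The expected value of a function of the future after all clocks have been set. -/
noncomputable def futureAfter (g : Config S E → ℝ≥0∞) : ℕ → Finset E → Config S E → ℝ≥0∞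
  | 0, A => open Classical in if A = ∅ then g else 0
  | n + 1, A => M.backStep (futureAfter g n) A

theorem measurable_futureAfter {g : Config S E → ℝ≥0∞} (hg : Measurable g) (n : ℕ) (A : Finset E) :
    Measurable (M.futureAfter g n A) := by
  induction n generalizing A with
  | zero =>
    rw [futureAfter]
    split_ifs
    · exact hg
    · exact measurable_zero
  | succ n ih => exact M.measurable_backStep ih A

/-- Iterated first-step decomposition. The gain is that `futureAfter` is defined on all
configurations, so it can be studied for almost every clock vector with respect to a Gaussian
measure. -/
theorem chainLaw_oldClocks_eq_empty {B : Set (ℕ → M.GState)} (hB : MeasurableSet B)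
    {g : Config S E → ℝ≥0∞} (hg : Measurable g) (hgB : ∀ z : M.GState, g z.1 = M.chainLaw z B)
    (n : ℕ) (A : Finset E) (x : M.GState) :
    M.chainLaw x {ω | M.oldClocks n A ω = ∅ ∧ shiftSeq n ω ∈ B} = M.futureAfter g n A x.1 := by
  have hm : ∀ n A, MeasurableSet {ω | M.oldClocks n A ω = ∅ ∧ shiftSeq n ω ∈ B} := fun n A =>
    (M.measurableSet_oldClocks_eq_empty n A).inter (measurable_shiftSeq n hB)
  induction n generalizing A x with
  | zero =>
    have h0 : ∀ ω : ℕ → M.GState, shiftSeq 0 ω = ω := fun ω => funext fun k => by simp [shiftSeq]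
    simp only [oldClocks, futureAfter, h0]
    split_ifs with h
    · simp [h, hgB]
    · simp [h]
  | succ n ih =>
    rw [chainLaw_eq, chainKernel_apply x (hm _ _), futureAfter,
      M.backStep_of_firesFirst _ A (M.firesFirst_fired x),
      ← M.lintegral_kernel x (M.measurable_apply_kept (M.measurable_futureAfter hg n) _ _ _)]
    refine lintegral_congr fun z => ?_
    rw [← ih, chainLaw_eq]
    refine measure_congr ?_
    filter_upwards [ae_chainKernel_zero (κ := M.kernel) z] with ω hω
    refine propext ?_
    change (M.oldClocks (n + 1) A (consSeq x ω) = ∅ ∧ shiftSeq (n + 1) (consSeq x ω) ∈ B) ↔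
      (M.oldClocks n (M.kept (M.fired x) x.1.state z.1.state A) ω = ∅ ∧ shiftSeq n ω ∈ B)
    rw [oldClocks_succ_consSeq, shiftSeq_succ_consSeq, hω]

/-- A measure on configurations whose null sets contain those of the law of every configuration
in which all clocks have been set. -/
noncomputable def refConfig : Measure (Config S E) :=
  ∑ s, (gaussClocks E).map (M.blend s ∅ 0)

/-- The law of the chain started in the reference measure. -/
noncomputable def refLaw : Measure (ℕ → M.GState) :=
  (M.refConfig.comap Subtype.val).bind (chainKernel M.kernel)

instance : IsFiniteMeasure M.refConfig := by unfold refConfig; infer_instance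

instance : IsFiniteMeasure (M.refConfig.comap (Subtype.val : M.GState → Config S E)) := by
  constructor
  rw [M.measurableEmbedding_val.comap_apply]
  exact measure_lt_top _ _

instance : IsFiniteMeasure M.refLaw := by unfold refLaw; infer_instance

theorem blend_self (x : M.GState) (w : E → ℝ) :
    M.blend x.1.state (M.active x.1.state) x.1.clock w = x.1 := by
  refine Config.ext rfl (funext fun j => ?_)
  by_cases h : j ∈ M.active x.1.state
  · simp [blend, h]
  · simp [blend, h, (M.proper_val x j).2 h]

/-- Once no old clock is left, the clock vector is absolutely continuous. Backwards in time:
`futureAfter g 0` vanishes almost everywhere in the clocks outside `A`, and `backStep` preserves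
this. -/
theorem chainLaw_renewed_eq_zero {B : Set (ℕ → M.GState)} (hB : MeasurableSet B)
    (h0 : M.refLaw B = 0) (n : ℕ) (x : M.GState) :
    M.chainLaw x {ω | M.Renewed n ω ∧ shiftSeq n ω ∈ B} = 0 := by
  let f : M.GState → ℝ≥0∞ := fun z => chainKernel M.kernel z B
  have hf : Measurable f := (chainKernel M.kernel).measurable_coe hB
  -- Extension by `0` is consistent with `refLaw`, which ignores configurations that are not
  -- generalized states.
  let g : Config S E → ℝ≥0∞ := Function.extend Subtype.val f 0
  have hg : Measurable g := M.measurableEmbedding_val.measurable_extend hf measurable_zero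
  have hgf : ∀ z : M.GState, g z.1 = f z := fun z => Subtype.val_injective.extend_apply _ _ _
  have h1 : M.refConfig {y | g y ≠ 0} = 0 := by
    have h2 : {y | g y ≠ 0} = Subtype.val '' {z : M.GState | f z ≠ 0} := by
      ext y
      constructor
      · intro hy
        by_cases hex : ∃ z : M.GState, z.1 = y
        · obtain ⟨z, rfl⟩ := hex
          exact ⟨z, by simpa [hgf] using hy, rfl⟩
        · exact absurd (Function.extend_apply' _ _ _ hex) hy
      · rintro ⟨z, hz, rfl⟩
        simpa [hgf] using hz
    rw [h2, ← M.measurableEmbedding_val.comap_apply]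
    rw [refLaw, Measure.bind_apply hB (chainKernel M.kernel).aemeasurable,
      lintegral_eq_zero_iff hf] at h0
    exact h0
  have hnull : M.NullOffClocks (M.futureAfter g 0) := by
    intro A s a
    by_cases hA : A = ∅
    · have hb : ∀ w, M.blend s A a w = M.blend s ∅ 0 w := fun w => by simp [blend, hA]
      have h2 : (gaussClocks E).map (M.blend s ∅ 0) {y | g y ≠ 0} = 0 := by
        refine le_antisymm (le_of_le_of_eq ?_ h1) zero_le
        rw [refConfig, Measure.coe_finsetSum, Finset.sum_apply]
        exact Finset.single_le_sum (f := fun s => (gaussClocks E).map (M.blend s ∅ 0) {y | g y ≠ 0})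
          (fun _ _ => zero_le) (Finset.mem_univ s)
      have hbm : Measurable (M.blend s ∅ 0) := (M.measurable_blend s ∅).comp measurable_prodMk_left
      filter_upwards [ae_of_ae_map hbm.aemeasurable (p := fun y => g y = 0) h2] with w hw
      rw [hb, futureAfter, if_pos hA]
      exact hw
    · simp [futureAfter, hA]
  have hall : ∀ n, M.NullOffClocks (M.futureAfter g n) := by
    intro n
    induction n with
    | zero => exact hnull
    | succ n ih => exact ih.backStep M (M.measurable_futureAfter hg n)
  -- With all active clocks counted as old, `blend` does not depend on `w`, so a statement for
  -- almost every `w` is a statement about `x` itself.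
  have hx := hall n (M.active x.1.state) x.1.state x.1.clock
  simp only [blend_self] at hx
  obtain ⟨-, hx⟩ := hx.exists
  rw [← M.chainLaw_oldClocks_eq_empty hB hg (fun z => hgf z) n] at hx
  rw [← hx, chainLaw_eq]
  refine measure_congr ?_
  filter_upwards [ae_chainKernel_zero (κ := M.kernel) x] with ω hω
  refine propext ?_
  change (M.oldClocks n (M.active (ω 0).1.state) ω = ∅ ∧ shiftSeq n ω ∈ B) ↔
    (M.oldClocks n (M.active x.1.state) ω = ∅ ∧ shiftSeq n ω ∈ B)
  rw [hω]

end GSMP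

namespace GSMP

variable {S E AP : Type*} [Fintype S] [Fintype E] (M : GSMP S E AP)

/-! ### Classification of generalized states -/

/-- A generalized state has distance at most `t` to the state reached from it in time `t`. -/
def TimeLipschitz (m : M.GState → M.GState → ℝ) : Prop :=
  ∀ x t, 0 ≤ t → t < M.firstTime x.1 → m x (M.elapse x t) ≤ t

/-- The space of generalized states is a countable union of measurable sets of diameter at most
`ε`, for every `ε > 0`. -/
def FinelyClassifiable (m : M.GState → M.GState → ℝ) : Prop :=
  ∀ ε : ℝ, 0 < ε → Classifiable fun x y => m x y ≤ ε

/-- Every state passed from `x` before the first event is close to one passed from `y`. -/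
def SegmentClose (m : M.GState → M.GState → ℝ) (ε : ℝ) (x y : M.GState) : Prop :=
  |M.firstTime x.1 - M.firstTime y.1| ≤ ε ∧ ∀ a, 0 ≤ a → a < M.firstTime x.1 →
    ∃ b, 0 ≤ b ∧ b < M.firstTime y.1 ∧ |a - b| ≤ ε ∧ m (M.elapse x a) (M.elapse y b) ≤ ε

theorem elapse_zero (x : M.GState) : M.elapse x 0 = x := by
  refine Subtype.ext ?_
  rw [M.elapse_val (M.firstTime_val_pos x)]
  refine Config.ext rfl (funext fun j => ?_)
  by_cases h : j ∈ M.active x.1.state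
  · simp [evolve, h]
  · simp [evolve, h, (M.proper_val x j).2 h]

theorem elapse_state (x : M.GState) (t : ℝ) : (M.elapse x t).1.state = x.1.state := by
  unfold elapse
  split_ifs <;> rfl

variable {M} in
theorem TimeLipschitz.elapse_le {m : M.GState → M.GState → ℝ} (h : M.TimeLipschitz m)
    {x : M.GState} {a b : ℝ} (hab : a ≤ b) (hb : b < M.firstTime x.1) :
    m (M.elapse x a) (M.elapse x b) ≤ b - a := by
  have h1 := h (M.elapse x a) (b - a) (sub_nonneg.2 hab)
    (by rw [M.firstTime_elapse (hab.trans_lt hb)]; linarith)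
  rwa [M.elapse_elapse (hab.trans_lt hb) (by linarith), add_sub_cancel] at h1

theorem measurable_elapse (t : ℝ) : Measurable fun x : M.GState => M.elapse x t := by
  classical
  rw [← M.measurableEmbedding_val.measurable_comp_iff]
  have : (Subtype.val ∘ fun x : M.GState => M.elapse x t) =
      (fun x : Config S E => if t < M.firstTime x then M.evolve x t else x) ∘ Subtype.val := by
    funext x
    by_cases h : t < M.firstTime x.1
    · simp [h, M.elapse_val h]
    · simp [h, elapse]
  rw [this]
  refine Measurable.comp ?_ M.measurableEmbedding_val.measurable
  refine Measurable.ite (measurableSet_lt measurable_const M.measurable_firstTime) ?_ measurable_id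
  refine measurable_of_state fun s => (measurable_config_mk s).comp
    (measurable_pi_lambda _ fun j => ?_)
  dsimp only
  split_ifs <;> fun_prop

/-- With `η = ε / 2`, the class of `x` records the length of its stay up to `η` and the `ε /
2`-classes of the states at the grid times `i * η`. A time `a` is matched with the grid time just
before it; `TimeLipschitz` bounds the move to the grid by `η`, and the classification contributes
another `η`. -/
theorem classifiable_segmentClose {m : M.GState → M.GState → ℝ} (hm : IsPseudometric m)
    (ht : M.TimeLipschitz m) (hc : M.FinelyClassifiable m) {ε : ℝ} (hε : 0 < ε) :
    Classifiable (M.SegmentClose m ε) := by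
  have hη : 0 < ε / 2 := half_pos hε
  obtain ⟨π, hπ, hR⟩ := hc (ε / 2) hη
  set η := ε / 2 with hηdef
  have hT : Measurable fun x : M.GState => M.firstTime x.1 :=
    M.measurable_firstTime.comp M.measurableEmbedding_val.measurable
  refine Classifiable.of_fiberwise (D := fun x => ⌈M.firstTime x.1 / η⌉₊)
    (Nat.measurable_ceil.comp (hT.div_const η)) fun q => ?_
  refine Classifiable.of_countable (f := fun x (i : Fin q) => π (M.elapse x (i * η)))
    (measurable_pi_lambda _ fun i => hπ.comp (M.measurable_elapse _)) fun x y hxy hx hy => ?_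
  have bounds : ∀ z : M.GState, ⌈M.firstTime z.1 / η⌉₊ = q →
      M.firstTime z.1 ≤ q * η ∧ q * η < M.firstTime z.1 + η := by
    intro z hz
    have hpos : 0 ≤ M.firstTime z.1 / η := div_nonneg (M.firstTime_val_pos z).le hη.le
    have h1 := Nat.le_ceil (M.firstTime z.1 / η)
    have h2 := Nat.ceil_lt_add_one hpos
    rw [hz] at h1 h2
    refine ⟨(div_le_iff₀ hη).1 h1, ?_⟩
    have h3 := mul_lt_mul_of_pos_right h2 hη
    rwa [add_mul, div_mul_cancel₀ _ hη.ne', one_mul] at h3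
  obtain ⟨hx1, hx2⟩ := bounds x hx
  obtain ⟨hy1, hy2⟩ := bounds y hy
  refine ⟨abs_sub_le_iff.2 ⟨by linarith, by linarith⟩, fun a ha0 ha1 => ?_⟩
  have hi1 : (⌊a / η⌋₊ : ℝ) * η ≤ a :=
    (le_div_iff₀ hη).1 (Nat.floor_le (div_nonneg ha0 hη.le))
  have hi2 : a < ((⌊a / η⌋₊ : ℝ) + 1) * η := (div_lt_iff₀ hη).1 (Nat.lt_floor_add_one _)
  set i := ⌊a / η⌋₊ with hi
  have hxi : (i : ℝ) * η < M.firstTime x.1 := hi1.trans_lt ha1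
  have hiq : i < q := by
    rw [← hx]
    exact Nat.lt_ceil.2 ((lt_div_iff₀ hη).2 hxi)
  have hyi : (i : ℝ) * η < M.firstTime y.1 := by
    rw [← hy] at hiq
    exact (lt_div_iff₀ hη).1 (Nat.lt_ceil.1 hiq)
  refine ⟨i * η, by positivity, hyi, ?_, ?_⟩
  · rw [abs_of_nonneg (by linarith)]; linarith
  · have h1 := ht.elapse_le hi1 ha1
    rw [hm.symm] at h1
    have h2 : m (M.elapse x (i * η)) (M.elapse y (i * η)) ≤ η :=
      hR _ _ (congrFun hxy ⟨i, hiq⟩)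
    have h3 := hm.triangle (M.elapse x a) (M.elapse x (i * η)) (M.elapse y (i * η))
    linarith

/-- Each of the first `N` stays can shift the jump times by `δ`, and the position inside a stay adds
one more `δ`; hence `N + 1`. From index `N` on the sequences coincide and the shift no longer grows.
-/
theorem follows_of_segmentClose {m : M.GState → M.GState → ℝ} (hm : IsPseudometric m)
    {N : ℕ} {δ ε : ℝ} (hδ : 0 ≤ δ) (hδε : (N + 1) * δ ≤ ε) {ω ω' : ℕ → M.GState}
    (h : ∀ n < N, M.SegmentClose m δ (ω n) (ω' n)) (hs : shiftSeq N ω = shiftSeq N ω') :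
    M.Follows m ε ω ω' := by
  have heq : ∀ n, N ≤ n → ω n = ω' n := fun n hn => by
    have := congrFun hs (n - N)
    simpa [shiftSeq, Nat.add_sub_cancel' hn] using this
  have hjump : ∀ n, |M.jumpTime ω n - M.jumpTime ω' n| ≤ (min n N : ℕ) * δ := by
    intro n
    induction n with
    | zero => simp [jumpTime_zero]
    | succ n ih =>
      rw [jumpTime_succ, jumpTime_succ]
      rcases lt_or_ge n N with hn | hn
      · rw [min_eq_left hn.le] at ih
        rw [min_eq_left (Nat.succ_le_of_lt hn)]
        have h1 := (h n hn).1
        push_cast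
        rw [abs_le] at *
        constructor <;> linarith [ih.1, ih.2, h1.1, h1.2]
      · rw [min_eq_right hn] at ih
        rw [min_eq_right (hn.trans n.le_succ), heq n hn]
        simpa using ih
  have hjump' : ∀ n, |M.jumpTime ω n - M.jumpTime ω' n| ≤ N * δ := fun n =>
    (hjump n).trans (mul_le_mul_of_nonneg_right (by exact_mod_cast min_le_right n N) hδ)
  have hNδ : 0 ≤ N * δ := by positivity
  have hexp : (N + 1) * δ = N * δ + δ := by ring
  intro n a ha0 ha1
  have hj := abs_le.1 (hjump' n)
  rcases lt_or_ge n N with hn | hn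
  · obtain ⟨b, hb0, hb1, hab, hmab⟩ := (h n hn).2 a ha0 ha1
    refine ⟨b, hb0, hb1, ?_, by linarith⟩
    rw [abs_le] at *
    constructor <;> linarith [hj.1, hj.2, hab.1, hab.2]
  · rw [← heq n hn]
    refine ⟨a, ha0, ha1, ?_, ?_⟩
    · rw [abs_le]
      constructor <;> linarith [hj.1, hj.2]
    · rw [hm.self]; linarith

/-! ### The functional preserves fine classifiability -/

theorem classifiable_state : Classifiable fun x y : M.GState => x.1.state = y.1.state := by
  let _ : MeasurableSpace S := ⊤
  exact Classifiable.of_countable M.measurable_state fun _ _ h => h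

/-- The classes of the first `N` states together with the later states. -/
def summary (N : ℕ) (π : M.GState → ℕ) (ω : ℕ → M.GState) : (Fin N → ℕ) × (ℕ → M.GState) :=
  (fun i => π (ω i), shiftSeq N ω)

theorem measurable_summary (N : ℕ) {π : M.GState → ℕ} (hπ : Measurable π) :
    Measurable (M.summary N π) :=
  (measurable_pi_lambda (fun (ω : ℕ → M.GState) (i : Fin N) => π (ω i)) fun i =>
    hπ.comp (measurable_pi_apply (i : ℕ))).prodMk (measurable_shiftSeq N)

/-- The law of the summary on the event that all clocks have been set. -/
noncomputable def summaryKernel (N : ℕ) (π : M.GState → ℕ) :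
    Kernel M.GState ((Fin N → ℕ) × (ℕ → M.GState)) :=
  ((chainKernel M.kernel).restrict (M.measurableSet_renewed N)).map (M.summary N π)

instance (N : ℕ) (π : M.GState → ℕ) : IsFiniteKernel (M.summaryKernel N π) := by
  unfold summaryKernel; infer_instance

theorem summaryKernel_apply (N : ℕ) {π : M.GState → ℕ} (hπ : Measurable π) (x : M.GState) :
    M.summaryKernel N π x =
      ((M.chainLaw x).restrict {ω | M.Renewed N ω}).map (M.summary N π) := by
  rw [summaryKernel, Kernel.map_apply _ (M.measurable_summary N hπ), Kernel.restrict_apply]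
  rfl

/-- The class vectors form a countable set, so a null set of the product measure has `refLaw`-null
sections at every vector, and each section is handled by `chainLaw_renewed_eq_zero`. -/
theorem summaryKernel_absolutelyContinuous (N : ℕ) {π : M.GState → ℕ} (hπ : Measurable π)
    (x : M.GState) :
    M.summaryKernel N π x ≪ (Measure.count.toFinite : Measure (Fin N → ℕ)).prod M.refLaw := by
  refine Measure.AbsolutelyContinuous.mk fun B hB h0 => ?_
  rw [Measure.measure_prod_null hB] at h0
  have h1 : ∀ c : Fin N → ℕ, M.refLaw (Prod.mk c ⁻¹' B) = 0 := by
    have h2 := (absolutelyContinuous_toFinite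
      (Measure.count : Measure (Fin N → ℕ))).ae_le h0
    have h3 := Measure.count_eq_zero_iff.1 (ae_iff.1 h2)
    intro c
    by_contra hc
    exact (Set.eq_empty_iff_forall_notMem.1 h3) c hc
  have hΘ := M.measurable_summary N hπ
  rw [summaryKernel_apply M N hπ, Measure.map_apply hΘ hB, Measure.restrict_apply (hΘ hB)]
  refine measure_mono_null (t := ⋃ c : Fin N → ℕ,
    {ω | M.Renewed N ω ∧ shiftSeq N ω ∈ Prod.mk c ⁻¹' B}) ?_ ?_
  · rintro ω ⟨h2, h3⟩
    exact Set.mem_iUnion.2 ⟨_, h3, h2⟩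
  · exact measure_iUnion_null fun c =>
      M.chainLaw_renewed_eq_zero (measurable_prodMk_left hB) (h1 c) N x

theorem wasserstein_traceLaw_le {m : M.GState → M.GState → ℝ} (hm : IsPseudometric m) {N : ℕ}
    {π : M.GState → ℕ} (hπ : Measurable π) {δ ε τ : ℝ} (hδ : 0 ≤ δ) (hδε : (N + 1) * δ ≤ ε)
    (hτ : 0 ≤ τ) (hseg : ∀ x y, π x = π y → M.SegmentClose m δ x y) {x y : M.GState}
    {σ : Measure ((Fin N → ℕ) × (ℕ → M.GState))} (hx : σ ≤ M.summaryKernel N π x)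
    (hy : σ ≤ M.summaryKernel N π y) (hmass : 1 ≤ σ Set.univ + ENNReal.ofReal τ) :
    wasserstein (fun ω ω' => skorohodJ2 m (M.path ω) (M.path ω')) (M.traceLaw x) (M.traceLaw y) ≤
      ε + τ := by
  have hval := M.measurableEmbedding_traceVal.measurable
  have hΘ : Measurable fun ω : M.Trace => M.summary N π ω.1 := (M.measurable_summary N hπ).comp hval
  have hle : ∀ z, M.summaryKernel N π z ≤ (M.traceLaw z).map fun ω => M.summary N π ω.1 := by
    intro z
    have : (M.traceLaw z).map (fun ω => M.summary N π ω.1) =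
        (M.chainLaw z).map (M.summary N π) := by
      rw [← M.map_val_traceLaw, Measure.map_map (M.measurable_summary N hπ) hval]
      rfl
    rw [this, summaryKernel_apply M N hπ]
    exact Measure.map_mono Measure.restrict_le_self (M.measurable_summary N hπ)
  obtain ⟨ρ, h1, h2, h3⟩ := exists_coupling_of_map_common_part hΘ (hx.trans (hle x))
    (hy.trans (hle y)) hmass
  have hε : 0 ≤ ε := le_trans (by positivity) hδε
  refine wasserstein_le_add_of_coupling h1 h2 (fun ω ω' => skorohodJ2_le_one hm _ _) hε hτ
    (B := {p : M.Trace × M.Trace | M.summary N π p.1.1 ≠ M.summary N π p.2.1})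
    (measurableSet_eq_fun (hΘ.comp measurable_fst) (hΘ.comp measurable_snd)).compl ?_ h3
  intro p hp
  have hp' : M.summary N π p.1.1 = M.summary N π p.2.1 := not_not.1 hp
  have hc : ∀ n < N, π (p.1.1 n) = π (p.2.1 n) := fun n hn =>
    congrFun (congrArg Prod.fst hp') ⟨n, hn⟩
  have hs : shiftSeq N p.1.1 = shiftSeq N p.2.1 := congrArg Prod.snd hp'
  exact M.skorohodJ2_path_le hm
    (M.follows_of_segmentClose hm hδ hδε (fun n hn => hseg _ _ (hc n hn)) hs)
    (M.follows_of_segmentClose hm hδ hδε (fun n hn => hseg _ _ (hc n hn).symm) hs.symm)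

/-- The budget: `ε / 4` for failing to renew within `N` transitions and `ε / 4` for the summary mass
not shared, together `ε / 2` of uncoupled mass, plus `ε / 2` for the distance between paths with
equal summaries. -/
theorem finelyClassifiable_functional {k : ℝ} (hk1 : k ≤ 1)
    {m : M.GState → M.GState → ℝ} (hm : IsPseudometric m) (ht : M.TimeLipschitz m)
    (hc : M.FinelyClassifiable m) : M.FinelyClassifiable (M.functional k m) := by
  classical
  intro ε hε
  have hε4 : ENNReal.ofReal (ε / 4) ≠ 0 := by simpa using hε
  have hex := fun x => M.exists_le_chainLaw_renewed x hε4
  have hmeas : ∀ n, MeasurableSet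
      {x | 1 ≤ M.chainLaw x {ω | M.Renewed n ω} + ENNReal.ofReal (ε / 4)} := fun n =>
    measurableSet_le measurable_const
      (((chainKernel M.kernel).measurable_coe (M.measurableSet_renewed n)).add measurable_const)
  -- The required `N` depends on the initial state; it is measurable, so it can be fixed before `δ`
  -- and `π` are chosen.
  refine Classifiable.of_fiberwise (measurable_find hex hmeas) fun N => ?_
  set δ := ε / 2 / (N + 1) with hδ
  have hδ0 : 0 < δ := by positivity
  have hδε : (N + 1) * δ ≤ ε / 2 := by
    rw [hδ, mul_div_cancel₀]
    positivity
  obtain ⟨π, hπ, hseg⟩ := M.classifiable_segmentClose hm ht hc hδ0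
  have hR := classifiable_common_part (M.summaryKernel N π) _
    (M.summaryKernel_absolutelyContinuous N hπ) hε4
  refine (hR.and M.classifiable_state).mono ?_
  rintro x y ⟨⟨σ, hx, hy, hmass⟩, hstate⟩ hNx -
  have hNx' := Nat.find_spec (hex x)
  rw [hNx] at hNx'
  have huniv : M.summaryKernel N π x Set.univ = M.chainLaw x {ω | M.Renewed N ω} := by
    rw [summaryKernel_apply M N hπ, Measure.map_apply (M.measurable_summary N hπ) .univ,
      Set.preimage_univ, Measure.restrict_apply_univ]
  rw [huniv] at hmass
  have hmass' : 1 ≤ σ Set.univ + ENNReal.ofReal (ε / 2) := by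
    refine hNx'.trans ((add_le_add_left hmass _).trans (le_of_eq ?_))
    rw [add_assoc, ← ENNReal.ofReal_add (by positivity) (by positivity)]
    congr 2
    ring
  have hW := M.wasserstein_traceLaw_le hm hπ hδ0.le hδε (half_pos hε).le hseg hx hy hmass'
  rw [add_halves] at hW
  have hprops : M.propsOf x = M.propsOf y := congrArg M.props hstate
  rw [functional, if_pos hprops]
  exact (mul_le_of_le_one_left (wasserstein_nonneg _ _ _) hk1).trans hW

/-! ### Stability of the time-Lipschitz property under the functional -/

theorem kernel_elapse {x : M.GState} {t : ℝ} (h : t < M.firstTime x.1) :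
    M.kernel (M.elapse x t) = M.kernel x := by
  change (M.stepLaw (M.elapse x t).1).comap Subtype.val = (M.stepLaw x.1).comap Subtype.val
  rw [M.elapse_val h, M.stepLaw_evolve (M.firesFirst_fired x)]

theorem map_shiftSeq_traceLaw (x : M.GState) :
    (M.traceLaw x).map (fun ω => shiftSeq 1 ω.1) = (M.kernel x).bind (chainKernel M.kernel) := by
  have hval := M.measurableEmbedding_traceVal.measurable
  have h1 : (M.traceLaw x).map (fun ω => shiftSeq 1 ω.1) =
      (M.chainLaw x).map (shiftSeq 1) := by
    rw [← M.map_val_traceLaw, Measure.map_map (measurable_shiftSeq 1) hval]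
    rfl
  rw [h1, chainLaw_eq, chainKernel_apply_eq_bind,
    Measure.map_map (measurable_shiftSeq 1) (measurable_consSeq_right x)]
  have : shiftSeq 1 ∘ consSeq x = id := funext fun ω => shiftSeq_one_consSeq x ω
  rw [this, Measure.map_id]

theorem ae_traceLaw_zero (x : M.GState) : ∀ᵐ ω ∂M.traceLaw x, ω.1 0 = x := by
  have h := ae_chainKernel_zero (κ := M.kernel) x
  rw [← chainLaw_eq, ← M.map_val_traceLaw] at h
  exact ae_of_ae_map M.measurableEmbedding_traceVal.measurable.aemeasurable h

/-- The second sequence is the first with its initial `t` units of time cut off. Positions are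
matched by equal state where possible, at the cost of a time shift `t`; positions before time `t`
have no counterpart and are matched with the start. -/
theorem follows_elapse {m : M.GState → M.GState → ℝ} (hm : IsPseudometric m)
    (ht : M.TimeLipschitz m) {t : ℝ} (ht0 : 0 ≤ t) {ω ω' : ℕ → M.GState}
    (ht1 : t < M.firstTime (ω 0).1) (h0 : ω' 0 = M.elapse (ω 0) t)
    (hs : shiftSeq 1 ω = shiftSeq 1 ω') : M.Follows m t ω ω' ∧ M.Follows m t ω' ω := by
  have heq : ∀ n, ω (n + 1) = ω' (n + 1) := fun n => by
    have := congrFun hs n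
    simpa [shiftSeq, add_comm] using this
  have hT : M.firstTime (ω' 0).1 = M.firstTime (ω 0).1 - t := by
    rw [h0, M.firstTime_elapse ht1]
  have hjump : ∀ n, M.jumpTime ω (n + 1) - M.jumpTime ω' (n + 1) = t := fun n => by
    rw [jumpTime_succ', jumpTime_succ', hs, hT]; ring
  constructor
  · intro n a ha0 ha1
    cases n with
    | zero =>
      simp only [jumpTime_zero, zero_add]
      rcases le_or_gt t a with hta | hta
      · refine ⟨a - t, by linarith, by linarith, ?_, ?_⟩
        · rw [sub_sub_cancel, abs_of_nonneg ht0]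
        · rw [h0, M.elapse_elapse ht1 (by linarith), add_sub_cancel, hm.self]
          exact ht0
      · refine ⟨0, le_rfl, M.firstTime_val_pos _, ?_, ?_⟩
        · rw [sub_zero, abs_of_nonneg ha0]; exact hta.le
        · rw [elapse_zero, h0]
          linarith [ht.elapse_le hta.le ht1]
    | succ n =>
      rw [← heq n]
      refine ⟨a, ha0, ha1, ?_, ?_⟩
      · rw [add_sub_add_right_eq_sub, hjump, abs_of_nonneg ht0]
      · rw [hm.self]; exact ht0
  · intro n a ha0 ha1
    cases n with
    | zero =>
      have hat : t + a < M.firstTime (ω 0).1 := by linarith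
      refine ⟨a, ha0, by linarith, ?_, ?_⟩
      · simpa [jumpTime_zero] using ht0
      · rw [h0, M.elapse_elapse ht1 hat, hm.symm]
        linarith [ht.elapse_le (show a ≤ t + a by linarith) hat]
    | succ n =>
      rw [heq n]
      refine ⟨a, ha0, by rwa [← heq n] at ha1 ⊢, ?_, ?_⟩
      · rw [add_sub_add_right_eq_sub, abs_sub_comm, hjump, abs_of_nonneg ht0]
      · rw [hm.self]; exact ht0

/-- Letting time pass does not change the transition kernel, so the two sequences have the same law
after their first term and can be coupled to agree there almost surely. `follows_elapse` then bounds
the path distance by `t`. -/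
theorem timeLipschitz_functional {k : ℝ} (hk1 : k ≤ 1)
    {m : M.GState → M.GState → ℝ} (hm : IsPseudometric m) (ht : M.TimeLipschitz m) :
    M.TimeLipschitz (M.functional k m) := by
  intro x t ht0 ht1
  have hval := M.measurableEmbedding_traceVal.measurable
  have hΘ : Measurable fun ω : M.Trace => shiftSeq 1 ω.1 := (measurable_shiftSeq 1).comp hval
  have he : (M.traceLaw x).map (fun ω => shiftSeq 1 ω.1) =
      (M.traceLaw (M.elapse x t)).map fun ω => shiftSeq 1 ω.1 := by
    rw [map_shiftSeq_traceLaw, map_shiftSeq_traceLaw, M.kernel_elapse ht1]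
  obtain ⟨ρ, h1, h2, h3⟩ := exists_coupling_of_map_common_part hΘ le_rfl he.le (τ := 0) (by
    rw [Measure.map_apply hΘ .univ, Set.preimage_univ, measure_univ, add_zero])
  have hW : wasserstein (fun ω ω' => skorohodJ2 m (M.path ω) (M.path ω')) (M.traceLaw x)
      (M.traceLaw (M.elapse x t)) ≤ t + 0 := by
    have hz : Measurable fun ω : M.Trace => ω.1 0 := (measurable_pi_apply 0).comp hval
    have hB1 : MeasurableSet {p : M.Trace × M.Trace | shiftSeq 1 p.1.1 ≠ shiftSeq 1 p.2.1} :=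
      (measurableSet_eq_fun (hΘ.comp measurable_fst) (hΘ.comp measurable_snd)).compl
    have hB2 : MeasurableSet {p : M.Trace × M.Trace | p.1.1 0 ≠ x} :=
      (measurableSet_eq_fun (hz.comp measurable_fst) measurable_const).compl
    have hB3 : MeasurableSet {p : M.Trace × M.Trace | p.2.1 0 ≠ M.elapse x t} :=
      (measurableSet_eq_fun (hz.comp measurable_snd) measurable_const).compl
    refine wasserstein_le_add_of_coupling h1 h2 (fun ω ω' => skorohodJ2_le_one hm _ _) ht0 le_rfl
      (hB1.union (hB2.union hB3)) (fun p hp => ?_) ?_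
    · simp only [Set.mem_union, Set.mem_ofPred_eq, not_or, not_not] at hp
      obtain ⟨hp1, hp2, hp3⟩ := hp
      obtain ⟨h4, h5⟩ := M.follows_elapse hm ht ht0 (ω := p.1.1) (ω' := p.2.1) (by rwa [hp2])
        (by rw [hp2, hp3]) hp1
      exact M.skorohodJ2_path_le hm h4 h5
    · rw [ENNReal.ofReal_zero, nonpos_iff_eq_zero]
      have e2 : ∀ᵐ p ∂ρ, p.1.1 0 = x := by
        have := M.ae_traceLaw_zero x
        rw [← h1] at this
        exact ae_of_ae_map measurable_fst.aemeasurable this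
      have e3 : ∀ᵐ p ∂ρ, p.2.1 0 = M.elapse x t := by
        have := M.ae_traceLaw_zero (M.elapse x t)
        rw [← h2] at this
        exact ae_of_ae_map measurable_snd.aemeasurable this
      exact measure_union_null (nonpos_iff_eq_zero.1 h3) (measure_union_null e2 e3)
  have hprops : M.propsOf x = M.propsOf (M.elapse x t) :=
    congrArg M.props (M.elapse_state x t).symm
  rw [add_zero] at hW
  rw [functional, if_pos hprops]
  exact (mul_le_of_le_one_left (wasserstein_nonneg _ _ _) hk1).trans hW

/-! ### Induction along the iterates, uniform limit and separability -/

theorem timeLipschitz_iter {k : ℝ} (hk0 : 0 ≤ k) (hk1 : k ≤ 1) (n : ℕ) :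
    M.TimeLipschitz (M.iter k n) := by
  induction n with
  | zero =>
    intro x t ht0 _
    have hprops : M.propsOf x = M.propsOf (M.elapse x t) :=
      congrArg M.props (M.elapse_state x t).symm
    exact (if_pos hprops).le.trans ht0
  | succ n ih =>
    exact M.timeLipschitz_functional hk1 (M.isStateMetric_iter hk0 hk1 n).toIsPseudometric ih

theorem finelyClassifiable_iter {k : ℝ} (hk0 : 0 ≤ k) (hk1 : k ≤ 1) (n : ℕ) :
    M.FinelyClassifiable (M.iter k n) := by
  induction n with
  | zero =>
    intro ε hε
    refine M.classifiable_state.mono fun x y h => ?_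
    exact (if_pos (congrArg M.props h : M.propsOf x = M.propsOf y)).le.trans hε.le
  | succ n ih =>
    exact M.finelyClassifiable_functional hk1 (M.isStateMetric_iter hk0 hk1 n).toIsPseudometric
      (M.timeLipschitz_iter hk0 hk1 n) ih

variable {M} in
-- One representative from each nonempty class at each scale `1 / (n + 1)` gives a countable dense
-- set.
theorem FinelyClassifiable.separable {m : M.GState → M.GState → ℝ} (hm : IsPseudometric m)
    (h : M.FinelyClassifiable m) : hm.Separable := by
  let _ := hm.toPseudoMetricSpace
  choose π _ hR using fun n : ℕ => h (1 / (n + 1)) (by positivity)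
  have hrep : ∀ (n : ℕ) (c : Set.range (π n)), ∃ x, π n x = c := fun n c => c.2
  choose r hr using hrep
  change TopologicalSpace.SeparableSpace M.GState
  refine ⟨⋃ n, Set.range (r n), Set.countable_iUnion fun n => Set.countable_range _, ?_⟩
  refine Metric.dense_iff.2 fun x ε hε => ?_
  obtain ⟨n, hn⟩ := exists_nat_one_div_lt hε
  refine ⟨r n ⟨π n x, x, rfl⟩, ?_, Set.mem_iUnion.2 ⟨n, _, rfl⟩⟩
  exact (hR n _ _ (hr n ⟨π n x, x, rfl⟩)).trans_lt hn

theorem finelyClassifiable_of_abs_sub_iter_le {k : ℝ} (hk0 : 0 < k) (hk1 : k < 1)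
    {m : M.GState → M.GState → ℝ}
    (h : ∀ (n : ℕ) (x y : M.GState), |m x y - M.iter k n x y| ≤ k ^ (n + 1) / (1 - k)) :
    M.FinelyClassifiable m := by
  intro ε hε
  obtain ⟨n, hn⟩ := ((Metric.tendstoUniformly_iff.1 (M.tendstoUniformly_iter hk0 hk1 h)) (ε / 2)
    (half_pos hε)).exists
  refine (M.finelyClassifiable_iter hk0.le hk1.le n (ε / 2) (half_pos hε)).mono fun x y hxy => ?_
  have := abs_lt.1 (Real.dist_eq _ _ ▸ hn (x, y))
  simp only at this
  linarith [this.2]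

end GSMP

/-! ### The main theorem -/

theorem mainTheorem5 {S E AP : Type*} [Fintype S] [Fintype E] (M : GSMP S E AP)
    (k : ℝ) (hk0 : 0 < k) (hk1 : k < 1) :
    ∃ (m : M.GState → M.GState → ℝ) (hm : M.IsMaxFixedPoint k m),
      hm.toIsPseudometric.Separable ∧
      (∀ (n : ℕ) (x y : M.GState), |M.iter k (n + 1) x y - M.iter k n x y| ≤ k ^ (n + 1)) ∧
      (∀ (n : ℕ) (x y : M.GState), |m x y - M.iter k n x y| ≤ k ^ (n + 1) / (1 - k)) ∧
      TendstoUniformly (fun n (p : M.GState × M.GState) => M.iter k n p.1 p.2)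
        (fun p => m p.1 p.2) atTop := by
  obtain ⟨m, hm, h⟩ := M.exists_isMaxFixedPoint hk0 hk1
  exact ⟨m, hm, (M.finelyClassifiable_of_abs_sub_iter_le hk0 hk1 h).separable _,
    M.abs_iter_succ_sub_le hk0.le hk1.le, h, M.tendstoUniformly_iter hk0 hk1 h⟩
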